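/- **Setting.** Let $n\ge 2$, let $U\subset\mathbb R^n$ be a bounded domain, $N\ge 1$, $0=\alpha_0<\alpha_1<\dots<\alpha_N$, $a=\frac{\alpha_N}{\alpha_N+1}\in(0,1)$ and $\kappa_0=\frac{a}{2-a}+\frac12$. Let $\phi:U\to(0,1]$ and $a_0,\dots,a_N:U\to[0,\infty)$ be measurable with $a_0,a_N>0$ and $a_N\in L^1(U)$. Put $g(x,s)=\sum_{j=0}^N a_j(x)s^{\alpha_j}$ and $K(x,\xi)=1/g(x,s(x,\xi))$, where $s(x,\xi)\ge0$ is the unique non-negative solution of $s\,g(x,s)=\xi$, and $$W_1(x)=\frac{a_N(x)^a}{2N\max_j a_j(x)},\qquad \|u\|_{L^q_w}=\Big(\int_U w|u|^q\,dx\Big)^{1/q}.$$ Call $u(x,t)$ *regular* if $u\in C^2((0,\infty);L^2_\phi(U))$ and $\nabla u\in C^1((0,\infty);L^2_{1/a_0}(U))$, where $\nabla u(t)$ and $\nabla u_t(t)=\partial_t\nabla u(t)$ are the weak gradients in $U$ of the locally integrable functions $u(t)$, $u_t(t)$. For $i=1,2$ let $p_i,\Psi_i$ be regular and such that $p_i$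 solves $$\phi\,p_t=\nabla\cdot\big(K(x,|\nabla p|)\nabla p\big)\ \text{ in }U\times(0,\infty),\qquad p=\Psi_i\ \text{ on }\partial U\times(0,\infty),\qquad p(\cdot,0)=p_{0,i}\in L^2_\phi(U),$$ in the following sense: for each $t>0$ the flux $K(x,|\nabla p_i|)\nabla p_i$ is locally integrable in $U$ and the equation holds in the sense of distributions on $U$; for each $t>0$, $\bar p_i:=p_i-\Psi_i$ is a limit of functions in $C_c^\infty(U)$ in the norm $\|u\|_{L^2_\phi}+\|\nabla u\|_{L^2_{1/a_0}}$; and $p_i(t)\to p_{0,i}$ in $L^2_\phi(U)$ as $t\to0^+$. Let $\bar P=\bar p_1-\bar p_2$, $\Phi=\Psi_1-\Psi_2$, and assume that with a constant $c_P>0$ the two-weight Poincaré–Sobolev inequality $$\|u\|_{L^2_\phi}\le c_P\,\|\nabla u\|_{L^{2-a}_{W_1}}$$ holds for $u=\bar p_1(t),\bar p_2(t),\bar P(t)$ and all $t>0$. For $\Psi=\Psi_1,\Psi_2$ let $$G[\Psi](t)=\max\Big\{\int_U a_N dx,1\Big\}+\int_U\frac{|\nabla\Psi|^2}{a_0}dx+\int_U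 W_1|\nabla\Psi|^{2-a}dx+\Big(\int_U|\Psi_t|^2\phi\,dx\Big)^{\frac{2-a}{2(1-a)}},$$ $$G_1[\Psi](t)=\int_U a_0^{-1}|\nabla\Psi_t|^2dx,\qquad G_2[\Psi](t)=\int_U|\Psi_{tt}|^2\phi\,dx,$$ and write $\tilde G,\tilde G_1,\tilde G_2$ for the sums over $\Psi_1,\Psi_2$. Let $$\tilde{\mathcal A}=\sum_{i=1}^2\limsup_{t\to\infty}G[\Psi_i](t),\qquad \tilde{\mathcal B}=\sum_{i=1}^2\limsup_{t\to\infty}\big[(G[\Psi_i])'(t)\big]^-,$$ $$D(t)=\int_U\frac{|\nabla\Phi|^2}{a_0}dx+\Big(\int_U\frac{|\nabla\Phi|^2}{a_0}dx\Big)^{1/2}+\Big(\int_U|\Phi_t|^2\phi\,dx\Big)^{1/2}.$$ Let $V$ be a function given for $t\ge1$ by one of the formulas $$V(t)=\tilde{\mathcal M}(t)^{\frac2{2-a}}+\int_{t-1}^t(\tilde G_1+\tilde G_2)\,d\tau\quad\text{(in general)},$$ $$V(t)=\tilde{\mathcal B}^{\frac1{1-a}}+\tilde G(t)^{\frac2{2-a}}+\int_{t-1}^t(\tilde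 G_1+\tilde G_2)\,d\tau\quad\text{(allowed when }G[\Psi_1],G[\Psi_2]\in C^1((0,\infty))\text{ and }\tilde{\mathcal B}<\infty),$$ where $\tilde{\mathcal M}=\mathcal M_1+\mathcal M_2$ and each $\mathcal M_i$ is any continuous increasing function on $[0,\infty)$ with $\mathcal M_i\ge G[\Psi_i]$. **Theorem.** There is a constant $C>0$, depending only on $U$, $n$, the exponents $\alpha_0,\dots,\alpha_N$ and $c_P$ (not on $\phi$, the coefficients $a_j$, the solutions, or the initial and boundary data), such that the following holds. If $\tilde{\mathcal A}=\infty$, $$\int_1^\infty V(t)^{-\frac a{2-a}}dt=\infty,$$ $V^{\frac{a}{2-a}}$ is differentiable for all large $t$, and $\lim_{t\to\infty}\big(V^{\frac a{2-a}}\big)'(t)=0$, then $$\limsup_{t\to\infty}\|\nabla\bar P(t)\|^2_{L^{2-a}_{W_1}}\le C\limsup_{t\to\infty}\Big[V(t)^{3\kappa_0}D(t)\Big]^{1/2}+C\limsup_{t\to\infty}\Big[V(t)^{\kappa_0}D(t)\Big],$$ where the limits superior are taken in $[0,\infty]$. -/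

import Mathlib

open MeasureTheory Filter Topology Set
open scoped ENNReal ContDiff

noncomputable section

namespace Forchheimer

/-- The space `ℝⁿ` with its Euclidean norm. -/
abbrev E (n : ℕ) := EuclideanSpace ℝ (Fin n)

/-! ## The generalized Forchheimer polynomial and the conductivity `K` -/

section Coefficients

variable {n N : ℕ}

/-- `g(x,s) = a₀(x) s^{α₀} + ⋯ + a_N(x) s^{α_N}`, for `s ≥ 0`. -/
def g (α : Fin (N + 1) → ℝ) (a : Fin (N + 1) → E n → ℝ) (x : E n) (s : ℝ) : ℝ :=
  ∑ j, a j x * s ^ α j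

/-- `s(x,ξ)`: the unique non-negative solution `s` of `s g(x,s) = ξ`
(the set below is a singleton for `ξ ≥ 0` and admissible coefficients). -/
def sSol (α : Fin (N + 1) → ℝ) (a : Fin (N + 1) → E n → ℝ) (x : E n) (ξ : ℝ) : ℝ :=
  sInf {s : ℝ | 0 ≤ s ∧ s * g α a x s = ξ}

/-- `K(x,ξ) = 1 / g(x, s(x,ξ))`. -/
def K (α : Fin (N + 1) → ℝ) (a : Fin (N + 1) → E n → ℝ) (x : E n) (ξ : ℝ) : ℝ :=
  1 / g α a x (sSol α a x ξ)

/-- The exponent `a = α_N / (α_N + 1)`. -/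
def aExp (α : Fin (N + 1) → ℝ) : ℝ := α (Fin.last N) / (α (Fin.last N) + 1)

/-- `κ₀ = a / (2 - a) + 1 / 2`. -/
def kappa0 (α : Fin (N + 1) → ℝ) : ℝ := aExp α / (2 - aExp α) + 1 / 2

/-- `M(x) = max_j a_j(x)`. -/
def maxCoeff (a : Fin (N + 1) → E n → ℝ) (x : E n) : ℝ :=
  Finset.univ.sup' Finset.univ_nonempty fun j => a j x

/-- The weight `W₁(x) = a_N(x)^a / (2 N M(x))`. -/
def W1 (α : Fin (N + 1) → ℝ) (a : Fin (N + 1) → E n → ℝ) (x : E n) : ℝ :=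
  a (Fin.last N) x ^ aExp α / (2 * N * maxCoeff a x)

/-- Admissible porosity and coefficient functions on `U`. The last clause says
`B₁ = ∫_U a_N dx < ∞`. -/
structure IsMedium (U : Set (E n)) (φ : E n → ℝ) (a : Fin (N + 1) → E n → ℝ) : Prop where
  porosity_meas : AEMeasurable φ (volume.restrict U)
  porosity_pos : ∀ x ∈ U, 0 < φ x
  porosity_le : ∀ x ∈ U, φ x ≤ 1
  coeff_meas : ∀ j, AEMeasurable (a j) (volume.restrict U)
  coeff_nonneg : ∀ j, ∀ x ∈ U, 0 ≤ a j x
  coeff_zero_pos : ∀ x ∈ U, 0 < a 0 x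
  coeff_last_pos : ∀ x ∈ U, 0 < a (Fin.last N) x
  coeff_last_int : IntegrableOn (a (Fin.last N)) U

end Coefficients

/-! ## Weighted integrals, weak gradients, regular time-dependent functions -/

section Spaces

variable {n : ℕ}

/-- `∫_U w |u|^q dx`. -/
def wInt {F : Type*} [NormedAddCommGroup F] (U : Set (E n)) (w : E n → ℝ) (q : ℝ)
    (u : E n → F) : ℝ :=
  ∫ x in U, w x * ‖u x‖ ^ q

/-- The weighted norm `‖u‖_{L^q_w(U)} = (∫_U w |u|^q dx)^{1/q}`, with values in `[0,∞]`. -/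
def wNorm {F : Type*} [NormedAddCommGroup F] (U : Set (E n)) (w : E n → ℝ) (q : ℝ)
    (u : E n → F) : ℝ≥0∞ :=
  (∫⁻ x in U, ENNReal.ofReal (w x * ‖u x‖ ^ q)) ^ (1 / q)

/-- The measure `w dx` on `U`; `Lp F 2 (wMeasure U w)` is `L²_w(U)`. -/
def wMeasure (U : Set (E n)) (w : E n → ℝ) : Measure (E n) :=
  (volume.restrict U).withDensity fun x => ENNReal.ofReal (w x)

/-- Test functions `ζ ∈ C_c^∞(U)`. -/
structure IsTest (U : Set (E n)) (ζ : E n → ℝ) : Prop where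
  smooth : ContDiff ℝ ∞ ζ
  compact : HasCompactSupport ζ
  supp : tsupport ζ ⊆ U

/-- `v` is the weak (distributional) gradient of `u` in `U`. -/
structure HasWeakGrad (U : Set (E n)) (u : E n → ℝ) (v : E n → E n) : Prop where
  locInt : LocallyIntegrableOn u U
  locInt_grad : LocallyIntegrableOn v U
  parts : ∀ ζ, IsTest U ζ → ∀ e : E n,
    ∫ x in U, u x * fderiv ℝ ζ x e = - ∫ x in U, inner ℝ (v x) e * ζ x

/-- The pair `(u, ∇u)` lies in the closure of `C_c^∞(U)` with respect to
`‖u‖²_{L²_φ} + ‖∇u‖²_{L²_{1/a₀}}`: the weighted form of "`u = 0` on `∂U`". -/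
def VanishesOnBdry (U : Set (E n)) (φ a₀ : E n → ℝ) (u : E n → ℝ) (gu : E n → E n) : Prop :=
  ∀ ε : ℝ≥0∞, 0 < ε → ∃ ζ, IsTest U ζ ∧
    wNorm U φ 2 (fun x => u x - ζ x) +
      wNorm U (fun x => (a₀ x)⁻¹) 2 (fun x => gu x - gradient ζ x) < ε

/-- `t ↦ u(·,t)` is a `C¹` curve in `L²(μ)` on `(0,∞)` and `u'` is its time derivative. -/
def IsC1Curve {F : Type*} [NormedAddCommGroup F] [NormedSpace ℝ F] (μ : Measure (E n))
    (u u' : ℝ → E n → F) : Prop :=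
  ∃ c c' : ℝ → Lp F 2 μ,
    (∀ t > 0, (c t : E n → F) =ᵐ[μ] u t) ∧ (∀ t > 0, (c' t : E n → F) =ᵐ[μ] u' t) ∧
    (∀ t > 0, HasDerivAt c (c' t) t) ∧ ContinuousOn c' (Ioi 0)

/-- A regular time-dependent function `u(x,t)` together with `u_t`, `u_tt`, `∇u`, `∇u_t`:
`u ∈ C²((0,∞); L²_φ(U))` and `∇u ∈ C¹((0,∞); L²_{1/a₀}(U))`. -/
structure RegFun (U : Set (E n)) (φ a₀ : E n → ℝ) where
  val : ℝ → E n → ℝ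
  dt : ℝ → E n → ℝ
  dtt : ℝ → E n → ℝ
  grad : ℝ → E n → E n
  gradDt : ℝ → E n → E n
  val_curve : IsC1Curve (wMeasure U φ) val dt
  dt_curve : IsC1Curve (wMeasure U φ) dt dtt
  grad_curve : IsC1Curve (wMeasure U fun x => (a₀ x)⁻¹) grad gradDt
  grad_spec : ∀ t > 0, HasWeakGrad U (val t) (grad t)
  gradDt_spec : ∀ t > 0, HasWeakGrad U (dt t) (gradDt t)

end Spaces

/-! ## Solutions of the initial boundary value problem -/

section Problem

variable {n N : ℕ} {U : Set (E n)} {φ : E n → ℝ} {a : Fin (N + 1) → E n → ℝ}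

/-- `p` solves `φ p_t = ∇·(K(x,|∇p|)∇p)` in `U × (0,∞)` (for each `t > 0`, in the sense of
distributions on `U`), `p = Ψ` on `∂U × (0,∞)`, and `p(·,0) = p₀`. -/
structure IsSolution (α : Fin (N + 1) → ℝ) (p Ψ : RegFun U φ (a 0)) (p₀ : E n → ℝ) : Prop where
  flux_locInt : ∀ t > 0,
    LocallyIntegrableOn (fun x => K α a x ‖p.grad t x‖ • p.grad t x) U
  pde : ∀ t > 0, ∀ ζ, IsTest U ζ →
    ∫ x in U, φ x * p.dt t x * ζ x =
      - ∫ x in U, K α a x ‖p.grad t x‖ * inner ℝ (p.grad t x) (gradient ζ x)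
  bdry : ∀ t > 0, VanishesOnBdry U φ (a 0)
    (fun x => p.val t x - Ψ.val t x) (fun x => p.grad t x - Ψ.grad t x)
  init_mem : MemLp p₀ 2 (wMeasure U φ)
  init : Tendsto (fun t => wNorm U φ 2 (fun x => p.val t x - p₀ x)) (𝓝[>] 0) (𝓝 0)

/-- The weighted Poincaré–Sobolev inequality
`(∫_U u² φ dx)^{1/2} ≤ c_P (∫_U W₁ |∇u|^{2-a} dx)^{1/(2-a)}` for one function `u`. -/
def PoincareSobolev (U : Set (E n)) (φ : E n → ℝ) (α : Fin (N + 1) → ℝ)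
    (a : Fin (N + 1) → E n → ℝ) (cP : ℝ) (u : E n → ℝ) (gu : E n → E n) : Prop :=
  wNorm U φ 2 u ≤ ENNReal.ofReal cP * wNorm U (W1 α a) (2 - aExp α) gu

/-- `G[Ψ](t)`, where `B_* = max{∫_U a_N dx, 1}`. -/
def G (α : Fin (N + 1) → ℝ) (Ψ : RegFun U φ (a 0)) (t : ℝ) : ℝ :=
  max (∫ x in U, a (Fin.last N) x) 1
    + wInt U (fun x => (a 0 x)⁻¹) 2 (Ψ.grad t)
    + wInt U (W1 α a) (2 - aExp α) (Ψ.grad t)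
    + wInt U φ 2 (Ψ.dt t) ^ ((2 - aExp α) / (2 * (1 - aExp α)))

/-- `G₁[Ψ](t) = ∫_U a₀⁻¹ |∇Ψ_t|² dx`. -/
def G1 (Ψ : RegFun U φ (a 0)) (t : ℝ) : ℝ := wInt U (fun x => (a 0 x)⁻¹) 2 (Ψ.gradDt t)

/-- `G₂[Ψ](t) = ∫_U |Ψ_tt|² φ dx`. -/
def G2 (Ψ : RegFun U φ (a 0)) (t : ℝ) : ℝ := wInt U φ 2 (Ψ.dtt t)

/-- `𝓐[Ψ] = limsup_{t→∞} G[Ψ](t) ∈ [0,∞]`. -/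
def limA (α : Fin (N + 1) → ℝ) (Ψ : RegFun U φ (a 0)) : ℝ≥0∞ :=
  limsup (fun t => ENNReal.ofReal (G α Ψ t)) atTop

/-- `𝓑[Ψ] = limsup_{t→∞} [G[Ψ]'(t)]⁻ ∈ [0,∞]`. -/
def limB (α : Fin (N + 1) → ℝ) (Ψ : RegFun U φ (a 0)) : ℝ≥0∞ :=
  limsup (fun t => ENNReal.ofReal (-deriv (G α Ψ) t)) atTop

/-- `𝓜` is a continuous increasing function on `[0,∞)` with `𝓜 ≥ G[Ψ]`. -/
structure IsMajorant (α : Fin (N + 1) → ℝ) (Ψ : RegFun U φ (a 0)) (M : ℝ → ℝ) : Prop where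
  cont : ContinuousOn M (Ici 0)
  mono : MonotoneOn M (Ici 0)
  ge : ∀ t, 0 ≤ t → G α Ψ t ≤ M t

/-- `∫_{t-1}^t (G̃₁(τ) + G̃₂(τ)) dτ`. -/
def intG12 (Ψ₁ Ψ₂ : RegFun U φ (a 0)) (t : ℝ) : ℝ :=
  ∫ τ in (t - 1)..t, ((G1 Ψ₁ τ + G1 Ψ₂ τ) + (G2 Ψ₁ τ + G2 Ψ₂ τ))

/-- `V` is given by the general formula, for some choice of the majorants `𝓜[Ψ₁]`, `𝓜[Ψ₂]`. -/
def IsGeneralV (α : Fin (N + 1) → ℝ) (Ψ₁ Ψ₂ : RegFun U φ (a 0)) (V : ℝ → ℝ) : Prop :=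
  ∃ M₁ M₂ : ℝ → ℝ, IsMajorant α Ψ₁ M₁ ∧ IsMajorant α Ψ₂ M₂ ∧
    ∀ t, 1 ≤ t → V t = (M₁ t + M₂ t) ^ (2 / (2 - aExp α)) + intG12 Ψ₁ Ψ₂ t

/-- `G[Ψ₁], G[Ψ₂] ∈ C¹((0,∞))`, `𝓑̃ = 𝓑[Ψ₁] + 𝓑[Ψ₂] < ∞`, and `V` is given by the formula for
that case. -/
def IsFiniteBV (α : Fin (N + 1) → ℝ) (Ψ₁ Ψ₂ : RegFun U φ (a 0)) (V : ℝ → ℝ) : Prop :=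
  ContDiffOn ℝ 1 (G α Ψ₁) (Ioi 0) ∧ ContDiffOn ℝ 1 (G α Ψ₂) (Ioi 0) ∧
  limB α Ψ₁ + limB α Ψ₂ < ⊤ ∧
    ∀ t, 1 ≤ t → V t = (limB α Ψ₁ + limB α Ψ₂).toReal ^ (1 / (1 - aExp α))
      + (G α Ψ₁ t + G α Ψ₂ t) ^ (2 / (2 - aExp α)) + intG12 Ψ₁ Ψ₂ t

/-- `D(t) = ∫ a₀⁻¹|∇Φ|² + (∫ a₀⁻¹|∇Φ|²)^{1/2} + (∫ |Φ_t|² φ)^{1/2}` with `Φ = Ψ₁ - Ψ₂`. -/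
def D (Ψ₁ Ψ₂ : RegFun U φ (a 0)) (t : ℝ) : ℝ :=
  wInt U (fun x => (a 0 x)⁻¹) 2 (fun x => Ψ₁.grad t x - Ψ₂.grad t x)
    + wInt U (fun x => (a 0 x)⁻¹) 2 (fun x => Ψ₁.grad t x - Ψ₂.grad t x) ^ (1 / 2 : ℝ)
    + wInt U φ 2 (fun x => Ψ₁.dt t x - Ψ₂.dt t x) ^ (1 / 2 : ℝ)

/-- `p̄ = p - Ψ`. -/
def bar (p Ψ : RegFun U φ (a 0)) (t : ℝ) (x : E n) : ℝ := p.val t x - Ψ.val t x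

/-- `∇p̄ = ∇p - ∇Ψ`. -/
def gradBar (p Ψ : RegFun U φ (a 0)) (t : ℝ) (x : E n) : E n := p.grad t x - Ψ.grad t x

end Problem

end Forchheimer

end

open Forchheimer

/-
The difference `P̄` of the solutions is estimated through `w = ‖P̄‖²` in `L²_φ`. The monotonicity
of the flux and Hölder's inequality with the weight `W₁` bound `‖∇P̄‖²` by
`C (∫ a_N + ∫ K(x,|∇p₁|)|∇p₁|² + ∫ K(x,|∇p₂|)|∇p₂|²)^γ S` with `γ = a / (2 - a)`, where `S` is the
monotonicity term, which testing the equations with `P̄` identifies with `-w' / 2` up to the data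
`D`.

The dissipations are bounded by `V`: the energy and Poincaré inequalities give
`y' ≤ -c y^{1 - a/2} + C G` for `y = ‖p̄ᵢ‖²`, and supersolutions built from `G` bound `y` by `V`;
time-weighted energies on `[t - 1, t]` transfer this bound to the dissipation and to `∂ₜ p̄ᵢ`.

Hence `w' ≤ -c V^{-γ} w + C V^{1/2} D`. As `∫ V^{-γ} = ∞` and `(V^γ)' → 0`, an inequality of the
same kind holds for `V^{2κ₀} w`, so that its limit superior is at most a multiple of that of
`V^{3κ₀} D`. Inserting this into `‖∇P̄‖² ≤ C V^γ (|w'| + V^{1/2} D)`, where `|w'| ≤ C (V w)^{1/2}`,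
gives the two terms of the estimate.
-/

noncomputable section

namespace Forchheimer

theorem one_sub_rpow_le_mul_one_sub {r β : ℝ} (h0 : 0 ≤ r) (h1 : r ≤ 1) (hβ : 0 ≤ β) :
    1 - r ^ β ≤ (1 + β) * (1 - r) := by
  rcases le_total 1 β with h | h
  · have := one_add_mul_self_le_rpow_one_add (s := r - 1) (by linarith) h
    rw [add_sub_cancel] at this
    nlinarith
  · have : r ≤ r ^ β := by
      rcases h0.eq_or_lt with rfl | h0
      · exact Real.rpow_nonneg le_rfl _
      · simpa using Real.rpow_le_rpow_of_exponent_ge h0 h1 h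
    nlinarith

theorem rpow_sub_rpow_mul_le {s t β : ℝ} (hs : 0 ≤ s) (hst : s ≤ t) (hβ : 0 ≤ β) :
    (t ^ β - s ^ β) * s ≤ (1 + β) * t ^ β * (t - s) := by
  rcases (hs.trans hst).eq_or_lt with rfl | ht
  · obtain rfl : s = 0 := le_antisymm hst hs
    simp
  have hr0 : 0 ≤ s / t := by positivity
  have hr1 : s / t ≤ 1 := (div_le_one ht).2 hst
  have h := one_sub_rpow_le_mul_one_sub hr0 hr1 hβ
  have hsr : s ^ β = (s / t) ^ β * t ^ β := by
    rw [← Real.mul_rpow hr0 ht.le, div_mul_cancel₀ _ ht.ne']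
  calc (t ^ β - s ^ β) * s = t ^ β * s * (1 - (s / t) ^ β) := by rw [hsr]; ring
    _ ≤ t ^ β * s * ((1 + β) * (1 - s / t)) := by gcongr
    _ ≤ t ^ β * t * ((1 + β) * (1 - s / t)) := by
        have : 0 ≤ (1 + β) * (1 - s / t) := mul_nonneg (by linarith) (by linarith)
        gcongr
    _ = _ := by field_simp

theorem mul_mul_rpow_sub_rpow_le {s t β : ℝ} (hs : 0 ≤ s) (ht : 0 ≤ t) (hβ : 0 ≤ β) :
    s * (t * t ^ β) - s ^ (β + 2)
      ≤ (β + 1) / (β + 2) * t ^ (β + 2) - (β + 1) / (β + 2) * s ^ (β + 2) := by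
  have hconj : (β + 2).HolderConjugate ((β + 2) / (β + 1)) := by
    rw [Real.holderConjugate_iff]
    refine ⟨by linarith, ?_⟩
    field_simp
    ring
  have hyoung := Real.young_inequality_of_nonneg hs (Real.rpow_nonneg ht (β + 1)) hconj
  have ht_pow : (t ^ (β + 1)) ^ ((β + 2) / (β + 1)) = t ^ (β + 2) := by
    rw [← Real.rpow_mul ht, mul_div_cancel₀ _ (by positivity)]
  rw [ht_pow, Real.rpow_add_of_nonneg ht hβ zero_le_one, Real.rpow_one] at hyoung
  have hs_div : s ^ (β + 2) / (β + 2) = s ^ (β + 2) - (β + 1) / (β + 2) * s ^ (β + 2) := by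
    field_simp; ring
  have ht_div : t ^ (β + 2) / ((β + 2) / (β + 1)) = (β + 1) / (β + 2) * t ^ (β + 2) := by
    field_simp
  linarith

/-- The constant `C` in Young's inequality `2pq ≤ δ q^{2-b} + C p^{(2-b)/(1-b)}`. -/
def youngConst (b δ : ℝ) : ℝ :=
  (2 / (δ * (2 - b)) ^ (1 / (2 - b))) ^ ((2 - b) / (1 - b)) / ((2 - b) / (1 - b))

theorem youngConst_nonneg {b δ : ℝ} (hb1 : b < 1) (hδ : 0 < δ) : 0 ≤ youngConst b δ := by
  unfold youngConst
  have : 0 < 2 - b := by linarith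
  have : 0 < 1 - b := by linarith
  positivity

theorem two_mul_le_young {b δ p q : ℝ} (hb1 : b < 1) (hδ : 0 < δ) (hp : 0 ≤ p) (hq : 0 ≤ q) :
    2 * p * q ≤ δ * q ^ (2 - b) + youngConst b δ * p ^ ((2 - b) / (1 - b)) := by
  have h2b : 0 < 2 - b := by linarith
  have : 0 < 1 - b := by linarith
  have hconj : (2 - b).HolderConjugate ((2 - b) / (1 - b)) := by
    rw [Real.holderConjugate_iff]
    refine ⟨by linarith, ?_⟩
    field_simp
    ring
  set l := (δ * (2 - b)) ^ (1 / (2 - b)) with hl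
  have hl0 : 0 < l := by positivity
  have hl_pow : l ^ (2 - b) = δ * (2 - b) := by
    rw [hl, ← Real.rpow_mul (by positivity), one_div_mul_cancel h2b.ne', Real.rpow_one]
  have hyoung := Real.young_inequality_of_nonneg (a := l * q) (b := 2 / l * p) (by positivity)
    (by positivity) hconj
  rw [Real.mul_rpow hl0.le hq, Real.mul_rpow (by positivity) hp, hl_pow] at hyoung
  calc 2 * p * q = l * q * (2 / l * p) := by field_simp
    _ ≤ _ := hyoung
    _ = _ := by rw [youngConst, ← hl]; field_simp

theorem rpow_mul_le_mul_add_mul_rpow {γ ε x z : ℝ} (hγ0 : 0 ≤ γ) (hγ1 : γ < 1) (hε : 0 < ε)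
    (hx : 0 ≤ x) (hz : 0 ≤ z) :
    x ^ γ * z ≤ ε * x + ε ^ (-(γ / (1 - γ))) * z ^ (1 / (1 - γ)) := by
  have h1γ : 0 < 1 - γ := by linarith
  set r := ε ^ (-(γ / (1 - γ))) * z ^ (1 / (1 - γ)) with hr
  have hr0 : 0 ≤ r := by positivity
  have hεx : 0 ≤ ε * x := by positivity
  have hmean := Real.geom_mean_le_arith_mean2_weighted hγ0 h1γ.le hεx hr0 (by ring)
  have hprod : (ε * x) ^ γ * r ^ (1 - γ) = x ^ γ * z := by
    rw [hr, Real.mul_rpow hε.le hx, Real.mul_rpow (by positivity) (by positivity),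
      ← Real.rpow_mul hε.le, ← Real.rpow_mul hz, one_div_mul_cancel h1γ.ne', Real.rpow_one,
      neg_mul, div_mul_cancel₀ _ h1γ.ne', Real.rpow_neg hε.le]
    have := Real.rpow_pos_of_pos hε γ
    field_simp
  rw [hprod] at hmean
  nlinarith

theorem le_rpow_two_div_two_sub {b x : ℝ} (hb0 : 0 ≤ b) (hb2 : b < 2) (hx : 1 ≤ x) :
    x ≤ x ^ (2 / (2 - b)) := by
  refine Real.self_le_rpow_of_one_le hx ?_
  rw [le_div_iff₀ (by linarith)]
  linarith

theorem add_rpow_le_two_rpow_mul_add {x y q : ℝ} (hx : 0 ≤ x) (hy : 0 ≤ y) (hq : 1 ≤ q) :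
    (x + y) ^ q ≤ 2 ^ (q - 1) * (x ^ q + y ^ q) := by
  lift x to NNReal using hx
  lift y to NNReal using hy
  exact_mod_cast NNReal.rpow_add_le_mul_rpow_add_rpow x y hq

theorem add_sq_le_two_mul_add (x y : ℝ≥0∞) : (x + y) ^ 2 ≤ 2 * (x ^ 2 + y ^ 2) := by
  have h := ENNReal.rpow_add_le_mul_rpow_add_rpow x y one_le_two
  rwa [show (2 : ℝ) - 1 = 1 by norm_num, ENNReal.rpow_one, ENNReal.rpow_two, ENNReal.rpow_two,
    ENNReal.rpow_two] at h

theorem le_ofReal_rpow_of_sq_le {x : ℝ≥0∞} {b r q T : ℝ} (hb0 : 0 ≤ b) (hb2 : b < 2) (hr : 0 ≤ r)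
    (hq : 0 ≤ q) (hrT : r ≤ T) (hqT : q ≤ T) (hx : x ^ 2 ≤ ENNReal.ofReal (r * q ^ (b / (2 - b)))) :
    x ≤ ENNReal.ofReal (T ^ (1 / (2 - b))) := by
  have h2 : 0 < 2 - b := by linarith
  have hT : 0 ≤ T := hr.trans hrT
  have hexp : 1 + b / (2 - b) = 1 / (2 - b) * (2 : ℕ) := by
    field_simp
    push_cast
    ring
  have hsq : T * T ^ (b / (2 - b)) = (T ^ (1 / (2 - b))) ^ 2 := by
    rw [← Real.rpow_natCast, ← Real.rpow_mul hT, ← hexp,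
      Real.rpow_add_of_nonneg hT zero_le_one (by positivity), Real.rpow_one]
  refine (ENNReal.pow_le_pow_left_iff two_ne_zero).1 (hx.trans ?_)
  rw [← ENNReal.ofReal_pow (by positivity), ← hsq]
  gcongr

section DifferentialInequalities

variable {y y' z z' : ℝ → ℝ} {T : ℝ}

theorem exists_ge_neg_lt_of_hasDerivAt_of_le {m κ : ℝ} (hκ : 0 < κ)
    (hd : ∀ t ≥ T, HasDerivAt y (y' t) t) (hy : ∀ t ≥ T, m ≤ y t) : ∃ t ≥ T, -κ < y' t := by
  by_contra! hle
  have hlin := (convex_Ici T).image_sub_le_mul_sub_of_deriv_le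
    (fun t ht => (hd t ht).continuousAt.continuousWithinAt)
    (fun t ht => (hd t (interior_subset ht)).differentiableAt.differentiableWithinAt)
    (fun t ht => (hd t (interior_subset ht)).deriv.trans_le (hle t (interior_subset ht)))
  have hy_T : 0 ≤ y T - m := by linarith [hy T le_rfl]
  have hs : T ≤ T + ((y T - m) / κ + 1) := by
    have : 0 ≤ (y T - m) / κ := by positivity
    linarith
  have hdrop := hlin T self_mem_Ici _ hs hs
  have hcancel : -κ * (T + ((y T - m) / κ + 1) - T) = -(y T - m) - κ := by field_simp; ring
  linarith [hy _ hs]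

theorem eventually_le_of_deriv_le_sub {κ : ℝ} (hκ : 0 < κ)
    (hy : ∀ t ≥ T, HasDerivAt y (y' t) t) (hz : ∀ t ≥ T, HasDerivAt z (z' t) t)
    (hle : ∀ t ≥ T, z t ≤ y t → y' t ≤ z' t - κ) : ∀ᶠ t in atTop, y t ≤ z t := by
  obtain ⟨T', hT', hT'_le⟩ : ∃ T' ≥ T, y T' ≤ z T' := by
    by_contra! hlt
    obtain ⟨t, ht, hneg⟩ := exists_ge_neg_lt_of_hasDerivAt_of_le hκ
      (fun t ht => (hy t ht).fun_sub (hz t ht)) (fun t ht => (sub_pos.2 (hlt t ht)).le)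
    linarith [hle t ht (hlt t ht).le]
  filter_upwards [eventually_ge_atTop T'] with t ht
  refine image_le_of_deriv_right_lt_deriv_boundary' (a := T') (b := t) (f' := y') (B' := z')
    (fun s hs => (hy s (hT'.trans hs.1)).continuousAt.continuousWithinAt)
    (fun s hs => (hy s (hT'.trans hs.1)).hasDerivWithinAt) hT'_le
    (fun s hs => (hz s (hT'.trans hs.1)).continuousAt.continuousWithinAt)
    (fun s hs => (hz s (hT'.trans hs.1)).hasDerivWithinAt) ?_ (right_mem_Icc.2 ht)
  intro s hs heq
  linarith [hle s (hT'.trans hs.1) heq.ge]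

theorem eventually_le_mul_rpow_of_monotoneOn {θ c C₀ : ℝ} {M : ℝ → ℝ} (hθ : 0 < θ) (hc : 0 < c)
    (hC₀ : 0 < C₀) (hy0 : ∀ t > 0, 0 ≤ y t) (hd : ∀ t > 0, HasDerivAt y (y' t) t)
    (hle : ∀ t > 0, y' t ≤ -c * y t ^ θ + C₀ * M t) (hM1 : ∀ t > 0, 1 ≤ M t)
    (hmono : MonotoneOn M (Ioi 0)) :
    ∀ᶠ t in atTop, y t ≤ (2 * C₀ / c) ^ (1 / θ) * M t ^ (1 / θ) := by
  set A := (2 * C₀ / c) ^ (1 / θ) with hA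
  have hpow : ∀ t > 0, c * (A * M t ^ (1 / θ)) ^ θ = 2 * C₀ * M t := fun t ht => by
    have hMt : 0 ≤ M t := zero_le_one.trans (hM1 t ht)
    rw [Real.mul_rpow (by positivity) (by positivity), hA, ← Real.rpow_mul (by positivity),
      ← Real.rpow_mul hMt, one_div_mul_cancel hθ.ne', Real.rpow_one, Real.rpow_one]
    field_simp
  have hdecay : ∀ s > 0, ∀ t ≥ s, A * M t ^ (1 / θ) ≤ y s → y' s ≤ -C₀ := by
    intro s hs t hst hys
    have hMt := hM1 t (hs.trans_le hst)
    have hy_pow := mul_le_mul_of_nonneg_left (Real.rpow_le_rpow (by positivity) hys hθ.le) hc.le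
    rw [hpow t (hs.trans_le hst)] at hy_pow
    have hMs : C₀ * M s ≤ C₀ * M t :=
      mul_le_mul_of_nonneg_left (hmono hs (hs.trans_le hst) hst) hC₀.le
    nlinarith [hle s hs]
  obtain ⟨T, hT, hyT⟩ : ∃ T ≥ 1, y T ≤ A * M T ^ (1 / θ) := by
    by_contra! hlt
    obtain ⟨t, ht, hneg⟩ := exists_ge_neg_lt_of_hasDerivAt_of_le hC₀
      (fun t ht => hd t (zero_lt_one.trans_le ht)) (fun t ht => hy0 t (zero_lt_one.trans_le ht))
    linarith [hdecay t (by linarith) t le_rfl (hlt t ht).le]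
  filter_upwards [eventually_ge_atTop T] with t ht
  have hpos : ∀ s ≥ T, 0 < s := fun s hs => by linarith
  have hM_le : M T ^ (1 / θ) ≤ M t ^ (1 / θ) :=
    Real.rpow_le_rpow (zero_le_one.trans (hM1 T (hpos T le_rfl)))
      (hmono (hpos T le_rfl) (hpos t ht) ht) (by positivity)
  refine image_le_of_deriv_right_lt_deriv_boundary' (B := fun _ => A * M t ^ (1 / θ))
    (B' := fun _ => 0) (a := T) (b := t) (f' := y')
    (fun s hs => (hd s (hpos s hs.1)).continuousAt.continuousWithinAt)
    (fun s hs => (hd s (hpos s hs.1)).hasDerivWithinAt)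
    (hyT.trans (mul_le_mul_of_nonneg_left hM_le (by positivity))) continuousOn_const
    (fun s _ => hasDerivWithinAt_const _ _ _) (fun s hs heq => ?_) (right_mem_Icc.2 ht)
  linarith [hdecay s (hpos s hs.1) t hs.2.le heq.ge]

/-- `A x^{1/θ} + B β^{1/(2θ-1)}` is a supersolution of `z' = -(c/2) z^θ + C₀ x` as long as `x`
decreases at rate at most `β`. -/
theorem exists_supersolution {θ c C₀ : ℝ} (hθ : 1 / 2 < θ) (hθ1 : θ ≤ 1) (hc : 0 < c)
    (hC₀ : 0 < C₀) :
    ∃ A > 0, ∃ B > 0, ∀ x x' β : ℝ, 0 ≤ x → 0 ≤ β → -β ≤ x' →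
      C₀ * x - c / 2 * (A * x ^ (1 / θ) + B * β ^ (1 / (2 * θ - 1))) ^ θ
        ≤ A * (x' * (1 / θ) * x ^ (1 / θ - 1)) := by
  have hθ0 : 0 < θ := by linarith
  have h2θ : 0 < 2 * θ - 1 := by linarith
  have hγ0 : 0 ≤ 1 / θ - 1 := by rw [sub_nonneg, one_le_div hθ0]; exact hθ1
  have hγ1 : 1 / θ - 1 < 1 := by rw [sub_lt_iff_lt_add, div_lt_iff₀ hθ0]; linarith
  have exists_pow_eq : ∀ k > 0, ∃ A > 0, c / 4 * A ^ θ = k := fun k hk => by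
    refine ⟨(4 * k / c) ^ (1 / θ), by positivity, ?_⟩
    rw [← Real.rpow_mul (by positivity), one_div_mul_cancel hθ0.ne', Real.rpow_one]
    field_simp
  obtain ⟨A, hA, hA_pow⟩ := exists_pow_eq (2 * C₀) (by positivity)
  set k := A / θ * (C₀ * θ / A) ^ (-((1 / θ - 1) / (1 - (1 / θ - 1)))) with hk
  obtain ⟨B, hB, hB_pow⟩ := exists_pow_eq k (by positivity)
  refine ⟨A, hA, B, hB, fun x x' β hx hβ hx' => ?_⟩
  have hexp : 1 / (1 - (1 / θ - 1)) = 1 / (2 * θ - 1) * θ := by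
    have : 1 - (1 / θ - 1) = (2 * θ - 1) / θ := by field_simp; ring
    rw [this]; field_simp
  have hyoung : A / θ * (x ^ (1 / θ - 1) * β) ≤ C₀ * x + k * β ^ (1 / (2 * θ - 1) * θ) := by
    have h := rpow_mul_le_mul_add_mul_rpow hγ0 hγ1 (by positivity : 0 < C₀ * θ / A) hx hβ
    rw [hexp] at h
    refine (mul_le_mul_of_nonneg_left h (by positivity : 0 ≤ A / θ)).trans_eq ?_
    rw [hk]; field_simp
  have hfst : 2 * C₀ * x ≤ c / 4 * (A * x ^ (1 / θ) + B * β ^ (1 / (2 * θ - 1))) ^ θ := by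
    calc 2 * C₀ * x = c / 4 * (A * x ^ (1 / θ)) ^ θ := by
          rw [Real.mul_rpow hA.le (by positivity), ← Real.rpow_mul hx, one_div_mul_cancel hθ0.ne',
            Real.rpow_one, ← mul_assoc, hA_pow]
      _ ≤ _ := by gcongr; exact le_add_of_nonneg_right (by positivity)
  have hsnd : k * β ^ (1 / (2 * θ - 1) * θ)
      ≤ c / 4 * (A * x ^ (1 / θ) + B * β ^ (1 / (2 * θ - 1))) ^ θ := by
    calc k * β ^ (1 / (2 * θ - 1) * θ) = c / 4 * (B * β ^ (1 / (2 * θ - 1))) ^ θ := by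
          rw [Real.mul_rpow hB.le (by positivity), ← Real.rpow_mul hβ, ← mul_assoc, hB_pow]
      _ ≤ _ := by gcongr; exact le_add_of_nonneg_left (by positivity)
  have hderiv : -(A / θ * (x ^ (1 / θ - 1) * β)) ≤ A * (x' * (1 / θ) * x ^ (1 / θ - 1)) := by
    have := mul_le_mul_of_nonneg_left hx' (by positivity : 0 ≤ A / θ * x ^ (1 / θ - 1))
    calc _ = A / θ * x ^ (1 / θ - 1) * -β := by ring
      _ ≤ _ := this
      _ = _ := by ring
  linarith

theorem exists_eventually_le_of_deriv_ge {θ c C₀ : ℝ} (hθ : 1 / 2 < θ) (hθ1 : θ ≤ 1) (hc : 0 < c)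
    (hC₀ : 0 < C₀) :
    ∃ A > 0, ∀ (y y' G G' : ℝ → ℝ) (β : ℝ), 0 ≤ β →
      (∀ t > 0, HasDerivAt y (y' t) t) → (∀ t > 0, y' t ≤ -c * y t ^ θ + C₀ * G t) →
      (∀ t > 0, 1 ≤ G t) → (∀ t > 0, HasDerivAt G (G' t) t) → (∀ᶠ t in atTop, -β ≤ G' t) →
      ∀ᶠ t in atTop, y t ≤ A * (G t ^ (1 / θ) + β ^ (1 / (2 * θ - 1))) := by
  have : 0 < θ := by linarith
  obtain ⟨A, hA, B, hB, hsuper⟩ := exists_supersolution hθ hθ1 hc hC₀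
  refine ⟨A + B, by positivity, fun y y' G G' β hβ hd hle hG1 hGd hG' => ?_⟩
  set z : ℝ → ℝ := fun t => A * G t ^ (1 / θ) + B * β ^ (1 / (2 * θ - 1)) with hz
  have hzd : ∀ t > 0, HasDerivAt z (A * (G' t * (1 / θ) * G t ^ (1 / θ - 1))) t := fun t ht =>
    (((hGd t ht).rpow_const (Or.inl (by linarith [hG1 t ht]))).const_mul A).add_const _
  have hAz : ∀ t > 0, A ≤ z t := fun t ht => by
    have hβ_pow : 0 ≤ B * β ^ (1 / (2 * θ - 1)) := by positivity
    have := le_mul_of_one_le_right hA.le (Real.one_le_rpow (hG1 t ht) (by positivity : 0 ≤ 1 / θ))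
    simp only [hz]
    linarith
  obtain ⟨T, hT⟩ := (hG'.and (eventually_gt_atTop 0)).exists_forall_of_atTop
  have hyz : ∀ᶠ t in atTop, y t ≤ z t := by
    refine eventually_le_of_deriv_le_sub (κ := c / 2 * A ^ θ) (by positivity)
      (fun t ht => hd t (hT t ht).2) (fun t ht => hzd t (hT t ht).2) fun t ht hzy => ?_
    obtain ⟨hG't, ht0⟩ := hT t ht
    have hzt := hsuper (G t) (G' t) β (by linarith [hG1 t ht0]) hβ hG't
    have hy_pow : c * z t ^ θ ≤ c * y t ^ θ := by gcongr; exact hA.le.trans (hAz t ht0)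
    have hA_pow : c / 2 * A ^ θ ≤ c / 2 * z t ^ θ := by gcongr; exact hAz t ht0
    linarith [hle t ht0]
  filter_upwards [hyz, eventually_gt_atTop 0] with t hyz ht0
  have hG0 : 0 ≤ G t := by linarith [hG1 t ht0]
  refine hyz.trans ?_
  rw [mul_add]
  exact add_le_add (mul_le_mul_of_nonneg_right (by linarith) (by positivity))
    (mul_le_mul_of_nonneg_right (by linarith) (by positivity))

end DifferentialInequalities

section IntegratingFactor

variable {w w' g : ℝ → ℝ} {c L T : ℝ}

theorem intervalIntegrable_of_continuousOn_Ici (hg : ContinuousOn g (Ici T)) {s t : ℝ}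
    (hs : T ≤ s) (ht : T ≤ t) : IntervalIntegrable g volume s t :=
  (hg.mono fun _ hr => (le_min hs ht).trans hr.1).intervalIntegrable

theorem monotoneOn_integral_of_nonneg (hg : ContinuousOn g (Ici T)) (hg0 : ∀ t ≥ T, 0 ≤ g t) :
    MonotoneOn (fun t => ∫ s in T..t, g s) (Ici T) := by
  intro s hs t ht hst
  have hadd := intervalIntegral.integral_add_adjacent_intervals
    (intervalIntegrable_of_continuousOn_Ici hg le_rfl hs)
    (intervalIntegrable_of_continuousOn_Ici hg hs ht)
  have hnonneg : 0 ≤ ∫ r in s..t, g r :=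
    intervalIntegral.integral_nonneg hst fun r hr => hg0 r (le_trans hs hr.1)
  simp only
  linarith

theorem tendsto_integral_atTop_of_lintegral_eq_top (hg : ContinuousOn g (Ici T))
    (hg0 : ∀ t ≥ T, 0 ≤ g t) (hint : ∫⁻ t in Ioi T, ENNReal.ofReal (g t) = ⊤) :
    Tendsto (fun t => ∫ s in T..t, g s) atTop atTop := by
  refine tendsto_atTop.2 fun B => ?_
  by_contra hcon
  have hbdd : ∀ t ≥ T, ∫ s in T..t, g s ≤ B := by
    intro t ht
    by_contra! hlt
    exact hcon ((eventually_ge_atTop t).mono fun s hs =>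
      hlt.le.trans (monotoneOn_integral_of_nonneg hg hg0 ht (le_trans ht hs) hs))
  have hintegrable : IntegrableOn g (Ioi T) := by
    refine integrableOn_Ioi_of_intervalIntegral_norm_bounded B T (b := fun t => max T t)
      (l := atTop) (fun t => (intervalIntegrable_of_continuousOn_Ici hg le_rfl (le_max_left _ _)).1)
      (tendsto_atTop_mono (fun t => le_max_right T t) tendsto_id) ?_
    filter_upwards [eventually_ge_atTop T] with t ht
    rw [max_eq_right ht]
    refine (intervalIntegral.integral_congr fun s hs => ?_).trans_le (hbdd t ht)
    rw [uIcc_of_le ht] at hs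
    exact Real.norm_of_nonneg (hg0 s hs.1)
  exact hintegrable.lintegral_lt_top.ne hint

theorem continuousOn_integral_Ici (hg : ContinuousOn g (Ici T)) :
    ContinuousOn (fun t => ∫ s in T..t, g s) (Ici T) := by
  intro t ht
  have hTt : T ≤ t + 1 := by linarith [mem_Ici.1 ht]
  have hcont := intervalIntegral.continuousOn_primitive_interval'
    (intervalIntegrable_of_continuousOn_Ici hg le_rfl hTt) left_mem_uIcc
  rw [uIcc_of_le hTt] at hcont
  refine (hcont t ⟨ht, by linarith⟩).mono_of_mem_nhdsWithin ?_
  rw [← Ici_inter_Iic]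
  exact inter_mem_nhdsWithin _ (Iic_mem_nhds (by linarith))

theorem antitoneOn_mul_exp_integral (hc : c ≠ 0) (hw : ∀ t ≥ T, HasDerivAt w (w' t) t)
    (hg : ContinuousOn g (Ici T)) (hle : ∀ t ≥ T, w' t ≤ -g t * (c * w t - L)) :
    AntitoneOn (fun t => (w t - L / c) * Real.exp (c * ∫ s in T..t, g s)) (Ici T) := by
  have hcont : ContinuousOn (fun t => (w t - L / c) * Real.exp (c * ∫ s in T..t, g s)) (Ici T) :=
    (ContinuousOn.sub (fun t ht => (hw t ht).continuousAt.continuousWithinAt)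
      continuousOn_const).mul
      (Real.continuous_exp.comp_continuousOn ((continuousOn_integral_Ici hg).const_smul c))
  refine antitoneOn_of_hasDerivWithinAt_nonpos (convex_Ici _) hcont
    (f' := fun t => w' t * Real.exp (c * ∫ s in T..t, g s)
      + (w t - L / c) * (Real.exp (c * ∫ s in T..t, g s) * (c * g t))) ?_ ?_
  all_goals rw [interior_Ici]; intro t (ht : T < t)
  · have hint : HasDerivAt (fun t => ∫ s in T..t, g s) (g t) t :=
      intervalIntegral.integral_hasDerivAt_right
        (intervalIntegrable_of_continuousOn_Ici hg le_rfl ht.le)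
        ((hg.mono Ioi_subset_Ici_self).stronglyMeasurableAtFilter isOpen_Ioi t ht)
        (hg.continuousAt (Ici_mem_nhds ht))
    exact (((hw t ht.le).sub_const _).mul ((hint.const_mul c).exp)).hasDerivWithinAt
  · have hfactor : w' t + (w t - L / c) * (c * g t) ≤ 0 := by
      have : (w t - L / c) * (c * g t) = g t * (c * w t - L) := by field_simp
      linarith [hle t ht.le]
    linarith [mul_nonpos_of_nonpos_of_nonneg hfactor (Real.exp_pos (c * ∫ s in T..t, g s)).le]

theorem eventually_le_div_add_of_deriv_le (hc : 0 < c) (hw : ∀ t ≥ T, HasDerivAt w (w' t) t)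
    (hg : ContinuousOn g (Ici T)) (hg0 : ∀ t ≥ T, 0 ≤ g t)
    (hle : ∀ t ≥ T, w' t ≤ -g t * (c * w t - L))
    (hint : ∫⁻ t in Ioi T, ENNReal.ofReal (g t) = ⊤) {ε : ℝ} (hε : 0 < ε) :
    ∀ᶠ t in atTop, w t ≤ L / c + ε := by
  set I : ℝ → ℝ := fun t => ∫ s in T..t, g s
  have hI : Tendsto I atTop atTop := tendsto_integral_atTop_of_lintegral_eq_top hg hg0 hint
  have hexp : Tendsto (fun t => (w T - L / c) * Real.exp (-(c * I t))) atTop (𝓝 0) := by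
    simpa using (Real.tendsto_exp_neg_atTop_nhds_zero.comp (hI.const_mul_atTop hc)).const_mul
      (w T - L / c)
  filter_upwards [hexp.eventually (gt_mem_nhds hε), eventually_ge_atTop T] with t hexp_lt ht
  have hanti : (w t - L / c) * Real.exp (c * I t) ≤ w T - L / c := by
    simpa [I] using antitoneOn_mul_exp_integral hc.ne' hw hg hle self_mem_Ici ht ht
  have hdiv : w t - L / c ≤ (w T - L / c) * Real.exp (-(c * I t)) := by
    rwa [Real.exp_neg, ← div_eq_mul_inv, le_div_iff₀ (Real.exp_pos _)]
  linarith

theorem lintegral_Ioi_eq_top_of_le {f : ℝ → ℝ≥0∞} {a b : ℝ} (hab : a ≤ b)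
    (hfin : ∫⁻ t in Ioc a b, f t ≠ ⊤) (hf : ∫⁻ t in Ioi a, f t = ⊤) : ∫⁻ t in Ioi b, f t = ⊤ := by
  rw [← Ioc_union_Ioi_eq_Ioi hab, lintegral_union measurableSet_Ioi
    (Ioc_disjoint_Ioi le_rfl)] at hf
  exact (ENNReal.add_eq_top.1 hf).resolve_left hfin

end IntegratingFactor

section Limsup

theorem eventually_le_toReal_limsup_add {R : ℝ → ℝ} {δ : ℝ} (hδ : 0 < δ)
    (hR : limsup (fun t => ENNReal.ofReal (R t)) atTop ≠ ⊤) :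
    ∀ᶠ t in atTop, R t ≤ (limsup (fun t => ENNReal.ofReal (R t)) atTop).toReal + δ := by
  have hlt : limsup (fun t => ENNReal.ofReal (R t)) atTop
      < ENNReal.ofReal ((limsup (fun t => ENNReal.ofReal (R t)) atTop).toReal + δ) := by
    rw [ENNReal.lt_ofReal_iff_toReal_lt hR]
    linarith
  filter_upwards [eventually_lt_of_limsup_lt hlt] with t ht
  exact (lt_of_not_ge fun h => ht.not_ge (ENNReal.ofReal_le_ofReal h)).le

theorem limsup_ofReal_le_of_eventually {Z P Q : ℝ → ℝ} {C : ℝ} (hC : 0 < C)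
    (h : ∀ l m ε : ℝ, 0 ≤ l → 0 ≤ m → 0 < ε → (∀ᶠ t in atTop, P t ≤ l) →
      (∀ᶠ t in atTop, Q t ≤ m) → ∀ᶠ t in atTop, Z t ≤ C * l + C * m + ε) :
    limsup (fun t => ENNReal.ofReal (Z t)) atTop
      ≤ ENNReal.ofReal C * limsup (fun t => ENNReal.ofReal (P t)) atTop
        + ENNReal.ofReal C * limsup (fun t => ENNReal.ofReal (Q t)) atTop := by
  set LP := limsup (fun t => ENNReal.ofReal (P t)) atTop
  set LQ := limsup (fun t => ENNReal.ofReal (Q t)) atTop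
  have hC' : ENNReal.ofReal C ≠ 0 := by simpa using hC
  by_cases hP : LP = ⊤
  · rw [hP, ENNReal.mul_top hC', top_add]; exact le_top
  by_cases hQ : LQ = ⊤
  · rw [hQ, ENNReal.mul_top hC', add_top]; exact le_top
  refine ENNReal.le_of_forall_pos_le_add fun ε hε _ => limsup_le_of_le (h := ?_)
  have hδ : 0 < (ε : ℝ) / (4 * C) := by positivity
  filter_upwards [h (LP.toReal + ε / (4 * C)) (LQ.toReal + ε / (4 * C)) (ε / 2) (by positivity)
    (by positivity) (by positivity) (eventually_le_toReal_limsup_add hδ hP)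
    (eventually_le_toReal_limsup_add hδ hQ)] with t ht
  calc ENNReal.ofReal (Z t) ≤ ENNReal.ofReal (C * LP.toReal + C * LQ.toReal + ε) := by
        refine ENNReal.ofReal_le_ofReal (ht.trans_eq ?_)
        field_simp
        ring
    _ = _ := by
        rw [ENNReal.ofReal_add (by positivity) (by positivity),
          ENNReal.ofReal_add (by positivity) (by positivity), ENNReal.ofReal_mul hC.le,
          ENNReal.ofReal_mul hC.le, ENNReal.ofReal_toReal hP, ENNReal.ofReal_toReal hQ,
          ENNReal.ofReal_coe_nnreal]

end Limsup

section GrowingWeight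

variable {γ c C : ℝ} {V d y y' : ℝ → ℝ}

theorem deriv_rpow_mul_le {σ θ θ' x x' r m : ℝ} (hC : 0 ≤ C) (hθ : 0 < θ) (hx : 0 ≤ x)
    (hθ' : θ' * σ ≤ c / 2) (hx' : x' ≤ -(c * (θ⁻¹ * x)) + C * r) (hr : θ ^ σ * r ≤ θ⁻¹ * m) :
    θ' * σ * θ ^ (σ - 1) * x + θ ^ σ * x' ≤ -θ⁻¹ * (c / 2 * (θ ^ σ * x) - C * m) := by
  have hweight : θ' * σ * θ ^ (σ - 1) * x ≤ c / 2 * (θ⁻¹ * (θ ^ σ * x)) := by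
    calc _ = θ' * σ * (θ⁻¹ * (θ ^ σ * x)) := by rw [Real.rpow_sub_one hθ.ne']; ring
      _ ≤ _ := mul_le_mul_of_nonneg_right hθ' (by positivity)
  calc _ ≤ c / 2 * (θ⁻¹ * (θ ^ σ * x)) + θ ^ σ * (-(c * (θ⁻¹ * x)) + C * r) := by gcongr
    _ = -(c / 2 * (θ⁻¹ * (θ ^ σ * x))) + C * (θ ^ σ * r) := by ring
    _ ≤ -(c / 2 * (θ⁻¹ * (θ ^ σ * x))) + C * (θ⁻¹ * m) := by gcongr
    _ = _ := by ring

theorem le_neg_mul_inv_add_of_le {x x' z θ r : ℝ} (hC : 0 < C) (hθ : 0 < θ) (hxz : x ≤ C * z)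
    (hz : z ≤ C * θ * (-x' + C * r)) : x' ≤ -(1 / C ^ 2 * (θ⁻¹ * x)) + C * r := by
  have hx : 1 / C ^ 2 * (θ⁻¹ * x) ≤ 1 / C ^ 2 * (θ⁻¹ * (C * (C * θ * (-x' + C * r)))) := by
    gcongr
    exact hxz.trans (mul_le_mul_of_nonneg_left hz hC.le)
  have hcancel : 1 / C ^ 2 * (θ⁻¹ * (C * (C * θ * (-x' + C * r)))) = -x' + C * r := by field_simp
  linarith

theorem rpow_mul_rpow_half_le {v x κ l ε : ℝ} (hC : 1 ≤ C) (hv : 0 ≤ v) (hx : 0 ≤ x) (hl : 0 ≤ l)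
    (hε : 0 ≤ ε) (h : v ^ (2 * κ) * x ≤ 2 * C / (1 / C ^ 2) * l ^ 2 + ε ^ 2) :
    v ^ κ * x ^ (1 / 2 : ℝ) ≤ 2 * C ^ 2 * l + ε := by
  have hsq : (v ^ κ * x ^ (1 / 2 : ℝ)) ^ 2 = v ^ (2 * κ) * x := by
    rw [mul_pow, ← Real.sqrt_eq_rpow, Real.sq_sqrt hx, ← Real.rpow_natCast, ← Real.rpow_mul hv,
      mul_comm 2, Nat.cast_ofNat]
  have hcoef : 2 * C / (1 / C ^ 2) * l ^ 2 ≤ (2 * C ^ 2 * l) ^ 2 := by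
    have : C ^ 3 ≤ C ^ 4 := pow_le_pow_right₀ hC (by norm_num)
    calc _ = 2 * C ^ 3 * l ^ 2 := by field_simp
      _ ≤ 4 * C ^ 4 * l ^ 2 := by gcongr; norm_num
      _ = _ := by ring
  refine le_of_sq_le_sq ?_ (by positivity)
  rw [hsq]
  nlinarith [(by positivity : 0 ≤ 2 * C ^ 2 * l * ε)]

theorem lintegral_inv_rpow_eq_top {T : ℝ} (hγ : 0 ≤ γ) (hV1 : ∀ t ≥ 1, 1 ≤ V t)
    (hVint : ∫⁻ t in Ioi (1 : ℝ), ENNReal.ofReal (V t ^ (-γ)) = ⊤) (hT : 1 ≤ T) :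
    ∫⁻ t in Ioi T, ENNReal.ofReal (V t ^ γ)⁻¹ = ⊤ := by
  have hfin : ∫⁻ t in Ioc 1 T, ENNReal.ofReal (V t ^ (-γ)) ≠ ⊤ :=
    ne_top_of_le_ne_top (b := ∫⁻ _ in Ioc 1 T, 1) (by simp)
      (setLIntegral_mono measurable_const fun t ht => ENNReal.ofReal_le_one.2
        (Real.rpow_le_one_of_one_le_of_nonpos (hV1 t ht.1.le) (by linarith)))
  rw [← lintegral_Ioi_eq_top_of_le hT hfin hVint]
  exact setLIntegral_congr_fun measurableSet_Ioi fun t ht => by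
    rw [← Real.rpow_neg (zero_le_one.trans (hV1 t (hT.trans (le_of_lt ht))))]

/-- The power `V^{2κ}`, `κ = γ + 1/2`, turns the source `V^{1/2} d` into `V^{-γ} V^{3κ} d`, and its
own derivative is negligible because `(V^γ)' → 0`. -/
theorem eventually_rpow_mul_le (hγ : 0 < γ) (hc : 0 < c) (hC : 0 ≤ C) (hV1 : ∀ t ≥ 1, 1 ≤ V t)
    (hVd : ∀ᶠ t in atTop, DifferentiableAt ℝ (fun s => V s ^ γ) t)
    (hVlim : Tendsto (deriv fun s => V s ^ γ) atTop (𝓝 0))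
    (hVint : ∫⁻ t in Ioi (1 : ℝ), ENNReal.ofReal (V t ^ (-γ)) = ⊤)
    (hy0 : ∀ t > 0, 0 ≤ y t) (hyd : ∀ t > 0, HasDerivAt y (y' t) t)
    (hy' : ∀ᶠ t in atTop, y' t ≤ -(c * ((V t ^ γ)⁻¹ * y t)) + C * (V t ^ (1 / 2 : ℝ) * d t))
    {m ε : ℝ} (hd : ∀ᶠ t in atTop, V t ^ (3 * (γ + 1 / 2)) * d t ≤ m) (hε : 0 < ε) :
    ∀ᶠ t in atTop, V t ^ (2 * (γ + 1 / 2)) * y t ≤ 2 * C / c * m + ε := by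
  set θ : ℝ → ℝ := fun s => V s ^ γ
  set σ := 2 * (γ + 1 / 2) / γ
  have hσ : 0 < σ := by positivity
  have hsmall : ∀ᶠ t in atTop, deriv θ t < c / (2 * σ) :=
    hVlim.eventually (gt_mem_nhds (by positivity))
  obtain ⟨T, hT⟩ := (hVd.and (hsmall.and (hy'.and (hd.and
    (eventually_ge_atTop 1))))).exists_forall_of_atTop
  have hT1 : ∀ t ≥ T, 1 ≤ t := fun t ht => (hT t ht).2.2.2.2
  have hV0 : ∀ t ≥ T, 0 < V t := fun t ht => zero_lt_one.trans_le (hV1 t (hT1 t ht))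
  have hθ0 : ∀ t ≥ T, 0 < θ t := fun t ht => Real.rpow_pos_of_pos (hV0 t ht) γ
  have hθσ : ∀ t ≥ T, θ t ^ σ = V t ^ (2 * (γ + 1 / 2)) := fun t ht => by
    rw [← Real.rpow_mul (hV0 t ht).le, mul_div_cancel₀ _ hγ.ne']
  have hsource : ∀ t ≥ T, θ t ^ σ * (V t ^ (1 / 2 : ℝ) * d t) ≤ (θ t)⁻¹ * m := fun t ht => by
    have hpow : θ t ^ σ * V t ^ (1 / 2 : ℝ) = (θ t)⁻¹ * V t ^ (3 * (γ + 1 / 2)) := by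
      rw [hθσ t ht, ← Real.rpow_neg (hV0 t ht).le, ← Real.rpow_add (hV0 t ht),
        ← Real.rpow_add (hV0 t ht)]
      congr 1; ring
    rw [← mul_assoc, hpow, mul_assoc]
    exact mul_le_mul_of_nonneg_left (hT t ht).2.2.2.1 (inv_nonneg.2 (hθ0 t ht).le)
  have hbound := eventually_le_div_add_of_deriv_le (c := c / 2) (L := C * m) (by positivity)
    (fun t ht => ((hT t ht).1.hasDerivAt.rpow_const (p := σ) (Or.inl (hθ0 t ht).ne')).fun_mul
      (hyd t (by linarith [hT1 t ht])))
    (ContinuousOn.inv₀ (fun t ht => (hT t ht).1.continuousAt.continuousWithinAt)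
      fun t ht => (hθ0 t ht).ne') (fun t ht => inv_nonneg.2 (hθ0 t ht).le)
    (fun t ht => deriv_rpow_mul_le hC (hθ0 t ht) (hy0 t (by linarith [hT1 t ht]))
      ((mul_le_mul_of_nonneg_right (hT t ht).2.1.le hσ.le).trans_eq (by field_simp))
      (hT t ht).2.2.1 (hsource t ht)) (lintegral_inv_rpow_eq_top hγ.le hV1 hVint (hT1 T le_rfl)) hε
  filter_upwards [hbound, eventually_ge_atTop T] with t hw ht
  rw [hθσ t ht] at hw
  exact hw.trans_eq (by field_simp)

theorem limsup_le_of_differential_inequality (hγ : 0 < γ) (hC : 1 ≤ C) {Z : ℝ → ℝ}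
    (hV1 : ∀ t ≥ 1, 1 ≤ V t) (hVd : ∀ᶠ t in atTop, DifferentiableAt ℝ (fun s => V s ^ γ) t)
    (hVlim : Tendsto (deriv fun s => V s ^ γ) atTop (𝓝 0))
    (hVint : ∫⁻ t in Ioi (1 : ℝ), ENNReal.ofReal (V t ^ (-γ)) = ⊤)
    (hd : ∀ t > 0, 0 ≤ d t) (hy0 : ∀ t > 0, 0 ≤ y t) (hyZ : ∀ t > 0, y t ≤ C * Z t)
    (hyd : ∀ t > 0, HasDerivAt y (y' t) t)
    (hZ : ∀ᶠ t in atTop, Z t ≤ C * V t ^ γ * (-y' t + C * (V t ^ (1 / 2 : ℝ) * d t)))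
    (hy' : ∀ᶠ t in atTop, |y' t| ≤ C * (V t ^ (1 / 2 : ℝ) * y t ^ (1 / 2 : ℝ))) :
    limsup (fun t => ENNReal.ofReal (Z t)) atTop
      ≤ ENNReal.ofReal (2 * C ^ 4) * limsup (fun t => ENNReal.ofReal
          ((V t ^ (3 * (γ + 1 / 2)) * d t) ^ (1 / 2 : ℝ))) atTop
        + ENNReal.ofReal (2 * C ^ 4) * limsup (fun t => ENNReal.ofReal
          (V t ^ (γ + 1 / 2) * d t)) atTop := by
  have hC0 : 0 < C := by linarith
  have hC24 : C ^ 2 ≤ C ^ 4 := pow_le_pow_right₀ hC (by norm_num)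
  refine limsup_ofReal_le_of_eventually (by positivity) fun l m ε hl hm hε hP hQ => ?_
  have hdecay : ∀ᶠ t in atTop,
      y' t ≤ -(1 / C ^ 2 * ((V t ^ γ)⁻¹ * y t)) + C * (V t ^ (1 / 2 : ℝ) * d t) := by
    filter_upwards [hZ, eventually_ge_atTop 1] with t hZt ht
    have hV0 : 0 < V t := zero_lt_one.trans_le (hV1 t ht)
    exact le_neg_mul_inv_add_of_le hC0 (by positivity) (hyZ t (by linarith)) hZt
  have hP_sq : ∀ᶠ t in atTop, V t ^ (3 * (γ + 1 / 2)) * d t ≤ l ^ 2 := by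
    filter_upwards [hP, eventually_ge_atTop 1] with t hPt ht
    have hV0 : 0 < V t := zero_lt_one.trans_le (hV1 t ht)
    have hdt := hd t (by linarith)
    rw [← Real.sqrt_eq_rpow] at hPt
    exact (Real.sqrt_le_left hl).1 hPt
  filter_upwards [eventually_rpow_mul_le hγ (by positivity) hC0.le hV1 hVd hVlim hVint hy0 hyd
    hdecay hP_sq (by positivity : 0 < (ε / C ^ 2) ^ 2), hQ, hZ, hy', eventually_ge_atTop 1]
    with t hw hQt hZt hy't ht
  have hV0 : 0 < V t := zero_lt_one.trans_le (hV1 t ht)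
  have hy := hy0 t (by linarith)
  have hroot : V t ^ (γ + 1 / 2) * y t ^ (1 / 2 : ℝ) ≤ 2 * C ^ 2 * l + ε / C ^ 2 :=
    rpow_mul_rpow_half_le hC hV0.le hy hl (by positivity) hw
  have hVκ : V t ^ γ * V t ^ (1 / 2 : ℝ) = V t ^ (γ + 1 / 2) := by rw [← Real.rpow_add hV0]
  calc Z t ≤ C * V t ^ γ * (-y' t + C * (V t ^ (1 / 2 : ℝ) * d t)) := hZt
    _ ≤ C * V t ^ γ * (C * (V t ^ (1 / 2 : ℝ) * y t ^ (1 / 2 : ℝ))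
          + C * (V t ^ (1 / 2 : ℝ) * d t)) := by
        gcongr
        exact (neg_le_abs _).trans hy't
    _ = C ^ 2 * (V t ^ (γ + 1 / 2) * y t ^ (1 / 2 : ℝ)) + C ^ 2 * (V t ^ (γ + 1 / 2) * d t) := by
        rw [← hVκ]; ring
    _ ≤ C ^ 2 * (2 * C ^ 2 * l + ε / C ^ 2) + C ^ 2 * m := by gcongr
    _ = 2 * C ^ 4 * l + C ^ 2 * m + ε := by field_simp; ring
    _ ≤ _ := by gcongr; linarith [pow_pos hC0 4]

end GrowingWeight

section AbstractFlow

open scoped RealInnerProductSpace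

variable {H X : Type*} [NormedAddCommGroup H] [InnerProductSpace ℝ H]
  [NormedAddCommGroup X] [InnerProductSpace ℝ X]

theorem inner_deriv_eq_neg_inner_deriv {v : H} {f : X} {w : ℝ → H} {z : ℝ → X} {w' : H} {z' : X}
    {t : ℝ} (h : ∀ᶠ s in 𝓝 t, ⟪v, w s⟫ = -⟪f, z s⟫) (hw : HasDerivAt w w' t)
    (hz : HasDerivAt z z' t) : ⟪v, w'⟫ = -⟪f, z'⟫ := by
  have hleft : HasDerivAt (fun s => ⟪v, w s⟫) ⟪v, w'⟫ t := by
    simpa using (hasDerivAt_const t v).inner ℝ hw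
  have hright : HasDerivAt (fun s => -⟪f, z s⟫) (-⟪f, z'⟫) t := by
    simpa using ((hasDerivAt_const t f).inner ℝ hz).fun_neg
  exact hleft.unique (hright.congr_of_eventuallyEq h)

theorem hasDerivAt_zero_of_abs_sub_le_norm_sub_sq {h : ℝ → ℝ} {y : ℝ → X} {y' : X} {t : ℝ}
    (hy : HasDerivAt y y' t) (hle : ∀ᶠ s in 𝓝 t, |h s - h t| ≤ ‖y s - y t‖ ^ 2) :
    HasDerivAt h 0 t := by
  rw [hasDerivAt_iff_isLittleO]
  have hquadratic : (fun s => ‖y s - y t‖ ^ 2) =O[𝓝 t] fun s => ‖s - t‖ ^ 2 :=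
    (hy.isBigO_sub.norm_norm).pow 2
  refine Asymptotics.IsBigO.trans_isLittleO (.of_bound 1 ?_)
    (hquadratic.trans_isLittleO (Asymptotics.isLittleO_pow_sub_sub t one_lt_two))
  filter_upwards [hle] with s hs
  simpa using hs

theorem neg_inner_le_norm_mul_norm (x y : H) : -⟪x, y⟫ ≤ ‖x‖ * ‖y‖ := by
  simpa using real_inner_le_norm (-x) y

theorem neg_inner_sub_le_of_norm_sq_le_inner {p q r e : X} (hpq : ‖p‖ ^ 2 ≤ ⟪p, q⟫) :
    -⟪p, r - e⟫ ≤ 1 / 2 * ‖e‖ ^ 2 + 1 / 2 * ‖q - r‖ ^ 2 := by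
  have hpe : ⟪p, e⟫ ≤ ‖p‖ * ‖e‖ := real_inner_le_norm _ _
  have hpqr : ⟪p, q - r⟫ ≤ ‖p‖ * ‖q - r‖ := real_inner_le_norm _ _
  rw [inner_sub_right] at hpqr ⊢
  nlinarith [sq_nonneg (‖p‖ - ‖e‖), sq_nonneg (‖p‖ - ‖q - r‖)]

/-- An abstract version of the weak form of `φ u_t = ∇·f`, `f = K(x, |y|) y`, `y = ∇u`, with
boundary values `ψ`, `η = ∇ψ`. The flux `f` is a cocoercive function of `y`, represented here only
along the solution, and is a subgradient of the energy `j`; `weak` is the equation at time `s`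
tested with `u - ψ` at another time `t`. -/
structure Flow (H X : Type*) [NormedAddCommGroup H] [InnerProductSpace ℝ H]
    [NormedAddCommGroup X] [InnerProductSpace ℝ X] where
  (u u' u'' ψ ψ' ψ'' : ℝ → H)
  (y y' η η' f : ℝ → X)
  j : ℝ → ℝ
  hasDerivAt_u : ∀ t > 0, HasDerivAt u (u' t) t
  hasDerivAt_u' : ∀ t > 0, HasDerivAt u' (u'' t) t
  hasDerivAt_ψ : ∀ t > 0, HasDerivAt ψ (ψ' t) t
  hasDerivAt_ψ' : ∀ t > 0, HasDerivAt ψ' (ψ'' t) t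
  hasDerivAt_y : ∀ t > 0, HasDerivAt y (y' t) t
  hasDerivAt_η : ∀ t > 0, HasDerivAt η (η' t) t
  continuousOn_ψ'' : ContinuousOn ψ'' (Ioi 0)
  continuousOn_η' : ContinuousOn η' (Ioi 0)
  cocoercive : ∀ s > 0, ∀ t > 0, ‖f s - f t‖ ^ 2 ≤ ⟪f s - f t, y s - y t⟫
  norm_f_sq_le : ∀ t > 0, ‖f t‖ ^ 2 ≤ ⟪f t, y t⟫
  le_j_sub : ∀ s > 0, ∀ t > 0, ⟪f t, y s - y t⟫ ≤ j s - j t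
  j_le : ∀ t > 0, j t ≤ ⟪f t, y t⟫
  le_two_j : ∀ t > 0, ⟪f t, y t⟫ ≤ 2 * j t
  weak : ∀ s > 0, ∀ t > 0, ⟪u' s, u t - ψ t⟫ = -⟪f s, y t - η t⟫

namespace Flow

variable (F : Flow H X)

/-- The dissipation `∫ K(x, |∇p|) |∇p|² dx`. -/
def diss (t : ℝ) : ℝ := ⟪F.f t, F.y t⟫

/-- The quantity `‖p - Ψ‖² + ∫ K(x, |∇p|) |∇p|² dx + ‖(p - Ψ)_t‖²` controlled by smoothing. -/
def size (t : ℝ) : ℝ := ‖F.u t - F.ψ t‖ ^ 2 + F.diss t + ‖F.u' t - F.ψ' t‖ ^ 2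

/-- The source term `G₁ + G₂` contributed by the boundary data to the equation for `u_t`. -/
def source (t : ℝ) : ℝ := ‖F.η' t‖ ^ 2 + ‖F.ψ'' t‖ ^ 2

variable {F} {s t : ℝ}

theorem diss_nonneg (ht : 0 < t) : 0 ≤ F.diss t :=
  (sq_nonneg _).trans (F.norm_f_sq_le t ht)

theorem source_nonneg (t : ℝ) : 0 ≤ F.source t := by unfold source; positivity

theorem norm_η'_sq_le_source (t : ℝ) : ‖F.η' t‖ ^ 2 ≤ F.source t :=
  le_add_of_nonneg_right (sq_nonneg _)

theorem inner_u'_sub_ψ' (hs : 0 < s) (ht : 0 < t) :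
    ⟪F.u' s, F.u' t - F.ψ' t⟫ = -⟪F.f s, F.y' t - F.η' t⟫ :=
  inner_deriv_eq_neg_inner_deriv
    ((lt_mem_nhds ht).mono fun r hr => F.weak s hs r hr)
    ((F.hasDerivAt_u t ht).sub (F.hasDerivAt_ψ t ht))
    ((F.hasDerivAt_y t ht).sub (F.hasDerivAt_η t ht))

theorem hasDerivAt_norm_sq (ht : 0 < t) :
    HasDerivAt (fun t => ‖F.u t - F.ψ t‖ ^ 2) (2 * ⟪F.u t - F.ψ t, F.u' t - F.ψ' t⟫) t :=
  ((F.hasDerivAt_u t ht).sub (F.hasDerivAt_ψ t ht)).norm_sq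

theorem hasDerivAt_norm_deriv_sq (ht : 0 < t) :
    HasDerivAt (fun t => ‖F.u' t - F.ψ' t‖ ^ 2)
      (2 * ⟪F.u' t - F.ψ' t, F.u'' t - F.ψ'' t⟫) t :=
  ((F.hasDerivAt_u' t ht).sub (F.hasDerivAt_ψ' t ht)).norm_sq

theorem norm_f_sub_le (hs : 0 < s) (ht : 0 < t) : ‖F.f s - F.f t‖ ≤ ‖F.y s - F.y t‖ := by
  have h := (F.cocoercive s hs t ht).trans (real_inner_le_norm _ _)
  rcases (norm_nonneg (F.f s - F.f t)).eq_or_lt with hzero | hpos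
  · rw [← hzero]; exact norm_nonneg _
  · exact le_of_mul_le_mul_left (by rwa [← pow_two]) hpos

theorem hasDerivAt_j (ht : 0 < t) : HasDerivAt F.j ⟪F.f t, F.y' t⟫ t := by
  have hy := F.hasDerivAt_y t ht
  have hlinear : HasDerivAt (fun s => ⟪F.f t, F.y s⟫) ⟪F.f t, F.y' t⟫ t := by
    simpa using (hasDerivAt_const t (F.f t)).inner ℝ hy
  have hremainder : HasDerivAt (fun s => F.j s - ⟪F.f t, F.y s⟫) 0 t := by
    refine hasDerivAt_zero_of_abs_sub_le_norm_sub_sq hy ?_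
    filter_upwards [lt_mem_nhds ht] with s hs
    have hlower := F.le_j_sub s hs t ht
    have hupper := F.le_j_sub t ht s hs
    have hlipschitz : ⟪F.f s - F.f t, F.y s - F.y t⟫ ≤ ‖F.y s - F.y t‖ ^ 2 := by
      refine (real_inner_le_norm _ _).trans ?_
      rw [pow_two]
      gcongr
      exact norm_f_sub_le hs ht
    simp only [inner_sub_left, inner_sub_right] at hlower hupper hlipschitz
    rw [abs_of_nonneg (by linarith)]
    linarith
  simpa using hremainder.fun_add hlinear

theorem inner_slope_u' (hs : 0 < s) (ht : 0 < t) :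
    ⟪slope F.u' t s, F.u' t - F.ψ' t⟫ = -⟪slope F.f t s, F.y' t - F.η' t⟫ := by
  rw [slope_def_module, slope_def_module, real_inner_smul_left, real_inner_smul_left,
    inner_sub_left, inner_sub_left, inner_u'_sub_ψ' hs ht, inner_u'_sub_ψ' ht ht]
  ring

theorem norm_slope_f_sq_le (hs : 0 < s) (ht : 0 < t) :
    ‖slope F.f t s‖ ^ 2 ≤ ⟪slope F.f t s, slope F.y t s⟫ := by
  rw [slope_def_module, slope_def_module, real_inner_smul_left, real_inner_smul_right, norm_smul,
    mul_pow, Real.norm_eq_abs, sq_abs, ← mul_assoc, ← pow_two]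
  exact mul_le_mul_of_nonneg_left (F.cocoercive s hs t ht) (sq_nonneg _)

-- The flux `f` need not be differentiable in time: its difference quotients are bounded through
-- cocoercivity before passing to the limit.
theorem inner_u''_le (ht : 0 < t) :
    ⟪F.u'' t, F.u' t - F.ψ' t⟫ ≤ 1 / 2 * ‖F.η' t‖ ^ 2 := by
  have hu' : Tendsto (slope F.u' t) (𝓝[≠] t) (𝓝 (F.u'' t)) := (F.hasDerivAt_u' t ht).tendsto_slope
  have hy : Tendsto (slope F.y t) (𝓝[≠] t) (𝓝 (F.y' t)) := (F.hasDerivAt_y t ht).tendsto_slope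
  have hright : Tendsto (fun s => 1 / 2 * ‖F.η' t‖ ^ 2 + 1 / 2 * ‖slope F.y t s - F.y' t‖ ^ 2)
      (𝓝[≠] t) (𝓝 (1 / 2 * ‖F.η' t‖ ^ 2)) := by
    simpa using (((hy.sub_const (F.y' t)).norm.pow 2).const_mul (1 / 2 : ℝ)).const_add
      (1 / 2 * ‖F.η' t‖ ^ 2)
  refine le_of_tendsto_of_tendsto (hu'.inner tendsto_const_nhds) hright ?_
  filter_upwards [nhdsWithin_le_nhds (lt_mem_nhds ht)] with s hs
  rw [inner_slope_u' hs ht]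
  exact neg_inner_sub_le_of_norm_sq_le_inner (norm_slope_f_sq_le hs ht)

theorem inner_deriv_le (ht : 0 < t) :
    2 * ⟪F.u' t - F.ψ' t, F.u'' t - F.ψ'' t⟫ ≤ F.source t + ‖F.u' t - F.ψ' t‖ ^ 2 := by
  have hu'' := inner_u''_le (F := F) ht
  have hψ'' := neg_inner_le_norm_mul_norm (F.ψ'' t) (F.u' t - F.ψ' t)
  rw [real_inner_comm, inner_sub_left, source]
  nlinarith [sq_nonneg (‖F.ψ'' t‖ - ‖F.u' t - F.ψ' t‖)]

theorem continuousOn_source : ContinuousOn F.source (Ioi 0) :=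
  (F.continuousOn_η'.norm.pow 2).add (F.continuousOn_ψ''.norm.pow 2)

theorem hasDerivAt_integral_source (hs : 0 < s) (ht : 0 < t) :
    HasDerivAt (fun t => ∫ τ in s..t, F.source τ) (F.source t) t :=
  intervalIntegral.integral_hasDerivAt_right
    (continuousOn_source.mono fun _ hx => (lt_min hs ht).trans_le hx.1).intervalIntegrable
    (continuousOn_source.stronglyMeasurableAtFilter isOpen_Ioi t ht)
    (continuousOn_source.continuousAt (Ioi_mem_nhds ht))

theorem integral_source_nonneg (hst : s ≤ t) : 0 ≤ ∫ τ in s..t, F.source τ :=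
  intervalIntegral.integral_nonneg hst fun _ _ => source_nonneg _

/-- Bounds on the boundary data of a flow and a Poincaré inequality for its solution, in terms of a
function `G`; the degeneracy exponent is `b ∈ [0, 1)`. -/
structure Controlled (F : Flow H X) (b C₀ : ℝ) (G : ℝ → ℝ) : Prop where
  one_le : ∀ t > 0, 1 ≤ G t
  norm_η_sq_le : ∀ t > 0, ‖F.η t‖ ^ 2 ≤ G t
  norm_ψ'_rpow_le : ∀ t > 0, ‖F.ψ' t‖ ^ ((2 - b) / (1 - b)) ≤ G t
  poincare : ∀ t > 0, ‖F.u t - F.ψ t‖ ^ (2 - b) ≤ C₀ * (F.diss t + G t)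

variable {b C₀ : ℝ} {G : ℝ → ℝ}

/-- The constant of the energy inequality `Controlled.inner_le_neg_diss_add`. -/
def energyConst (b C₀ : ℝ) : ℝ := 5 / 2 + youngConst b (1 / (2 * C₀))

theorem energyConst_pos (hb1 : b < 1) (hC₀ : 0 < C₀) : 0 < energyConst b C₀ := by
  have := youngConst_nonneg (δ := 1 / (2 * C₀)) hb1 (by positivity)
  unfold energyConst; positivity

namespace Controlled

theorem inner_le_neg_diss_add (hF : F.Controlled b C₀ G) (hb1 : b < 1) (hC₀ : 0 < C₀)
    (ht : 0 < t) :
    2 * ⟪F.u t - F.ψ t, F.u' t - F.ψ' t⟫ ≤ -F.diss t + energyConst b C₀ * G t := by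
  have hweak : ⟪F.u t - F.ψ t, F.u' t - F.ψ' t⟫
      = -F.diss t + ⟪F.f t, F.η t⟫ - ⟪F.ψ' t, F.u t - F.ψ t⟫ := by
    rw [real_inner_comm, inner_sub_left, F.weak t ht t ht, inner_sub_right, diss]
    ring
  have hη : ⟪F.f t, F.η t⟫ ≤ ‖F.f t‖ * ‖F.η t‖ := real_inner_le_norm _ _
  have hψ' := neg_inner_le_norm_mul_norm (F.ψ' t) (F.u t - F.ψ t)
  have hf : ‖F.f t‖ ^ 2 ≤ F.diss t := F.norm_f_sq_le t ht
  have hηG := hF.norm_η_sq_le t ht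
  have hyoung := two_mul_le_young (δ := 1 / (2 * C₀)) hb1 (by positivity) (norm_nonneg (F.ψ' t))
    (norm_nonneg (F.u t - F.ψ t))
  have hpoincare : 1 / (2 * C₀) * ‖F.u t - F.ψ t‖ ^ (2 - b) ≤ 1 / 2 * (F.diss t + G t) := by
    calc _ ≤ 1 / (2 * C₀) * (C₀ * (F.diss t + G t)) := by
          gcongr; exact hF.poincare t ht
      _ = _ := by field_simp
  have hψ'G := mul_le_mul_of_nonneg_left (hF.norm_ψ'_rpow_le t ht)
    (youngConst_nonneg (δ := 1 / (2 * C₀)) hb1 (by positivity))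
  rw [hweak]
  unfold energyConst
  nlinarith [sq_nonneg (‖F.f t‖ - 2 * ‖F.η t‖)]

theorem inner_le_neg_rpow_add (hF : F.Controlled b C₀ G) (hb1 : b < 1) (hC₀ : 0 < C₀)
    (ht : 0 < t) :
    2 * ⟪F.u t - F.ψ t, F.u' t - F.ψ' t⟫
      ≤ -(1 / C₀) * (‖F.u t - F.ψ t‖ ^ 2) ^ ((2 - b) / 2) + (energyConst b C₀ + 1) * G t := by
  have hpow : (‖F.u t - F.ψ t‖ ^ 2) ^ ((2 - b) / 2) = ‖F.u t - F.ψ t‖ ^ (2 - b) := by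
    rw [← Real.rpow_natCast_mul (norm_nonneg _)]; congr 1; push_cast; ring
  have hpoincare : 1 / C₀ * ‖F.u t - F.ψ t‖ ^ (2 - b) ≤ F.diss t + G t := by
    rw [one_div, inv_mul_le_iff₀ hC₀]; exact hF.poincare t ht
  rw [hpow]
  linarith [hF.inner_le_neg_diss_add hb1 hC₀ ht]

theorem norm_ψ'_sq_le (hF : F.Controlled b C₀ G) (hb0 : 0 ≤ b) (hb1 : b < 1) (ht : 0 < t) :
    ‖F.ψ' t‖ ^ 2 ≤ G t := by
  rcases le_total ‖F.ψ' t‖ 1 with h | h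
  · exact (pow_le_one₀ (norm_nonneg _) h).trans (hF.one_le t ht)
  · refine le_trans ?_ (hF.norm_ψ'_rpow_le t ht)
    rw [← Real.rpow_natCast]
    refine Real.rpow_le_rpow_of_exponent_le h ?_
    rw [le_div_iff₀ (by linarith)]; push_cast; linarith

theorem inner_f_y'_le (hF : F.Controlled b C₀ G) (hb0 : 0 ≤ b) (hb1 : b < 1) (ht : 0 < t) :
    ⟪F.f t, F.y' t⟫ ≤ -(1 / 2) * ‖F.u' t - F.ψ' t‖ ^ 2 + 1 / 2 * F.diss t
      + 1 / 2 * ‖F.η' t‖ ^ 2 + 1 / 2 * G t := by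
  have hweak := inner_u'_sub_ψ' (F := F) ht ht
  have hsq : ‖F.u' t - F.ψ' t‖ ^ 2
      = ⟪F.u' t, F.u' t - F.ψ' t⟫ - ⟪F.ψ' t, F.u' t - F.ψ' t⟫ := by
    rw [← inner_sub_left, real_inner_self_eq_norm_sq]
  rw [inner_sub_right (F.f t)] at hweak
  have hη' : ⟪F.f t, F.η' t⟫ ≤ ‖F.f t‖ * ‖F.η' t‖ := real_inner_le_norm _ _
  have hψ' := neg_inner_le_norm_mul_norm (F.ψ' t) (F.u' t - F.ψ' t)
  have hψ'G := hF.norm_ψ'_sq_le hb0 hb1 ht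
  have hf : ‖F.f t‖ ^ 2 ≤ F.diss t := F.norm_f_sq_le t ht
  nlinarith [sq_nonneg (‖F.f t‖ - ‖F.η' t‖), sq_nonneg (‖F.ψ' t‖ - ‖F.u' t - F.ψ' t‖)]

end Controlled

/-- A functional which decreases over a time interval of length one starting at `s`. The weights
`τ - s` and `(τ - s)²` vanish at the initial time, so that its initial value involves only `u - ψ`,
while its final value controls the dissipation and the time derivative. -/
def smoothing (F : Flow H X) (s k τ : ℝ) : ℝ :=
  9 * ‖F.u τ - F.ψ τ‖ ^ 2 + 6 * ((τ - s) * F.j τ) + (τ - s) ^ 2 * ‖F.u' τ - F.ψ' τ‖ ^ 2 - k * τ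
    - 4 * ∫ r in s..τ, F.source r

theorem hasDerivAt_smoothing (hs : 0 < s) (ht : 0 < t) (k : ℝ) :
    HasDerivAt (F.smoothing s k)
      (9 * (2 * ⟪F.u t - F.ψ t, F.u' t - F.ψ' t⟫) + 6 * (F.j t + (t - s) * ⟪F.f t, F.y' t⟫)
        + (2 * (t - s) * ‖F.u' t - F.ψ' t‖ ^ 2
          + (t - s) ^ 2 * (2 * ⟪F.u' t - F.ψ' t, F.u'' t - F.ψ'' t⟫)) - k - 4 * F.source t) t := by
  have hsub : HasDerivAt (fun τ : ℝ => τ - s) 1 t := (hasDerivAt_id t).sub_const _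
  have hsq : HasDerivAt (fun τ : ℝ => (τ - s) ^ 2) (2 * (t - s)) t := by
    simpa using hsub.fun_pow 2
  simpa using! (((((hasDerivAt_norm_sq (F := F) ht).const_mul 9).add
    ((hsub.mul (hasDerivAt_j (F := F) ht)).const_mul 6)).add
    (hsq.mul (hasDerivAt_norm_deriv_sq (F := F) ht))).sub ((hasDerivAt_id t).const_mul k)).sub
    ((hasDerivAt_integral_source (F := F) hs ht).const_mul 4)

namespace Controlled

theorem smoothing_deriv_nonpos (hF : F.Controlled b C₀ G) (hb0 : 0 ≤ b) (hb1 : b < 1)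
    (hC₀ : 0 < C₀) {r m : ℝ} (ht : 0 < t) (hr0 : 0 ≤ r) (hr1 : r ≤ 1) (hm : G t ≤ m) :
    9 * (2 * ⟪F.u t - F.ψ t, F.u' t - F.ψ' t⟫) + 6 * (F.j t + r * ⟪F.f t, F.y' t⟫)
      + (2 * r * ‖F.u' t - F.ψ' t‖ ^ 2
        + r ^ 2 * (2 * ⟪F.u' t - F.ψ' t, F.u'' t - F.ψ'' t⟫))
      - (9 * energyConst b C₀ + 3) * m - 4 * F.source t ≤ 0 := by
  have hG0 : 0 ≤ G t := zero_le_one.trans (hF.one_le t ht)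
  have henergy := hF.inner_le_neg_diss_add hb1 hC₀ ht
  have hpotential := mul_le_mul_of_nonneg_left (hF.inner_f_y'_le hb0 hb1 ht) hr0
  have hderiv := mul_le_mul_of_nonneg_left (inner_deriv_le (F := F) ht) (sq_nonneg r)
  have hj : F.j t ≤ F.diss t := F.j_le t ht
  have hr2 : r ^ 2 ≤ r := by nlinarith
  have hu' : r ^ 2 * ‖F.u' t - F.ψ' t‖ ^ 2 ≤ r * ‖F.u' t - F.ψ' t‖ ^ 2 := by gcongr
  have hdiss : r * F.diss t ≤ F.diss t := mul_le_of_le_one_left (diss_nonneg ht) hr1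
  have hη' : r * ‖F.η' t‖ ^ 2 ≤ F.source t :=
    (mul_le_of_le_one_left (sq_nonneg _) hr1).trans (norm_η'_sq_le_source t)
  have hrG : r * G t ≤ m := (mul_le_of_le_one_left hG0 hr1).trans hm
  have hsource : r ^ 2 * F.source t ≤ F.source t :=
    mul_le_of_le_one_left (source_nonneg t) (hr2.trans hr1)
  have hEG := mul_le_mul_of_nonneg_left hm (energyConst_pos hb1 hC₀).le
  linarith

theorem antitoneOn_smoothing (hF : F.Controlled b C₀ G) (hb0 : 0 ≤ b) (hb1 : b < 1) (hC₀ : 0 < C₀)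
    {m : ℝ} (hs : 0 < s) (hm : ∀ τ ∈ Icc s (s + 1), G τ ≤ m) :
    AntitoneOn (F.smoothing s ((9 * energyConst b C₀ + 3) * m)) (Icc s (s + 1)) := by
  have hd := fun τ (hτ : τ ∈ Icc s (s + 1)) =>
    hasDerivAt_smoothing (F := F) hs (hs.trans_le hτ.1) ((9 * energyConst b C₀ + 3) * m)
  refine antitoneOn_of_hasDerivWithinAt_nonpos (convex_Icc _ _)
    (fun τ hτ => (hd τ hτ).continuousAt.continuousWithinAt)
    (fun τ hτ => (hd τ (interior_subset hτ)).hasDerivWithinAt) fun τ hτ => ?_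
  have hτ := interior_subset hτ
  exact hF.smoothing_deriv_nonpos hb0 hb1 hC₀ (hs.trans_le hτ.1) (sub_nonneg.2 hτ.1)
    (by linarith [hτ.2]) (hm τ hτ)

theorem size_le (hF : F.Controlled b C₀ G) (hb0 : 0 ≤ b) (hb1 : b < 1) (hC₀ : 0 < C₀) {m : ℝ}
    (ht : 1 < t) (hm : ∀ τ ∈ Icc (t - 1) t, G τ ≤ m) :
    F.size t ≤ 9 * ‖F.u (t - 1) - F.ψ (t - 1)‖ ^ 2 + (9 * energyConst b C₀ + 3) * m
      + 4 * ∫ τ in (t - 1)..t, F.source τ := by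
  have hanti := hF.antitoneOn_smoothing hb0 hb1 hC₀ (s := t - 1) (by linarith)
    (by rwa [sub_add_cancel])
  rw [sub_add_cancel] at hanti
  have hdecrease := hanti (left_mem_Icc.2 (by linarith)) (right_mem_Icc.2 (by linarith))
    (by linarith)
  simp only [smoothing, intervalIntegral.integral_same] at hdecrease
  have hj : F.diss t ≤ 2 * F.j t := F.le_two_j t (by linarith)
  have hdiss : 0 ≤ F.diss t := diss_nonneg (by linarith)
  unfold size
  linarith [sq_nonneg ‖F.u t - F.ψ t‖]

end Controlled

end Flow

theorem exists_size_le_of_monotone {b C₀ : ℝ} (hb0 : 0 ≤ b) (hb1 : b < 1) (hC₀ : 0 < C₀) :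
    ∃ C > 0, ∀ {H X : Type*} [NormedAddCommGroup H] [InnerProductSpace ℝ H]
      [NormedAddCommGroup X] [InnerProductSpace ℝ X] (F : Flow H X) (G M : ℝ → ℝ),
      F.Controlled b C₀ G → (∀ t > 0, G t ≤ M t) → MonotoneOn M (Ioi 0) → ∀ᶠ t in atTop,
        F.size t ≤ C * (M t ^ (2 / (2 - b)) + ∫ τ in (t - 1)..t, F.source τ) := by
  have hE := Flow.energyConst_pos hb1 hC₀
  set c := 9 * Flow.energyConst b C₀ + 3
  set A := (2 * (Flow.energyConst b C₀ + 1) / (1 / C₀)) ^ (2 / (2 - b)) with hA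
  have hA0 : 0 ≤ A := by positivity
  refine ⟨9 * A + c + 4, by positivity, fun F G M hF hGM hM => ?_⟩
  have hM1 : ∀ t > 0, 1 ≤ M t := fun t ht => (hF.one_le t ht).trans (hGM t ht)
  have hnorm := eventually_le_mul_rpow_of_monotoneOn (θ := (2 - b) / 2) (c := 1 / C₀)
    (C₀ := Flow.energyConst b C₀ + 1) (by linarith) (by positivity) (by positivity)
    (fun t _ => sq_nonneg _) (fun t ht => Flow.hasDerivAt_norm_sq (F := F) ht)
    (fun t ht => (hF.inner_le_neg_rpow_add hb1 hC₀ ht).trans (by gcongr; exact hGM t ht)) hM1 hM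
  rw [one_div_div, ← hA] at hnorm
  filter_upwards [(tendsto_atTop_add_const_right atTop (-1 : ℝ) tendsto_id).eventually hnorm,
    eventually_gt_atTop 1] with t hnorm_t ht
  simp only [id, ← sub_eq_add_neg] at hnorm_t
  have hM_mono : ∀ τ ∈ Icc (t - 1) t, M τ ≤ M t := fun τ hτ =>
    hM (mem_Ioi.2 (by linarith [hτ.1])) (mem_Ioi.2 (by linarith)) hτ.2
  have hsize := hF.size_le hb0 hb1 hC₀ ht fun τ hτ =>
    (hGM τ (by linarith [hτ.1])).trans (hM_mono τ hτ)
  have hpow_mono : M (t - 1) ^ (2 / (2 - b)) ≤ M t ^ (2 / (2 - b)) :=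
    Real.rpow_le_rpow (by linarith [hM1 (t - 1) (by linarith)])
      (hM_mono _ ⟨le_rfl, by linarith⟩) (div_nonneg (by norm_num) (by linarith))
  have hpow_self : M t ≤ M t ^ (2 / (2 - b)) :=
    le_rpow_two_div_two_sub hb0 (by linarith) (hM1 t (by linarith))
  have hpow0 : 0 ≤ M t ^ (2 / (2 - b)) := by linarith [hM1 t (by linarith)]
  have hsource : 0 ≤ ∫ τ in (t - 1)..t, F.source τ := Flow.integral_source_nonneg (by linarith)
  calc F.size t ≤ 9 * (A * M t ^ (2 / (2 - b))) + c * M t ^ (2 / (2 - b))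
        + 4 * ∫ τ in (t - 1)..t, F.source τ := by
        refine hsize.trans ?_
        gcongr
        exact hnorm_t.trans (by gcongr)
    _ ≤ _ := by nlinarith [mul_nonneg hA0 hsource, mul_nonneg hE.le hsource]

theorem eventually_le_add_of_neg_le_deriv {G G' : ℝ → ℝ} {β : ℝ} (hβ : 0 ≤ β)
    (hG : ∀ t > 0, HasDerivAt G (G' t) t) (hG' : ∀ᶠ t in atTop, -β ≤ G' t) :
    ∀ᶠ t in atTop, ∀ τ ∈ Icc (t - 1) t, G τ ≤ G t + β := by
  obtain ⟨T, hT⟩ := (hG'.and (eventually_gt_atTop 0)).exists_forall_of_atTop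
  filter_upwards [eventually_ge_atTop (T + 1)] with t ht τ hτ
  have hd : ∀ s ∈ Ici T, HasDerivAt G (G' s) s := fun s hs => hG s (hT s hs).2
  have hmean := (convex_Ici T).mul_sub_le_image_sub_of_le_deriv (C := -β)
    (fun s hs => (hd s hs).continuousAt.continuousWithinAt)
    (fun s hs => (hd s (interior_subset hs)).differentiableAt.differentiableWithinAt)
    (fun s hs => by rw [(hd s (interior_subset hs)).deriv]; exact (hT s (interior_subset hs)).1)
    τ (mem_Ici.2 (by linarith [hτ.1])) t (mem_Ici.2 (by linarith)) hτ.2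
  nlinarith [hτ.1]

theorem rpow_two_div_add_le {b x β : ℝ} (hb0 : 0 ≤ b) (hb1 : b < 1) (hx : 0 ≤ x) (hβ : 1 ≤ β) :
    (x + β) ^ (2 / (2 - b))
      ≤ 2 ^ (2 / (2 - b) - 1) * (x ^ (2 / (2 - b)) + β ^ (1 / (1 - b))) := by
  have hβ_pow : β ^ (2 / (2 - b)) ≤ β ^ (1 / (1 - b)) := by
    refine Real.rpow_le_rpow_of_exponent_le hβ ?_
    rw [div_le_div_iff₀ (by linarith) (by linarith)]; linarith
  refine (add_rpow_le_two_rpow_mul_add hx (by linarith) ?_).trans (by gcongr)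
  rw [le_div_iff₀ (by linarith)]
  linarith

theorem exists_size_le_of_deriv_ge {b C₀ : ℝ} (hb0 : 0 ≤ b) (hb1 : b < 1) (hC₀ : 0 < C₀) :
    ∃ C > 0, ∀ {H X : Type*} [NormedAddCommGroup H] [InnerProductSpace ℝ H]
      [NormedAddCommGroup X] [InnerProductSpace ℝ X] (F : Flow H X) (G G' : ℝ → ℝ) (β : ℝ),
      F.Controlled b C₀ G → 1 ≤ β → (∀ t > 0, HasDerivAt G (G' t) t) →
      (∀ᶠ t in atTop, -β ≤ G' t) → ∀ᶠ t in atTop,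
        F.size t ≤ C * (G t ^ (2 / (2 - b)) + β ^ (1 / (1 - b))
          + ∫ τ in (t - 1)..t, F.source τ) := by
  have hE := Flow.energyConst_pos hb1 hC₀
  set c := 9 * Flow.energyConst b C₀ + 3
  obtain ⟨A, hA, hbound⟩ := exists_eventually_le_of_deriv_ge (θ := (2 - b) / 2) (c := 1 / C₀)
    (C₀ := Flow.energyConst b C₀ + 1) (by linarith) (by linarith) (by positivity) (by positivity)
  set K : ℝ := 2 ^ (2 / (2 - b) - 1)
  refine ⟨9 * (A * (K + 1)) + c * K + 4, by positivity, fun F G G' β hF hβ hG hG' => ?_⟩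
  have hβ0 : 0 ≤ β := by linarith
  have hnorm := hbound _ _ G G' β hβ0 (fun t ht => Flow.hasDerivAt_norm_sq (F := F) ht)
    (fun t ht => hF.inner_le_neg_rpow_add hb1 hC₀ ht) hF.one_le hG hG'
  rw [one_div_div, show 2 * ((2 - b) / 2) - 1 = 1 - b by ring] at hnorm
  filter_upwards [(tendsto_atTop_add_const_right atTop (-1 : ℝ) tendsto_id).eventually hnorm,
    eventually_gt_atTop 1, eventually_le_add_of_neg_le_deriv hβ0 hG hG'] with t hnorm_t ht hGβ
  simp only [id, ← sub_eq_add_neg] at hnorm_t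
  have hGt := hF.one_le t (by linarith)
  have hGprev := hF.one_le (t - 1) (by linarith)
  set S := G t ^ (2 / (2 - b)) + β ^ (1 / (1 - b))
  have hS0 : 0 ≤ S := by positivity
  have hKS : (G t + β) ^ (2 / (2 - b)) ≤ K * S := rpow_two_div_add_le hb0 hb1 (by linarith) hβ
  have hlin : G t + β ≤ K * S :=
    (le_rpow_two_div_two_sub hb0 (by linarith) (by linarith)).trans hKS
  have hprev : G (t - 1) ^ (2 / (2 - b)) ≤ K * S := by
    refine le_trans (Real.rpow_le_rpow (by linarith) (hGβ _ ⟨le_rfl, by linarith⟩) ?_) hKS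
    exact div_nonneg (by norm_num) (by linarith)
  have hβS : β ^ (1 / (1 - b)) ≤ S := le_add_of_nonneg_left (by positivity)
  have hsource : 0 ≤ ∫ τ in (t - 1)..t, F.source τ := Flow.integral_source_nonneg (by linarith)
  calc F.size t ≤ 9 * (A * (K * S + S)) + c * (K * S) + 4 * ∫ τ in (t - 1)..t, F.source τ := by
        refine (hF.size_le hb0 hb1 hC₀ ht hGβ).trans ?_
        gcongr
        exact hnorm_t.trans (by gcongr)
    _ ≤ _ := by
        have : 0 ≤ (9 * (A * (K + 1)) + c * K) * ∫ τ in (t - 1)..t, F.source τ := by positivity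
        linarith
end AbstractFlow

section Difference

open scoped RealInnerProductSpace

variable {H X : Type*} [NormedAddCommGroup H] [InnerProductSpace ℝ H]
  [NormedAddCommGroup X] [InnerProductSpace ℝ X]

namespace Flow

theorem diss_le_size (F : Flow H X) (t : ℝ) : F.diss t ≤ F.size t := by
  unfold size
  linarith [sq_nonneg ‖F.u t - F.ψ t‖, sq_nonneg ‖F.u' t - F.ψ' t‖]

theorem norm_sub_le_sqrt_size (F : Flow H X) {t : ℝ} (ht : 0 < t) :
    ‖F.u t - F.ψ t‖ ≤ √(F.size t) := by
  refine Real.le_sqrt_of_sq_le ?_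
  unfold size
  linarith [diss_nonneg (F := F) ht, sq_nonneg ‖F.u' t - F.ψ' t‖]

theorem norm_deriv_sub_le_sqrt_size (F : Flow H X) {t : ℝ} (ht : 0 < t) :
    ‖F.u' t - F.ψ' t‖ ≤ √(F.size t) := by
  refine Real.le_sqrt_of_sq_le ?_
  unfold size
  linarith [diss_nonneg (F := F) ht, sq_nonneg ‖F.u t - F.ψ t‖]

theorem norm_f_le_sqrt_size (F : Flow H X) {t : ℝ} (ht : 0 < t) : ‖F.f t‖ ≤ √(F.size t) :=
  Real.le_sqrt_of_sq_le ((F.norm_f_sq_le t ht).trans (F.diss_le_size t))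

variable (F₁ F₂ : Flow H X)

/-- The difference `P̄ = (p₁ - Ψ₁) - (p₂ - Ψ₂)` of two solutions with their boundary data
removed. -/
def diff (t : ℝ) : H := (F₁.u t - F₁.ψ t) - (F₂.u t - F₂.ψ t)

/-- The time derivative of `Flow.diff`. -/
def diffDeriv (t : ℝ) : H := (F₁.u' t - F₁.ψ' t) - (F₂.u' t - F₂.ψ' t)

/-- The monotonicity term of the difference of two flows, together with the gradient of the
difference of the boundary data. -/
def monotonicity (t : ℝ) : ℝ := ⟪F₁.f t - F₂.f t, F₁.y t - F₂.y t⟫ + ‖F₁.η t - F₂.η t‖ ^ 2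

/-- The distance `D` of the boundary data of two flows. -/
def dataDist (t : ℝ) : ℝ :=
  ‖F₁.η t - F₂.η t‖ ^ 2 + ‖F₁.η t - F₂.η t‖ + ‖F₁.ψ' t - F₂.ψ' t‖

/-- Two flows whose weak equations may be tested with each other's solutions, together with a
functional `Z` of their difference (which stands for `‖∇P̄‖²` in `L^{2-a}_{W₁}`) that satisfies a
Poincaré inequality and is bounded by the monotonicity term times a power of the dissipations. -/
structure Coupled (γ C₀ : ℝ) (B Z : ℝ → ℝ) : Prop where
  weak₁₂ : ∀ t > 0, ⟪F₁.u' t, F₂.u t - F₂.ψ t⟫ = -⟪F₁.f t, F₂.y t - F₂.η t⟫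
  weak₂₁ : ∀ t > 0, ⟪F₂.u' t, F₁.u t - F₁.ψ t⟫ = -⟪F₂.f t, F₁.y t - F₁.η t⟫
  nonneg : ∀ t > 0, 0 ≤ B t
  le_mul_monotonicity : ∀ t > 0,
    Z t ≤ C₀ * (B t + F₁.diss t + F₂.diss t) ^ γ * F₁.monotonicity F₂ t
  poincare : ∀ t > 0, ‖F₁.diff F₂ t‖ ^ 2 ≤ C₀ * Z t

variable {F₁ F₂} {γ C₀ m : ℝ} {B Z : ℝ → ℝ} {t : ℝ}

theorem dataDist_nonneg (t : ℝ) : 0 ≤ F₁.dataDist F₂ t := by unfold dataDist; positivity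

theorem hasDerivAt_norm_diff_sq (ht : 0 < t) :
    HasDerivAt (fun t => ‖F₁.diff F₂ t‖ ^ 2) (2 * ⟪F₁.diff F₂ t, F₁.diffDeriv F₂ t⟫) t :=
  (((F₁.hasDerivAt_u t ht).sub (F₁.hasDerivAt_ψ t ht)).sub
    ((F₂.hasDerivAt_u t ht).sub (F₂.hasDerivAt_ψ t ht))).norm_sq

theorem abs_inner_diff_diffDeriv_le (ht : 0 < t) (hF₁ : F₁.size t ≤ m) (hF₂ : F₂.size t ≤ m) :
    |⟪F₁.diff F₂ t, F₁.diffDeriv F₂ t⟫| ≤ 2 * √m * ‖F₁.diff F₂ t‖ := by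
  have hderiv : ‖F₁.diffDeriv F₂ t‖ ≤ 2 * √m := by
    rw [two_mul]
    exact (norm_sub_le _ _).trans (add_le_add
      ((F₁.norm_deriv_sub_le_sqrt_size ht).trans (Real.sqrt_le_sqrt hF₁))
      ((F₂.norm_deriv_sub_le_sqrt_size ht).trans (Real.sqrt_le_sqrt hF₂)))
  refine (abs_real_inner_le_norm _ _).trans ?_
  rw [mul_comm]
  gcongr

namespace Coupled

theorem inner_diff_diffDeriv (h : F₁.Coupled F₂ γ C₀ B Z) (ht : 0 < t) :
    ⟪F₁.diff F₂ t, F₁.diffDeriv F₂ t⟫ = -⟪F₁.f t - F₂.f t, F₁.y t - F₂.y t⟫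
      + ⟪F₁.f t - F₂.f t, F₁.η t - F₂.η t⟫ - ⟪F₁.ψ' t - F₂.ψ' t, F₁.diff F₂ t⟫ := by
  have hweak₁₁ := F₁.weak t ht t ht
  have hweak₂₂ := F₂.weak t ht t ht
  have hweak₁₂ := h.weak₁₂ t ht
  have hweak₂₁ := h.weak₂₁ t ht
  rw [real_inner_comm]
  simp only [diff, diffDeriv, inner_sub_left, inner_sub_right] at *
  linarith

theorem monotonicity_le (h : F₁.Coupled F₂ γ C₀ B Z) (ht : 0 < t) (hF₁ : F₁.size t ≤ m)
    (hF₂ : F₂.size t ≤ m) :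
    F₁.monotonicity F₂ t ≤ -⟪F₁.diff F₂ t, F₁.diffDeriv F₂ t⟫
      + (2 * √m * (‖F₁.η t - F₂.η t‖ + ‖F₁.ψ' t - F₂.ψ' t‖) + ‖F₁.η t - F₂.η t‖ ^ 2) := by
  have hf : ⟪F₁.f t - F₂.f t, F₁.η t - F₂.η t⟫ ≤ 2 * √m * ‖F₁.η t - F₂.η t‖ := by
    refine (real_inner_le_norm _ _).trans ?_
    gcongr
    rw [two_mul]
    exact (norm_sub_le _ _).trans (add_le_add
      ((F₁.norm_f_le_sqrt_size ht).trans (Real.sqrt_le_sqrt hF₁))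
      ((F₂.norm_f_le_sqrt_size ht).trans (Real.sqrt_le_sqrt hF₂)))
  have hψ' : -⟪F₁.ψ' t - F₂.ψ' t, F₁.diff F₂ t⟫ ≤ 2 * √m * ‖F₁.ψ' t - F₂.ψ' t‖ := by
    refine (neg_inner_le_norm_mul_norm _ _).trans ?_
    rw [mul_comm]
    gcongr
    rw [two_mul]
    exact (norm_sub_le _ _).trans (add_le_add
      ((F₁.norm_sub_le_sqrt_size ht).trans (Real.sqrt_le_sqrt hF₁))
      ((F₂.norm_sub_le_sqrt_size ht).trans (Real.sqrt_le_sqrt hF₂)))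
  rw [monotonicity, h.inner_diff_diffDeriv ht]
  linarith

theorem monotonicity_le_dataDist (h : F₁.Coupled F₂ γ C₀ B Z) (ht : 0 < t) {r v : ℝ} (hr : 0 ≤ r)
    (hv : 1 ≤ v) (hm : √m = r * v) (hF₁ : F₁.size t ≤ m) (hF₂ : F₂.size t ≤ m) :
    F₁.monotonicity F₂ t
      ≤ -⟪F₁.diff F₂ t, F₁.diffDeriv F₂ t⟫ + (2 * r + 1) * (v * F₁.dataDist F₂ t) := by
  refine (h.monotonicity_le ht hF₁ hF₂).trans ?_
  have hsum : ‖F₁.η t - F₂.η t‖ + ‖F₁.ψ' t - F₂.ψ' t‖ ≤ F₁.dataDist F₂ t := by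
    unfold dataDist
    linarith [sq_nonneg ‖F₁.η t - F₂.η t‖]
  have hsq : ‖F₁.η t - F₂.η t‖ ^ 2 ≤ v * F₁.dataDist F₂ t := by
    refine le_trans ?_ (le_mul_of_one_le_left (dataDist_nonneg t) hv)
    unfold dataDist
    linarith [norm_nonneg (F₁.η t - F₂.η t), norm_nonneg (F₁.ψ' t - F₂.ψ' t)]
  have hlin : 2 * √m * (‖F₁.η t - F₂.η t‖ + ‖F₁.ψ' t - F₂.ψ' t‖)
      ≤ 2 * r * (v * F₁.dataDist F₂ t) := by
    rw [hm, ← mul_assoc, mul_assoc (2 * r)]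
    gcongr
  linarith

theorem nonneg_Z (h : F₁.Coupled F₂ γ C₀ B Z) (hC₀ : 0 < C₀) (ht : 0 < t) : 0 ≤ Z t :=
  nonneg_of_mul_nonneg_right ((sq_nonneg _).trans (h.poincare t ht)) hC₀

-- If the monotonicity term were negative then `Z` and hence `P̄` would vanish.
theorem nonneg_of_monotonicity_le (h : F₁.Coupled F₂ γ C₀ B Z) (hC₀ : 0 < C₀) (ht : 0 < t) {S : ℝ}
    (hS : 0 ≤ S) (hle : F₁.monotonicity F₂ t ≤ -⟪F₁.diff F₂ t, F₁.diffDeriv F₂ t⟫ + S) :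
    0 ≤ -⟪F₁.diff F₂ t, F₁.diffDeriv F₂ t⟫ + S := by
  rcases le_or_gt 0 (F₁.monotonicity F₂ t) with hmono | hmono
  · exact hmono.trans hle
  · have hdiss : 0 ≤ B t + F₁.diss t + F₂.diss t :=
      add_nonneg (add_nonneg (h.nonneg t ht) (diss_nonneg ht)) (diss_nonneg ht)
    have hZ : Z t = 0 := le_antisymm ((h.le_mul_monotonicity t ht).trans
      (mul_nonpos_of_nonneg_of_nonpos (by positivity) hmono.le)) (h.nonneg_Z hC₀ ht)
    have hdiff : F₁.diff F₂ t = 0 := by simpa [hZ] using h.poincare t ht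
    simpa [hdiff] using hS

theorem le_mul_neg_inner_add (h : F₁.Coupled F₂ γ C₀ B Z) (hγ : 0 ≤ γ) (hC₀ : 0 < C₀)
    {C₁ V : ℝ} (hC₁ : 0 ≤ C₁) (ht : 0 < t) (hV : 1 ≤ V) (hBV : B t ≤ V)
    (hF₁ : F₁.size t ≤ C₁ * V) (hF₂ : F₂.size t ≤ C₁ * V) :
    0 ≤ -(2 * ⟪F₁.diff F₂ t, F₁.diffDeriv F₂ t⟫)
        + 2 * (2 * √C₁ + 1) * (V ^ (1 / 2 : ℝ) * F₁.dataDist F₂ t) ∧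
    Z t ≤ C₀ * (1 + 2 * C₁) ^ γ * V ^ γ * (-(2 * ⟪F₁.diff F₂ t, F₁.diffDeriv F₂ t⟫)
        + 2 * (2 * √C₁ + 1) * (V ^ (1 / 2 : ℝ) * F₁.dataDist F₂ t)) := by
  have hV0 : 0 ≤ V := by linarith
  have hD := dataDist_nonneg (F₁ := F₁) (F₂ := F₂) t
  have hmono := h.monotonicity_le_dataDist ht (Real.sqrt_nonneg C₁)
    (Real.one_le_rpow hV (by norm_num : (0 : ℝ) ≤ 1 / 2))
    (by rw [Real.sqrt_mul hC₁, ← Real.sqrt_eq_rpow]) hF₁ hF₂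
  set S := (2 * √C₁ + 1) * (V ^ (1 / 2 : ℝ) * F₁.dataDist F₂ t) with hS
  have hS0 : 0 ≤ S := by positivity
  have hnonneg := h.nonneg_of_monotonicity_le hC₀ ht hS0 hmono
  have hdiss₁ : 0 ≤ F₁.diss t := diss_nonneg ht
  have hdiss₂ : 0 ≤ F₂.diss t := diss_nonneg ht
  have hB := h.nonneg t ht
  have hweight : (B t + F₁.diss t + F₂.diss t) ^ γ ≤ (1 + 2 * C₁) ^ γ * V ^ γ := by
    rw [← Real.mul_rpow (by positivity) hV0]
    refine Real.rpow_le_rpow (by positivity) ?_ hγ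
    linarith [F₁.diss_le_size t, F₂.diss_le_size t]
  rw [mul_assoc 2, ← hS]
  refine ⟨by linarith, ?_⟩
  calc Z t ≤ C₀ * (B t + F₁.diss t + F₂.diss t) ^ γ * F₁.monotonicity F₂ t :=
        h.le_mul_monotonicity t ht
    _ ≤ C₀ * (B t + F₁.diss t + F₂.diss t) ^ γ * (-⟪F₁.diff F₂ t, F₁.diffDeriv F₂ t⟫ + S) := by
        gcongr
    _ ≤ C₀ * ((1 + 2 * C₁) ^ γ * V ^ γ)
          * (2 * (-⟪F₁.diff F₂ t, F₁.diffDeriv F₂ t⟫ + S)) := by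
        gcongr
        linarith
    _ = _ := by ring

end Coupled

theorem exists_limsup_difference_le {C₁ : ℝ} (hγ : 0 < γ) (hC₀ : 0 < C₀) (hC₁ : 0 ≤ C₁) :
    ∃ C > 0, ∀ {H X : Type*} [NormedAddCommGroup H] [InnerProductSpace ℝ H]
      [NormedAddCommGroup X] [InnerProductSpace ℝ X] (F₁ F₂ : Flow H X) (V B Z : ℝ → ℝ),
      F₁.Coupled F₂ γ C₀ B Z → (∀ t ≥ 1, B t ≤ V t) → (∀ t ≥ 1, 1 ≤ V t) →
      (∀ᶠ t in atTop, F₁.size t ≤ C₁ * V t) → (∀ᶠ t in atTop, F₂.size t ≤ C₁ * V t) →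
      (∀ᶠ t in atTop, DifferentiableAt ℝ (fun s => V s ^ γ) t) →
      Tendsto (deriv fun s => V s ^ γ) atTop (𝓝 0) →
      ∫⁻ t in Ioi (1 : ℝ), ENNReal.ofReal (V t ^ (-γ)) = ⊤ →
      limsup (fun t => ENNReal.ofReal (Z t)) atTop
        ≤ ENNReal.ofReal C * limsup (fun t => ENNReal.ofReal
            ((V t ^ (3 * (γ + 1 / 2)) * F₁.dataDist F₂ t) ^ (1 / 2 : ℝ))) atTop
          + ENNReal.ofReal C * limsup (fun t => ENNReal.ofReal
            (V t ^ (γ + 1 / 2) * F₁.dataDist F₂ t)) atTop := by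
  have hweight : 0 ≤ C₀ * (1 + 2 * C₁) ^ γ := by positivity
  have hsqrt := Real.sqrt_nonneg C₁
  set C := 1 + C₀ + 4 * √C₁ + 2 * (2 * √C₁ + 1) + C₀ * (1 + 2 * C₁) ^ γ
  refine ⟨2 * C ^ 4, by positivity, fun F₁ F₂ V B Z h hBV hV1 hF₁ hF₂ hVd hVlim hVint => ?_⟩
  have hC₀C : C₀ ≤ C := by linarith
  refine limsup_le_of_differential_inequality hγ (by linarith : 1 ≤ C)
    (y := fun t => ‖F₁.diff F₂ t‖ ^ 2) hV1 hVd hVlim hVint (fun t _ => dataDist_nonneg t)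
    (fun t _ => sq_nonneg _) (fun t ht => (h.poincare t ht).trans ?_)
    (fun t ht => hasDerivAt_norm_diff_sq ht) ?_ ?_
  · exact mul_le_mul_of_nonneg_right hC₀C (h.nonneg_Z hC₀ ht)
  · filter_upwards [hF₁, hF₂, eventually_ge_atTop 1] with t hF₁t hF₂t ht
    have hVt := hV1 t ht
    obtain ⟨hnonneg, hZ⟩ := h.le_mul_neg_inner_add hγ.le hC₀ hC₁ (by linarith) hVt (hBV t ht)
      hF₁t hF₂t
    have hD := dataDist_nonneg (F₁ := F₁) (F₂ := F₂) t
    refine hZ.trans ?_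
    gcongr <;> linarith
  · filter_upwards [hF₁, hF₂, eventually_ge_atTop 1] with t hF₁t hF₂t ht
    have hVt := hV1 t ht
    have hinner := abs_inner_diff_diffDeriv_le (by linarith) hF₁t hF₂t
    rw [Real.sqrt_mul hC₁] at hinner
    rw [abs_mul, abs_two, ← Real.sqrt_eq_rpow, ← Real.sqrt_eq_rpow, Real.sqrt_sq (norm_nonneg _)]
    calc 2 * |⟪F₁.diff F₂ t, F₁.diffDeriv F₂ t⟫| ≤ 4 * √C₁ * (√(V t) * ‖F₁.diff F₂ t‖) := by
          linarith
      _ ≤ C * (√(V t) * ‖F₁.diff F₂ t‖) := by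
          gcongr
          linarith

end Flow

end Difference

section Weighted

variable {n : ℕ} {U : Set (E n)} {w : E n → ℝ} {F : Type*} [NormedAddCommGroup F]

theorem wMeasure_absolutelyContinuous : wMeasure U w ≪ volume.restrict U :=
  withDensity_absolutelyContinuous _ _

theorem ae_wMeasure_of_forall_mem (hU : MeasurableSet U) {p : E n → Prop} (h : ∀ x ∈ U, p x) :
    ∀ᵐ x ∂wMeasure U w, p x :=
  wMeasure_absolutelyContinuous.ae_le ((ae_restrict_mem hU).mono h)

theorem lintegral_wMeasure (hw : AEMeasurable w (volume.restrict U)) (f : E n → ℝ≥0∞) :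
    ∫⁻ x, f x ∂wMeasure U w = ∫⁻ x in U, ENNReal.ofReal (w x) * f x := by
  rw [wMeasure, lintegral_withDensity_eq_lintegral_mul_non_measurable₀ _ hw.ennreal_ofReal
    (ae_of_all _ fun _ => ENNReal.ofReal_lt_top)]
  rfl

theorem integral_wMeasure (hU : MeasurableSet U) (hw : AEMeasurable w (volume.restrict U))
    (hw0 : ∀ x ∈ U, 0 ≤ w x) (f : E n → ℝ) :
    ∫ x, f x ∂wMeasure U w = ∫ x in U, w x * f x := by
  rw [wMeasure, integral_withDensity_eq_integral_toReal_smul₀ hw.ennreal_ofReal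
    (ae_of_all _ fun _ => ENNReal.ofReal_lt_top)]
  refine integral_congr_ae ?_
  filter_upwards [ae_restrict_mem hU] with x hx
  rw [ENNReal.toReal_ofReal (hw0 x hx), smul_eq_mul]

theorem wNorm_eq_eLpNorm (hU : MeasurableSet U) (hw : AEMeasurable w (volume.restrict U))
    (hw0 : ∀ x ∈ U, 0 ≤ w x) {q : ℝ} (hq : 0 < q) (u : E n → F) :
    wNorm U w q u = eLpNorm u (ENNReal.ofReal q) (wMeasure U w) := by
  rw [eLpNorm_eq_lintegral_rpow_enorm_toReal (by simpa using hq) ENNReal.ofReal_ne_top,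
    lintegral_wMeasure hw, ENNReal.toReal_ofReal hq.le, wNorm]
  congr 1
  refine lintegral_congr_ae ?_
  filter_upwards [ae_restrict_mem hU] with x hx
  rw [ENNReal.ofReal_mul (hw0 x hx), ← ENNReal.ofReal_rpow_of_nonneg (norm_nonneg _) hq.le,
    ofReal_norm]

theorem wNorm_two_eq_eLpNorm (hU : MeasurableSet U) (hw : AEMeasurable w (volume.restrict U))
    (hw0 : ∀ x ∈ U, 0 ≤ w x) (u : E n → F) :
    wNorm U w 2 u = eLpNorm u 2 (wMeasure U w) := by
  rw [wNorm_eq_eLpNorm hU hw hw0 two_pos]; simp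

theorem wNorm_two_eq_norm (hU : MeasurableSet U) (hw : AEMeasurable w (volume.restrict U))
    (hw0 : ∀ x ∈ U, 0 ≤ w x) {u : E n → F} {c : Lp F 2 (wMeasure U w)}
    (hc : c =ᵐ[wMeasure U w] u) : wNorm U w 2 u = ENNReal.ofReal ‖c‖ := by
  rw [wNorm_two_eq_eLpNorm hU hw hw0, ← eLpNorm_congr_ae hc, ofReal_norm, Lp.enorm_def]

theorem norm_sq_eq_integral [InnerProductSpace ℝ F] {u : E n → F} {c : Lp F 2 (wMeasure U w)}
    (hc : c =ᵐ[wMeasure U w] u) : ‖c‖ ^ 2 = ∫ x, ‖u x‖ ^ 2 ∂wMeasure U w := by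
  rw [← real_inner_self_eq_norm_sq, L2.inner_def]
  refine integral_congr_ae ?_
  filter_upwards [hc] with x hx
  rw [real_inner_self_eq_norm_sq, hx]

theorem wInt_two_eq_norm_sq [InnerProductSpace ℝ F] (hU : MeasurableSet U)
    (hw : AEMeasurable w (volume.restrict U)) (hw0 : ∀ x ∈ U, 0 ≤ w x) {u : E n → F}
    {c : Lp F 2 (wMeasure U w)} (hc : c =ᵐ[wMeasure U w] u) : wInt U w 2 u = ‖c‖ ^ 2 := by
  rw [norm_sq_eq_integral hc, integral_wMeasure hU hw hw0, wInt]
  simp_rw [Real.rpow_two]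

theorem wInt_nonneg (hU : MeasurableSet U) (hw0 : ∀ x ∈ U, 0 ≤ w x) {q : ℝ} (u : E n → F) :
    0 ≤ wInt U w q u :=
  setIntegral_nonneg hU fun x hx => mul_nonneg (hw0 x hx) (Real.rpow_nonneg (norm_nonneg _) _)

theorem inner_eq_integral_of_ae [InnerProductSpace ℝ F] {u v : E n → F}
    {c d : Lp F 2 (wMeasure U w)} (hc : c =ᵐ[wMeasure U w] u) (hd : d =ᵐ[wMeasure U w] v) :
    inner ℝ c d = ∫ x, inner ℝ (u x) (v x) ∂wMeasure U w := by
  rw [L2.inner_def]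
  refine integral_congr_ae ?_
  filter_upwards [hc, hd] with x hcx hdx
  rw [hcx, hdx]

theorem integrable_inner_of_ae [InnerProductSpace ℝ F] {u v : E n → F}
    {c d : Lp F 2 (wMeasure U w)} (hc : c =ᵐ[wMeasure U w] u) (hd : d =ᵐ[wMeasure U w] v) :
    Integrable (fun x => inner ℝ (u x) (v x)) (wMeasure U w) := by
  refine (L2.integrable_inner (𝕜 := ℝ) c d).congr ?_
  filter_upwards [hc, hd] with x hcx hdx
  rw [hcx, hdx]

theorem coeFn_sub_ae {u v : E n → F} {c d : Lp F 2 (wMeasure U w)}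
    (hc : c =ᵐ[wMeasure U w] u) (hd : d =ᵐ[wMeasure U w] v) :
    (c - d : Lp F 2 (wMeasure U w)) =ᵐ[wMeasure U w] fun x => u x - v x := by
  filter_upwards [Lp.coeFn_sub c d, hc, hd] with x hsub hcx hdx
  rw [hsub, Pi.sub_apply, hcx, hdx]

theorem inner_le_inner_of_ae [InnerProductSpace ℝ F] (hU : MeasurableSet U)
    {u₁ v₁ u₂ v₂ : E n → F} {c₁ d₁ c₂ d₂ : Lp F 2 (wMeasure U w)}
    (hc₁ : c₁ =ᵐ[wMeasure U w] u₁) (hd₁ : d₁ =ᵐ[wMeasure U w] v₁)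
    (hc₂ : c₂ =ᵐ[wMeasure U w] u₂) (hd₂ : d₂ =ᵐ[wMeasure U w] v₂)
    (h : ∀ x ∈ U, inner ℝ (u₁ x) (v₁ x) ≤ inner ℝ (u₂ x) (v₂ x)) :
    inner ℝ c₁ d₁ ≤ inner ℝ c₂ d₂ := by
  rw [inner_eq_integral_of_ae hc₁ hd₁, inner_eq_integral_of_ae hc₂ hd₂]
  exact integral_mono_ae (integrable_inner_of_ae hc₁ hd₁) (integrable_inner_of_ae hc₂ hd₂)
    (ae_wMeasure_of_forall_mem hU h)

end Weighted

section Pointwise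

variable {n N : ℕ}

/-- The exponents of a Forchheimer polynomial that is not constant in `s`: `0 = α₀ < ⋯ < α_N` with
`N ≥ 1`. -/
structure AdmissibleExp (α : Fin (N + 1) → ℝ) : Prop where
  one_le : 1 ≤ N
  zero : α 0 = 0
  mono : StrictMono α

/-- The conditions that `IsMedium` imposes on the coefficients at a single point `x`, which are all
that the pointwise estimates of the flux need. -/
structure AdmissibleAt (a : Fin (N + 1) → E n → ℝ) (x : E n) : Prop where
  nonneg : ∀ j, 0 ≤ a j x
  zero_pos : 0 < a 0 x
  last_pos : 0 < a (Fin.last N) x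

theorem IsMedium.admissibleAt {U : Set (E n)} {φ : E n → ℝ} {a : Fin (N + 1) → E n → ℝ}
    (hm : IsMedium U φ a) {x : E n} (hx : x ∈ U) : AdmissibleAt a x :=
  ⟨fun j => hm.coeff_nonneg j x hx, hm.coeff_zero_pos x hx, hm.coeff_last_pos x hx⟩

variable {α : Fin (N + 1) → ℝ} {a : Fin (N + 1) → E n → ℝ} {x : E n}
  {H : Type*} [NormedAddCommGroup H] [InnerProductSpace ℝ H]

namespace AdmissibleExp

theorem nonneg (hα : AdmissibleExp α) (j : Fin (N + 1)) : 0 ≤ α j := by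
  rw [← hα.zero]; exact hα.mono.monotone (Fin.zero_le j)

theorem le_last (hα : AdmissibleExp α) (j : Fin (N + 1)) : α j ≤ α (Fin.last N) :=
  hα.mono.monotone (Fin.le_last j)

theorem last_pos (hα : AdmissibleExp α) : 0 < α (Fin.last N) := by
  rw [← hα.zero]; exact hα.mono (by rw [Fin.lt_def]; exact hα.one_le)

theorem pos_of_ne (hα : AdmissibleExp α) {j : Fin (N + 1)} (hj : j ≠ 0) : 0 < α j := by
  rw [← hα.zero]; exact hα.mono (Fin.pos_of_ne_zero hj)

theorem aExp_pos (hα : AdmissibleExp α) : 0 < aExp α := by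
  have := hα.last_pos; unfold aExp; positivity

theorem aExp_lt_one (hα : AdmissibleExp α) : aExp α < 1 := by
  have := hα.last_pos; unfold aExp; rw [div_lt_one (by positivity)]; linarith

end AdmissibleExp

theorem g_nonneg (ha : AdmissibleAt a x) {s : ℝ} (hs : 0 ≤ s) : 0 ≤ g α a x s :=
  Finset.sum_nonneg fun j _ => mul_nonneg (ha.nonneg j) (Real.rpow_nonneg hs _)

theorem coeff_zero_le_g (hα : AdmissibleExp α) (ha : AdmissibleAt a x) {s : ℝ} (hs : 0 ≤ s) :
    a 0 x ≤ g α a x s := by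
  have := Finset.single_le_sum (f := fun j => a j x * s ^ α j)
    (fun j _ => mul_nonneg (ha.nonneg j) (Real.rpow_nonneg hs _)) (Finset.mem_univ 0)
  simpa [hα.zero, g] using this

theorem g_pos (hα : AdmissibleExp α) (ha : AdmissibleAt a x) {s : ℝ} (hs : 0 ≤ s) :
    0 < g α a x s := ha.zero_pos.trans_le (coeff_zero_le_g hα ha hs)

theorem g_mono (hα : AdmissibleExp α) (ha : AdmissibleAt a x) {s t : ℝ} (hs : 0 ≤ s)
    (hst : s ≤ t) : g α a x s ≤ g α a x t :=
  Finset.sum_le_sum fun j _ => mul_le_mul_of_nonneg_left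
    (Real.rpow_le_rpow hs hst (hα.nonneg j)) (ha.nonneg j)

theorem g_zero (hα : AdmissibleExp α) : g α a x 0 = a 0 x := by
  unfold g
  rw [Finset.sum_eq_single 0]
  · simp [hα.zero]
  · intro j _ hj
    rw [Real.zero_rpow (hα.pos_of_ne hj).ne', mul_zero]
  · simp

theorem continuous_g (hα : AdmissibleExp α) : Continuous (g α a x) :=
  continuous_finsetSum _ fun j _ => continuous_const.mul (Real.continuous_rpow_const (hα.nonneg j))

theorem sSol_spec (hα : AdmissibleExp α) (ha : AdmissibleAt a x) {ξ : ℝ} (hξ : 0 ≤ ξ) :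
    0 ≤ sSol α a x ξ ∧ sSol α a x ξ * g α a x (sSol α a x ξ) = ξ := by
  set f : ℝ → ℝ := fun s => s * g α a x s
  have hf : Continuous f := continuous_id.mul (continuous_g hα)
  have hclosed : IsClosed {s : ℝ | 0 ≤ s ∧ s * g α a x s = ξ} :=
    (isClosed_le continuous_const continuous_id).inter (isClosed_eq hf continuous_const)
  have hne : {s : ℝ | 0 ≤ s ∧ s * g α a x s = ξ}.Nonempty := by
    have hb : 0 ≤ ξ / a 0 x := div_nonneg hξ ha.zero_pos.le
    have := intermediate_value_Icc hb hf.continuousOn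
    obtain ⟨s, hs, hs'⟩ := this (show ξ ∈ Icc (f 0) (f (ξ / a 0 x)) by
      refine ⟨by simpa [f] using hξ, ?_⟩
      calc ξ = ξ / a 0 x * a 0 x := by field_simp [ha.zero_pos.ne']
        _ ≤ _ := mul_le_mul_of_nonneg_left (coeff_zero_le_g hα ha hb) hb)
    exact ⟨s, hs.1, hs'⟩
  exact hclosed.csInf_mem hne ⟨0, fun s hs => hs.1⟩

/-- The flux `K(x,|y|) y` driven by the gradient `y`, which may lie in any real inner product
space. -/
def flux (α : Fin (N + 1) → ℝ) (a : Fin (N + 1) → E n → ℝ) (x : E n) (y : H) : H :=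
  K α a x ‖y‖ • y

theorem norm_flux (hα : AdmissibleExp α) (ha : AdmissibleAt a x) (y : H) :
    ‖flux α a x y‖ = sSol α a x ‖y‖ := by
  obtain ⟨hs, hsξ⟩ := sSol_spec hα ha (norm_nonneg y)
  have hg := g_pos hα ha hs
  rw [flux, norm_smul, K, Real.norm_of_nonneg (by positivity)]
  nth_rewrite 2 [← hsξ]
  field_simp

theorem g_smul_flux (hα : AdmissibleExp α) (ha : AdmissibleAt a x) (y : H) :
    g α a x ‖flux α a x y‖ • flux α a x y = y := by
  rw [norm_flux hα ha, flux, K, smul_smul, mul_one_div_cancel, one_smul]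
  exact (g_pos hα ha (sSol_spec hα ha (norm_nonneg y)).1).ne'

theorem norm_coeff_zero_smul_flux_le (hα : AdmissibleExp α) (ha : AdmissibleAt a x) (y : H) :
    ‖a 0 x • flux α a x y‖ ≤ ‖y‖ := by
  conv_rhs => rw [← g_smul_flux hα ha y]
  rw [norm_smul, norm_smul, Real.norm_of_nonneg ha.zero_pos.le,
    Real.norm_of_nonneg (g_nonneg ha (norm_nonneg _))]
  exact mul_le_mul_of_nonneg_right (coeff_zero_le_g hα ha (norm_nonneg _)) (norm_nonneg _)

/-- The potential of the flux, expressed through the speed `s = |K(x,|y|) y|`: the gradient of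
`y ↦ potential α a x ‖flux α a x y‖` is `flux α a x`, and this function is half of
`∫₀^{|y|²} K(x,√r) dr`. -/
def potential (α : Fin (N + 1) → ℝ) (a : Fin (N + 1) → E n → ℝ) (x : E n) (s : ℝ) : ℝ :=
  ∑ j, a j x * ((α j + 1) / (α j + 2) * s ^ (α j + 2))

theorem sq_mul_g (hα : AdmissibleExp α) {s : ℝ} (hs : 0 ≤ s) :
    s ^ 2 * g α a x s = ∑ j, a j x * s ^ (α j + 2) := by
  unfold g
  rw [Finset.mul_sum]
  refine Finset.sum_congr rfl fun j _ => ?_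
  rw [Real.rpow_add_of_nonneg hs (hα.nonneg j) (by norm_num)]
  norm_cast
  ring

theorem potential_le_sq_mul_g (hα : AdmissibleExp α) (ha : AdmissibleAt a x) {s : ℝ} (hs : 0 ≤ s) :
    potential α a x s ≤ s ^ 2 * g α a x s := by
  rw [sq_mul_g hα hs]
  refine Finset.sum_le_sum fun j _ => mul_le_mul_of_nonneg_left ?_ (ha.nonneg j)
  have := hα.nonneg j
  refine mul_le_of_le_one_left (Real.rpow_nonneg hs _) ?_
  rw [div_le_one (by positivity)]; linarith

theorem sq_mul_g_le_two_mul_potential (hα : AdmissibleExp α) (ha : AdmissibleAt a x) {s : ℝ}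
    (hs : 0 ≤ s) :
    s ^ 2 * g α a x s ≤ 2 * potential α a x s := by
  rw [sq_mul_g hα hs, potential, Finset.mul_sum]
  refine Finset.sum_le_sum fun j _ => ?_
  rw [mul_left_comm]
  refine mul_le_mul_of_nonneg_left ?_ (ha.nonneg j)
  have := hα.nonneg j
  rw [← mul_assoc]
  refine le_mul_of_one_le_left (Real.rpow_nonneg hs _) ?_
  rw [mul_div_assoc', one_le_div (by positivity)]; linarith

theorem potential_nonneg (hα : AdmissibleExp α) (ha : AdmissibleAt a x) {s : ℝ} (hs : 0 ≤ s) :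
    0 ≤ potential α a x s := by
  have henergy : 0 ≤ s ^ 2 * g α a x s := mul_nonneg (sq_nonneg s) (g_nonneg ha hs)
  linarith [sq_mul_g_le_two_mul_potential hα ha hs]

theorem inner_sub_smul_sub_smul (v w : H) (b c : ℝ) :
    inner ℝ (w - v) (c • w - b • v)
      = (c + b) / 2 * ‖w - v‖ ^ 2 + (c - b) / 2 * (‖w‖ ^ 2 - ‖v‖ ^ 2) := by
  rw [norm_sub_sq_real]
  simp only [inner_sub_left, inner_sub_right, inner_smul_right, real_inner_self_eq_norm_sq,
    real_inner_comm w v]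
  ring

theorem half_add_g_mul_norm_sq_le_inner (hα : AdmissibleExp α) (ha : AdmissibleAt a x) (v w : H) :
    (g α a x ‖w‖ + g α a x ‖v‖) / 2 * ‖w - v‖ ^ 2
      ≤ inner ℝ (w - v) (g α a x ‖w‖ • w - g α a x ‖v‖ • v) := by
  rw [inner_sub_smul_sub_smul]
  have : 0 ≤ (g α a x ‖w‖ - g α a x ‖v‖) / 2 * (‖w‖ ^ 2 - ‖v‖ ^ 2) := by
    rcases le_total ‖v‖ ‖w‖ with h | h
    · have hg := g_mono hα ha (norm_nonneg v) h
      have hsq := pow_le_pow_left₀ (norm_nonneg v) h 2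
      exact mul_nonneg (by linarith) (by linarith)
    · have hg := g_mono hα ha (norm_nonneg w) h
      have hsq := pow_le_pow_left₀ (norm_nonneg w) h 2
      exact mul_nonneg_of_nonpos_of_nonpos (by linarith) (by linarith)
  linarith

theorem flux_cocoercive (hα : AdmissibleExp α) (ha : AdmissibleAt a x) (y z : H) :
    a 0 x * ‖flux α a x z - flux α a x y‖ ^ 2
      ≤ inner ℝ (flux α a x z - flux α a x y) (z - y) := by
  have h := half_add_g_mul_norm_sq_le_inner hα ha (flux α a x y) (flux α a x z)
  rw [g_smul_flux hα ha, g_smul_flux hα ha] at h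
  refine le_trans (mul_le_mul_of_nonneg_right ?_ (sq_nonneg _)) h
  linarith [coeff_zero_le_g hα ha (norm_nonneg (flux α a x y)),
    coeff_zero_le_g hα ha (norm_nonneg (flux α a x z))]

theorem inner_flux_self (hα : AdmissibleExp α) (ha : AdmissibleAt a x) (y : H) :
    inner ℝ (flux α a x y) y = ‖flux α a x y‖ ^ 2 * g α a x ‖flux α a x y‖ := by
  nth_rewrite 2 [← g_smul_flux hα ha y]
  rw [inner_smul_right, real_inner_self_eq_norm_sq]
  ring

theorem coeff_zero_mul_norm_flux_sq_le_inner (hα : AdmissibleExp α) (ha : AdmissibleAt a x)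
    (y : H) : a 0 x * ‖flux α a x y‖ ^ 2 ≤ inner ℝ (flux α a x y) y := by
  rw [inner_flux_self hα ha, mul_comm]
  exact mul_le_mul_of_nonneg_left (coeff_zero_le_g hα ha (norm_nonneg _)) (sq_nonneg _)

theorem g_sub_mul_le (hα : AdmissibleExp α) (ha : AdmissibleAt a x) {s t : ℝ} (hs : 0 ≤ s)
    (hst : s ≤ t) :
    (g α a x t - g α a x s) * s ≤ (1 + α (Fin.last N)) * g α a x t * (t - s) := by
  unfold g
  rw [← Finset.sum_sub_distrib, Finset.sum_mul, Finset.mul_sum, Finset.sum_mul]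
  refine Finset.sum_le_sum fun j _ => ?_
  have hpow := rpow_sub_rpow_mul_le hs hst (hα.nonneg j)
  have hlast := hα.le_last j
  have htpow : 0 ≤ t ^ α j := Real.rpow_nonneg (hs.trans hst) _
  have haj := ha.nonneg j
  calc (a j x * t ^ α j - a j x * s ^ α j) * s = a j x * ((t ^ α j - s ^ α j) * s) := by ring
    _ ≤ a j x * ((1 + α j) * t ^ α j * (t - s)) := by gcongr
    _ ≤ a j x * ((1 + α (Fin.last N)) * t ^ α j * (t - s)) := by gcongr
    _ = _ := by ring

theorem norm_g_smul_sub_le (hα : AdmissibleExp α) (ha : AdmissibleAt a x) {v w : H}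
    (h : ‖v‖ ≤ ‖w‖) :
    ‖g α a x ‖w‖ • w - g α a x ‖v‖ • v‖
      ≤ (2 + α (Fin.last N)) * g α a x ‖w‖ * ‖w - v‖ := by
  have hg := g_nonneg (α := α) ha (norm_nonneg w)
  have hmono := g_mono hα ha (norm_nonneg v) h
  have hsub := g_sub_mul_le hα ha (norm_nonneg v) h
  have hnorm : ‖w‖ - ‖v‖ ≤ ‖w - v‖ := norm_sub_norm_le w v
  have hl := hα.last_pos
  calc ‖g α a x ‖w‖ • w - g α a x ‖v‖ • v‖
      = ‖g α a x ‖w‖ • (w - v) + (g α a x ‖w‖ - g α a x ‖v‖) • v‖ := by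
        congr 1; module
    _ ≤ g α a x ‖w‖ * ‖w - v‖ + (g α a x ‖w‖ - g α a x ‖v‖) * ‖v‖ := by
        refine (norm_add_le _ _).trans_eq ?_
        rw [norm_smul, norm_smul, Real.norm_of_nonneg hg,
          Real.norm_of_nonneg (sub_nonneg.2 hmono)]
    _ ≤ g α a x ‖w‖ * ‖w - v‖ + (1 + α (Fin.last N)) * g α a x ‖w‖ * ‖w - v‖ := by
        refine add_le_add_right (hsub.trans ?_) _
        gcongr
    _ = _ := by ring

theorem norm_sub_sq_le_mul_inner_flux_of_le (hα : AdmissibleExp α) (ha : AdmissibleAt a x) {y z : H}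
    (h : ‖flux α a x y‖ ≤ ‖flux α a x z‖) :
    ‖z - y‖ ^ 2 ≤ 2 * (2 + α (Fin.last N)) ^ 2 * g α a x ‖flux α a x z‖ *
      inner ℝ (flux α a x z - flux α a x y) (z - y) := by
  have hlip := norm_g_smul_sub_le hα ha h
  have hmono := half_add_g_mul_norm_sq_le_inner hα ha (flux α a x y) (flux α a x z)
  rw [g_smul_flux hα ha, g_smul_flux hα ha] at hlip hmono
  have hg := g_nonneg (α := α) ha (norm_nonneg (flux α a x z))
  have hg' := g_nonneg (α := α) ha (norm_nonneg (flux α a x y))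
  have hl := hα.last_pos
  calc ‖z - y‖ ^ 2
      ≤ ((2 + α (Fin.last N)) * g α a x ‖flux α a x z‖ * ‖flux α a x z - flux α a x y‖) ^ 2 := by
        gcongr
    _ = 2 * (2 + α (Fin.last N)) ^ 2 * g α a x ‖flux α a x z‖ *
          ((g α a x ‖flux α a x z‖ + 0) / 2 * ‖flux α a x z - flux α a x y‖ ^ 2) := by ring
    _ ≤ _ := by
        gcongr
        refine le_trans ?_ hmono
        gcongr

theorem norm_sub_sq_div_g_le_mul_inner_flux (hα : AdmissibleExp α) (ha : AdmissibleAt a x)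
    (y z : H) :
    ‖z - y‖ ^ 2 / g α a x (max ‖flux α a x y‖ ‖flux α a x z‖)
      ≤ 2 * (2 + α (Fin.last N)) ^ 2 * inner ℝ (flux α a x z - flux α a x y) (z - y) := by
  rw [div_le_iff₀ (g_pos hα ha (le_max_of_le_left (norm_nonneg _)))]
  rcases le_total ‖flux α a x y‖ ‖flux α a x z‖ with h | h
  · rw [max_eq_right h]
    linarith [norm_sub_sq_le_mul_inner_flux_of_le hα ha h]
  · rw [max_eq_left h]
    have := norm_sub_sq_le_mul_inner_flux_of_le hα ha h
    rw [norm_sub_rev, ← neg_sub (flux α a x z), ← neg_sub z, inner_neg_neg] at this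
    linarith

theorem norm_eq_mul_g_norm_flux (hα : AdmissibleExp α) (ha : AdmissibleAt a x) (y : H) :
    ‖y‖ = ‖flux α a x y‖ * g α a x ‖flux α a x y‖ := by
  conv_lhs => rw [← g_smul_flux hα ha y, norm_smul,
    Real.norm_of_nonneg (g_nonneg ha (norm_nonneg _)), mul_comm]

theorem mul_mul_g_sub_le_potential_sub (hα : AdmissibleExp α) (ha : AdmissibleAt a x) {s t : ℝ}
    (hs : 0 ≤ s) (ht : 0 ≤ t) :
    s * (t * g α a x t) - s ^ 2 * g α a x s ≤ potential α a x t - potential α a x s := by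
  rw [sq_mul_g hα hs]
  simp only [g, potential]
  rw [Finset.mul_sum, Finset.mul_sum, ← Finset.sum_sub_distrib, ← Finset.sum_sub_distrib]
  refine Finset.sum_le_sum fun j _ => ?_
  have := mul_le_mul_of_nonneg_left (mul_mul_rpow_sub_rpow_le hs ht (hα.nonneg j)) (ha.nonneg j)
  linarith

theorem inner_flux_sub_le_potential_sub (hα : AdmissibleExp α) (ha : AdmissibleAt a x) (y z : H) :
    inner ℝ (flux α a x y) (z - y)
      ≤ potential α a x ‖flux α a x z‖ - potential α a x ‖flux α a x y‖ := by
  have hyz : inner ℝ (flux α a x y) z ≤ ‖flux α a x y‖ * ‖z‖ := real_inner_le_norm _ _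
  rw [norm_eq_mul_g_norm_flux hα ha z] at hyz
  rw [inner_sub_right, inner_flux_self hα ha]
  exact (sub_le_sub_right hyz _).trans
    (mul_mul_g_sub_le_potential_sub hα ha (norm_nonneg _) (norm_nonneg _))

theorem le_maxCoeff (j : Fin (N + 1)) : a j x ≤ maxCoeff a x :=
  Finset.le_sup' (fun j => a j x) (Finset.mem_univ j)

theorem maxCoeff_pos (ha : AdmissibleAt a x) : 0 < maxCoeff a x :=
  ha.zero_pos.trans_le (le_maxCoeff 0)

theorem W1_nonneg (ha : AdmissibleAt a x) : 0 ≤ W1 α a x :=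
  div_nonneg (Real.rpow_nonneg ha.last_pos.le _)
    (mul_nonneg (by positivity) (maxCoeff_pos ha).le)

theorem le_two_mul_card_mul_maxCoeff (hα : AdmissibleExp α) (ha : AdmissibleAt a x)
    (j : Fin (N + 1)) : a j x ≤ 2 * N * maxCoeff a x := by
  have hN : (1 : ℝ) ≤ N := by exact_mod_cast hα.one_le
  have hM := maxCoeff_pos ha
  nlinarith [le_maxCoeff (a := a) (x := x) j]

theorem g_le_two_mul_card_mul_maxCoeff_mul (hα : AdmissibleExp α) (ha : AdmissibleAt a x)
    {s r : ℝ} (hs : 0 ≤ s) (hr : 0 ≤ r) (hsr : ∀ j, s ^ α j ≤ r) :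
    g α a x s ≤ 2 * N * maxCoeff a x * r := by
  have hN : (1 : ℝ) ≤ N := by exact_mod_cast hα.one_le
  have hM := maxCoeff_pos ha
  calc g α a x s ≤ ∑ _j : Fin (N + 1), maxCoeff a x * r :=
        Finset.sum_le_sum fun j _ =>
          mul_le_mul (le_maxCoeff j) (hsr j) (Real.rpow_nonneg hs _) hM.le
    _ = (N + 1) * maxCoeff a x * r := by simp [mul_assoc]
    _ ≤ 2 * N * maxCoeff a x * r := by gcongr; linarith

theorem W1_rpow_two_div_aExp (hα : AdmissibleExp α) (ha : AdmissibleAt a x) :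
    W1 α a x ^ (2 / aExp α)
      = a (Fin.last N) x ^ 2 / (2 * N * maxCoeff a x) ^ (2 / aExp α) := by
  have hM := maxCoeff_pos ha
  rw [W1, Real.div_rpow (Real.rpow_nonneg ha.last_pos.le _) (by positivity),
    ← Real.rpow_mul ha.last_pos.le, mul_div_cancel₀ _ hα.aExp_pos.ne', Real.rpow_two]

theorem W1_rpow_mul_g_rpow_le_of_le_one (hα : AdmissibleExp α) (ha : AdmissibleAt a x) {s : ℝ}
    (hs : 0 ≤ s) (hs1 : s ≤ 1) :
    W1 α a x ^ (2 / aExp α) * g α a x s ^ ((2 - aExp α) / aExp α) ≤ a (Fin.last N) x := by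
  have hb := hα.aExp_pos
  have hb1 := hα.aExp_lt_one
  have hA := ha.last_pos
  have hgm := g_le_two_mul_card_mul_maxCoeff_mul hα ha hs zero_le_one
    fun j => Real.rpow_le_one hs hs1 (hα.nonneg j)
  have hAm := le_two_mul_card_mul_maxCoeff hα ha (Fin.last N)
  rw [mul_one] at hgm
  rw [W1_rpow_two_div_aExp hα ha]
  set m : ℝ := 2 * N * maxCoeff a x
  have hm : 0 < m := hA.trans_le hAm
  have hg := g_nonneg (α := α) ha hs
  have hexp : 2 / aExp α = (2 - aExp α) / aExp α + 1 := by field_simp; ring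
  have hexp0 : 0 ≤ (2 - aExp α) / aExp α := div_nonneg (by linarith) hb.le
  calc _ ≤ a (Fin.last N) x ^ 2 / m ^ (2 / aExp α) * m ^ ((2 - aExp α) / aExp α) := by gcongr
    _ = a (Fin.last N) x ^ 2 / m := by
        rw [hexp, Real.rpow_add hm, Real.rpow_one]
        field_simp
    _ ≤ a (Fin.last N) x := by rw [div_le_iff₀ hm]; nlinarith

theorem W1_rpow_mul_g_rpow_le_of_one_le (hα : AdmissibleExp α) (ha : AdmissibleAt a x) {s : ℝ}
    (hs1 : 1 ≤ s) :
    W1 α a x ^ (2 / aExp α) * g α a x s ^ ((2 - aExp α) / aExp α) ≤ s ^ 2 * g α a x s := by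
  have hb := hα.aExp_pos
  have hb1 := hα.aExp_lt_one
  have hA := ha.last_pos
  have hs : 0 ≤ s := zero_le_one.trans hs1
  have hgm := g_le_two_mul_card_mul_maxCoeff_mul hα ha hs (Real.rpow_nonneg hs _)
    fun j => Real.rpow_le_rpow_of_exponent_le hs1 (hα.le_last j)
  have hAm := le_two_mul_card_mul_maxCoeff hα ha (Fin.last N)
  rw [W1_rpow_two_div_aExp hα ha]
  set m : ℝ := 2 * N * maxCoeff a x
  have hm : 0 < m := hA.trans_le hAm
  have hg := g_pos hα ha hs
  have hexp : (2 - aExp α) / aExp α = (2 / aExp α - 2) + 1 := by field_simp; ring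
  have hexp0 : 0 ≤ 2 / aExp α - 2 := by rw [sub_nonneg, le_div_iff₀ hb]; linarith
  have hexp_last : α (Fin.last N) * (2 / aExp α - 2) = 2 := by
    have := hα.last_pos
    unfold aExp; field_simp; ring
  have hm_split : m ^ (2 / aExp α) = m ^ (2 / aExp α - 2) * m ^ 2 := by
    rw [← Real.rpow_two m, ← Real.rpow_add hm, sub_add_cancel]
  calc _ = a (Fin.last N) x ^ 2 / m ^ (2 / aExp α)
          * (g α a x s ^ (2 / aExp α - 2) * g α a x s) := by
        rw [hexp, Real.rpow_add hg, Real.rpow_one]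
    _ ≤ a (Fin.last N) x ^ 2 / m ^ (2 / aExp α) *
          ((m * s ^ α (Fin.last N)) ^ (2 / aExp α - 2) * g α a x s) := by gcongr
    _ = a (Fin.last N) x ^ 2 / m ^ 2 * (s ^ 2 * g α a x s) := by
        rw [Real.mul_rpow hm.le (Real.rpow_nonneg hs _), ← Real.rpow_mul hs, hexp_last, hm_split,
          Real.rpow_two]
        field_simp
    _ ≤ s ^ 2 * g α a x s := by
        refine mul_le_of_le_one_left (by positivity) ?_
        rw [div_le_one (by positivity)]
        gcongr

theorem W1_rpow_mul_g_rpow_le (hα : AdmissibleExp α) (ha : AdmissibleAt a x) {s : ℝ}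
    (hs : 0 ≤ s) :
    W1 α a x ^ (2 / aExp α) * g α a x s ^ ((2 - aExp α) / aExp α)
      ≤ s ^ 2 * g α a x s + a (Fin.last N) x := by
  rcases le_total s 1 with hs1 | hs1
  · exact (W1_rpow_mul_g_rpow_le_of_le_one hα ha hs hs1).trans
      (le_add_of_nonneg_left (mul_nonneg (sq_nonneg s) (g_nonneg ha hs)))
  · exact (W1_rpow_mul_g_rpow_le_of_one_le hα ha hs1).trans (le_add_of_nonneg_right ha.last_pos.le)

theorem W1_mul_rpow_le (hα : AdmissibleExp α) (ha : AdmissibleAt a x) {s r : ℝ} (hs : 0 ≤ s)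
    (hr : 0 ≤ r) :
    W1 α a x * r ^ (2 - aExp α) ≤ (r ^ 2 / g α a x s) ^ ((2 - aExp α) / 2)
      * (s ^ 2 * g α a x s + a (Fin.last N) x) ^ (aExp α / 2) := by
  have hb := hα.aExp_pos
  have hg := g_pos hα ha hs
  have hW := W1_nonneg (α := α) ha
  have hweight : W1 α a x * g α a x s ^ ((2 - aExp α) / 2)
      ≤ (s ^ 2 * g α a x s + a (Fin.last N) x) ^ (aExp α / 2) := by
    have hroot := Real.rpow_le_rpow (by positivity) (W1_rpow_mul_g_rpow_le hα ha hs)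
      (by positivity : 0 ≤ aExp α / 2)
    rwa [Real.mul_rpow (by positivity) (by positivity), ← Real.rpow_mul hW, ← Real.rpow_mul hg.le,
      show 2 / aExp α * (aExp α / 2) = 1 by field_simp,
      show (2 - aExp α) / aExp α * (aExp α / 2) = (2 - aExp α) / 2 by field_simp,
      Real.rpow_one] at hroot
  calc W1 α a x * r ^ (2 - aExp α)
      = r ^ (2 - aExp α) / g α a x s ^ ((2 - aExp α) / 2)
        * (W1 α a x * g α a x s ^ ((2 - aExp α) / 2)) := by field_simp
    _ = (r ^ 2 / g α a x s) ^ ((2 - aExp α) / 2)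
        * (W1 α a x * g α a x s ^ ((2 - aExp α) / 2)) := by
      rw [Real.div_rpow (sq_nonneg r) hg.le, ← Real.rpow_natCast_mul hr, Nat.cast_ofNat,
        mul_div_cancel₀ _ (two_ne_zero' ℝ)]
    _ ≤ _ := by gcongr

theorem max_sq_mul_g_le (ha : AdmissibleAt a x) {s t : ℝ} (hs : 0 ≤ s) (ht : 0 ≤ t) :
    max s t ^ 2 * g α a x (max s t) ≤ s ^ 2 * g α a x s + t ^ 2 * g α a x t := by
  rcases le_total s t with hst | hst
  · rw [max_eq_right hst]
    exact le_add_of_nonneg_left (mul_nonneg (sq_nonneg s) (g_nonneg ha hs))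
  · rw [max_eq_left hst]
    exact le_add_of_nonneg_right (mul_nonneg (sq_nonneg t) (g_nonneg ha ht))

end Pointwise

namespace RegFun

variable {n : ℕ} {U : Set (E n)} {φ a₀ : E n → ℝ} (R : RegFun U φ a₀)

/-- `u(t)` as an element of `L²_φ`. -/
def valL : ℝ → Lp ℝ 2 (wMeasure U φ) := R.val_curve.choose

/-- `u_t(t)` as an element of `L²_φ`, chosen so that it is differentiable in `t`. -/
def dtL : ℝ → Lp ℝ 2 (wMeasure U φ) := R.dt_curve.choose

/-- `u_tt(t)` as an element of `L²_φ`. -/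
def dttL : ℝ → Lp ℝ 2 (wMeasure U φ) := R.dt_curve.choose_spec.choose

/-- `∇u(t)` as an element of `L²_{1/a₀}`. -/
def gradL : ℝ → Lp (E n) 2 (wMeasure U fun x => (a₀ x)⁻¹) := R.grad_curve.choose

/-- `∇u_t(t)` as an element of `L²_{1/a₀}`. -/
def gradDtL : ℝ → Lp (E n) 2 (wMeasure U fun x => (a₀ x)⁻¹) := R.grad_curve.choose_spec.choose

theorem valL_ae {t : ℝ} (ht : 0 < t) : R.valL t =ᵐ[wMeasure U φ] R.val t :=
  R.val_curve.choose_spec.choose_spec.1 t ht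

theorem dtL_ae {t : ℝ} (ht : 0 < t) : R.dtL t =ᵐ[wMeasure U φ] R.dt t :=
  R.dt_curve.choose_spec.choose_spec.1 t ht

theorem dttL_ae {t : ℝ} (ht : 0 < t) : R.dttL t =ᵐ[wMeasure U φ] R.dtt t :=
  R.dt_curve.choose_spec.choose_spec.2.1 t ht

theorem gradL_ae {t : ℝ} (ht : 0 < t) :
    R.gradL t =ᵐ[wMeasure U fun x => (a₀ x)⁻¹] R.grad t :=
  R.grad_curve.choose_spec.choose_spec.1 t ht

theorem gradDtL_ae {t : ℝ} (ht : 0 < t) :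
    R.gradDtL t =ᵐ[wMeasure U fun x => (a₀ x)⁻¹] R.gradDt t :=
  R.grad_curve.choose_spec.choose_spec.2.1 t ht

theorem hasDerivAt_valL {t : ℝ} (ht : 0 < t) : HasDerivAt R.valL (R.dtL t) t := by
  have hderiv := R.val_curve.choose_spec.choose_spec.2.2.1 t ht
  rwa [Lp.ext ((R.val_curve.choose_spec.choose_spec.2.1 t ht).trans (R.dtL_ae ht).symm)] at hderiv

theorem hasDerivAt_dtL {t : ℝ} (ht : 0 < t) : HasDerivAt R.dtL (R.dttL t) t :=
  R.dt_curve.choose_spec.choose_spec.2.2.1 t ht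

theorem hasDerivAt_gradL {t : ℝ} (ht : 0 < t) : HasDerivAt R.gradL (R.gradDtL t) t :=
  R.grad_curve.choose_spec.choose_spec.2.2.1 t ht

theorem continuousOn_dttL : ContinuousOn R.dttL (Ioi 0) :=
  R.dt_curve.choose_spec.choose_spec.2.2.2

theorem continuousOn_gradDtL : ContinuousOn R.gradDtL (Ioi 0) :=
  R.grad_curve.choose_spec.choose_spec.2.2.2

end RegFun

section SolutionFlow

variable {n N : ℕ} {U : Set (E n)} {φ : E n → ℝ} {α : Fin (N + 1) → ℝ}
  {a : Fin (N + 1) → E n → ℝ}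

namespace IsMedium

theorem inv_meas (hm : IsMedium U φ a) :
    AEMeasurable (fun x => (a 0 x)⁻¹) (volume.restrict U) := (hm.coeff_meas 0).inv

theorem inv_nonneg (hm : IsMedium U φ a) : ∀ x ∈ U, 0 ≤ (a 0 x)⁻¹ := fun x hx =>
  _root_.inv_nonneg.2 (hm.coeff_nonneg 0 x hx)

theorem porosity_nonneg (hm : IsMedium U φ a) : ∀ x ∈ U, 0 ≤ φ x := fun x hx =>
  (hm.porosity_pos x hx).le

end IsMedium

/-- The pairs `(ζ, ∇ζ)` with `ζ ∈ C_c^∞(U)`, as elements of `L²_φ × L²_{1/a₀}`. -/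
def testPairs (U : Set (E n)) (φ a₀ : E n → ℝ) :
    Set (Lp ℝ 2 (wMeasure U φ) × Lp (E n) 2 (wMeasure U fun x => (a₀ x)⁻¹)) :=
  {c | ∃ ζ, IsTest U ζ ∧ c.1 =ᵐ[wMeasure U φ] ζ ∧
    c.2 =ᵐ[wMeasure U fun x => (a₀ x)⁻¹] gradient ζ}

theorem IsTest.continuous_gradient {ζ : E n → ℝ} (hζ : IsTest U ζ) : Continuous (gradient ζ) :=
  (InnerProductSpace.toDual ℝ (E n)).symm.continuous.comp
    (hζ.smooth.continuous_fderiv (by simp))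

theorem VanishesOnBdry.mem_closure_testPairs (hU : MeasurableSet U) (hm : IsMedium U φ a)
    {u : E n → ℝ} {v : E n → E n} (h : VanishesOnBdry U φ (a 0) u v)
    {c : Lp ℝ 2 (wMeasure U φ)} {d : Lp (E n) 2 (wMeasure U fun x => (a 0 x)⁻¹)}
    (hc : c =ᵐ[wMeasure U φ] u) (hd : d =ᵐ[wMeasure U fun x => (a 0 x)⁻¹] v) :
    (c, d) ∈ closure (testPairs U φ (a 0)) := by
  refine EMetric.mem_closure_iff.2 fun ε hε => ?_
  obtain ⟨ζ, hζ, hlt⟩ := h ε hε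
  rw [wNorm_two_eq_eLpNorm hU hm.porosity_meas hm.porosity_nonneg,
    wNorm_two_eq_eLpNorm hU hm.inv_meas hm.inv_nonneg] at hlt
  have hltval := le_self_add.trans_lt hlt
  have hltgrad := le_add_self.trans_lt hlt
  have hval : MemLp (fun x => u x - ζ x) 2 (wMeasure U φ) :=
    ⟨((Lp.aestronglyMeasurable c).congr hc).sub hζ.smooth.continuous.aestronglyMeasurable,
      hltval.trans_le le_top⟩
  have hgrad : MemLp (fun x => v x - gradient ζ x) 2 (wMeasure U fun x => (a 0 x)⁻¹) :=
    ⟨((Lp.aestronglyMeasurable d).congr hd).sub hζ.continuous_gradient.aestronglyMeasurable,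
      hltgrad.trans_le le_top⟩
  refine ⟨(c - hval.toLp, d - hgrad.toLp), ⟨ζ, hζ, ?_, ?_⟩, ?_⟩
  · filter_upwards [coeFn_sub_ae hc hval.coeFn_toLp] with x hx
    rw [hx, sub_sub_cancel]
  · filter_upwards [coeFn_sub_ae hd hgrad.coeFn_toLp] with x hx
    rw [hx, sub_sub_cancel]
  · rw [Prod.edist_eq, edist_eq_enorm_sub, edist_eq_enorm_sub, sub_sub_cancel, sub_sub_cancel,
      Lp.enorm_toLp, Lp.enorm_toLp]
    exact max_lt hltval hltgrad

variable {p Ψ q Θ : RegFun U φ (a 0)} {p₀ q₀ : E n → ℝ}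

/-- The flux `K(x,|∇p|)∇p` at time `t`. -/
def fluxAt (α : Fin (N + 1) → ℝ) (p : RegFun U φ (a 0)) (t : ℝ) (x : E n) : E n :=
  flux α a x (p.grad t x)

theorem IsSolution.aestronglyMeasurable_flux (hp : IsSolution α p Ψ p₀) {t : ℝ} (ht : 0 < t) :
    AEStronglyMeasurable (fluxAt α p t) (volume.restrict U) :=
  (hp.flux_locInt t ht).aestronglyMeasurable

theorem IsSolution.memLp_flux (hU : MeasurableSet U) (hm : IsMedium U φ a)
    (hα : AdmissibleExp α) (hp : IsSolution α p Ψ p₀) {t : ℝ} (ht : 0 < t) :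
    MemLp (fun x => a 0 x • fluxAt α p t x) 2 (wMeasure U fun x => (a 0 x)⁻¹) := by
  have hgrad : MemLp (p.grad t) 2 (wMeasure U fun x => (a 0 x)⁻¹) :=
    (memLp_congr_ae (p.gradL_ae ht)).1 (Lp.memLp _)
  refine hgrad.of_le (AEStronglyMeasurable.mono_ac wMeasure_absolutelyContinuous
    ((hm.coeff_meas 0).aestronglyMeasurable.smul (hp.aestronglyMeasurable_flux ht)))
    (ae_wMeasure_of_forall_mem hU fun x hx => ?_)
  exact norm_coeff_zero_smul_flux_le hα (hm.admissibleAt hx) _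

open Classical in
/-- `a₀ K(x,|∇p|)∇p` as an element of `L²_{1/a₀}`. The factor `a₀` makes pairing with it in
`L²_{1/a₀}` the same as pairing with the flux in the unweighted `L²`. -/
def fluxL (α : Fin (N + 1) → ℝ) (p : RegFun U φ (a 0)) (t : ℝ) :
    Lp (E n) 2 (wMeasure U fun x => (a 0 x)⁻¹) :=
  if h : MemLp (fun x => a 0 x • fluxAt α p t x) 2 (wMeasure U fun x => (a 0 x)⁻¹) then h.toLp _
  else 0

theorem IsSolution.fluxL_ae (hU : MeasurableSet U) (hm : IsMedium U φ a)
    (hα : AdmissibleExp α) (hp : IsSolution α p Ψ p₀) {t : ℝ} (ht : 0 < t) :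
    fluxL α p t =ᵐ[wMeasure U fun x => (a 0 x)⁻¹] fun x => a 0 x • fluxAt α p t x := by
  rw [fluxL, dif_pos (hp.memLp_flux hU hm hα ht)]
  exact MemLp.coeFn_toLp _

theorem IsSolution.inner_dtL_eq_of_mem_testPairs (hU : MeasurableSet U) (hm : IsMedium U φ a)
    (hα : AdmissibleExp α) (hp : IsSolution α p Ψ p₀) {t : ℝ} (ht : 0 < t)
    {c : Lp ℝ 2 (wMeasure U φ) × Lp (E n) 2 (wMeasure U fun x => (a 0 x)⁻¹)}
    (hc : c ∈ testPairs U φ (a 0)) :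
    inner ℝ (p.dtL t) c.1 = -inner ℝ (fluxL α p t) c.2 := by
  obtain ⟨ζ, hζ, hval, hgrad⟩ := hc
  have hleft : inner ℝ (p.dtL t) c.1 = ∫ x in U, φ x * p.dt t x * ζ x := by
    rw [inner_eq_integral_of_ae (p.dtL_ae ht) hval,
      integral_wMeasure hU hm.porosity_meas hm.porosity_nonneg]
    refine integral_congr_ae (ae_of_all _ fun x => ?_)
    simp only [RCLike.inner_apply, conj_trivial]
    ring
  have hright : inner ℝ (fluxL α p t) c.2
      = ∫ x in U, K α a x ‖p.grad t x‖ * inner ℝ (p.grad t x) (gradient ζ x) := by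
    rw [inner_eq_integral_of_ae (hp.fluxL_ae hU hm hα ht) hgrad,
      integral_wMeasure hU hm.inv_meas hm.inv_nonneg]
    refine integral_congr_ae ?_
    filter_upwards [ae_restrict_mem hU] with x hx
    rw [real_inner_smul_left, inv_mul_cancel_left₀ (hm.coeff_zero_pos x hx).ne', fluxAt, flux,
      real_inner_smul_left]
  rw [hleft, hright, hp.pde t ht ζ hζ]

theorem IsSolution.inner_dtL_eq (hU : MeasurableSet U) (hm : IsMedium U φ a)
    (hα : AdmissibleExp α) (hp : IsSolution α p Ψ p₀) (hq : IsSolution α q Θ q₀) {s t : ℝ}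
    (hs : 0 < s) (ht : 0 < t) :
    inner ℝ (p.dtL s) (q.valL t - Θ.valL t)
      = -inner ℝ (fluxL α p s) (q.gradL t - Θ.gradL t) := by
  have hmem := (hq.bdry t ht).mem_closure_testPairs hU hm
    (coeFn_sub_ae (q.valL_ae ht) (Θ.valL_ae ht)) (coeFn_sub_ae (q.gradL_ae ht) (Θ.gradL_ae ht))
  have hclosed : IsClosed {c : Lp ℝ 2 (wMeasure U φ) × Lp (E n) 2 (wMeasure U fun x => (a 0 x)⁻¹) |
      inner ℝ (p.dtL s) c.1 = -inner ℝ (fluxL α p s) c.2} :=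
    isClosed_eq (by fun_prop) (by fun_prop)
  exact closure_minimal (fun _ => hp.inner_dtL_eq_of_mem_testPairs hU hm hα hs) hclosed hmem

theorem IsSolution.fluxL_sub_ae (hU : MeasurableSet U) (hm : IsMedium U φ a)
    (hα : AdmissibleExp α) (hp : IsSolution α p Ψ p₀) (hq : IsSolution α q Θ q₀) {s t : ℝ}
    (hs : 0 < s) (ht : 0 < t) :
    ↑↑(fluxL α p s - fluxL α q t) =ᵐ[wMeasure U fun x => (a 0 x)⁻¹]
      fun x => a 0 x • (fluxAt α p s x - fluxAt α q t x) := by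
  filter_upwards [coeFn_sub_ae (hp.fluxL_ae hU hm hα hs) (hq.fluxL_ae hU hm hα ht)] with x hx
  rw [hx, smul_sub]

theorem IsSolution.norm_fluxL_sub_sq_le (hU : MeasurableSet U) (hm : IsMedium U φ a)
    (hα : AdmissibleExp α) (hp : IsSolution α p Ψ p₀) (hq : IsSolution α q Θ q₀) {s t : ℝ}
    (hs : 0 < s) (ht : 0 < t) :
    ‖fluxL α p s - fluxL α q t‖ ^ 2
      ≤ inner ℝ (fluxL α p s - fluxL α q t) (p.gradL s - q.gradL t) := by
  have hflux := hp.fluxL_sub_ae hU hm hα hq hs ht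
  rw [← real_inner_self_eq_norm_sq]
  refine inner_le_inner_of_ae hU hflux hflux hflux
    (coeFn_sub_ae (p.gradL_ae hs) (q.gradL_ae ht)) fun x hx => ?_
  have ha := hm.admissibleAt hx
  simp only [fluxAt]
  rw [real_inner_smul_left, real_inner_smul_left, real_inner_smul_right,
    real_inner_self_eq_norm_sq]
  exact mul_le_mul_of_nonneg_left (flux_cocoercive hα ha _ _) ha.zero_pos.le

theorem IsSolution.norm_fluxL_sq_le (hU : MeasurableSet U) (hm : IsMedium U φ a)
    (hα : AdmissibleExp α) (hp : IsSolution α p Ψ p₀) {t : ℝ} (ht : 0 < t) :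
    ‖fluxL α p t‖ ^ 2 ≤ inner ℝ (fluxL α p t) (p.gradL t) := by
  have hflux := hp.fluxL_ae hU hm hα ht
  rw [← real_inner_self_eq_norm_sq]
  refine inner_le_inner_of_ae hU hflux hflux hflux (p.gradL_ae ht) fun x hx => ?_
  have ha := hm.admissibleAt hx
  simp only [fluxAt]
  rw [real_inner_smul_left, real_inner_smul_left, real_inner_smul_right,
    real_inner_self_eq_norm_sq]
  exact mul_le_mul_of_nonneg_left (coeff_zero_mul_norm_flux_sq_le_inner hα ha _) ha.zero_pos.le

theorem aemeasurable_potential (hm : IsMedium U φ a) {s : E n → ℝ}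
    (hs : AEMeasurable s (volume.restrict U)) :
    AEMeasurable (fun x => potential α a x (s x)) (volume.restrict U) := by
  unfold potential
  exact Finset.aemeasurable_fun_sum _ fun j _ =>
    (hm.coeff_meas j).mul ((hs.pow_const _).const_mul _)

/-- The density of the potential energy with respect to the measure `dx / a₀`. -/
def potentialDensity (α : Fin (N + 1) → ℝ) (p : RegFun U φ (a 0)) (t : ℝ) (x : E n) : ℝ :=
  a 0 x * potential α a x ‖fluxAt α p t x‖

/-- The potential energy `1/2 ∫_U ∫₀^{|∇p|²} K(x,√r) dr dx` at time `t`. -/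
def potentialEnergy (α : Fin (N + 1) → ℝ) (p : RegFun U φ (a 0)) (t : ℝ) : ℝ :=
  ∫ x, potentialDensity α p t x ∂wMeasure U fun x => (a 0 x)⁻¹

theorem potentialDensity_nonneg (hm : IsMedium U φ a) (hα : AdmissibleExp α) {t : ℝ} {x : E n}
    (hx : x ∈ U) : 0 ≤ potentialDensity α p t x :=
  mul_nonneg (hm.coeff_nonneg 0 x hx) (potential_nonneg hα (hm.admissibleAt hx) (norm_nonneg _))

theorem potentialDensity_le_inner (hm : IsMedium U φ a) (hα : AdmissibleExp α) {t : ℝ} {x : E n}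
    (hx : x ∈ U) :
    potentialDensity α p t x ≤ inner ℝ (a 0 x • fluxAt α p t x) (p.grad t x) := by
  have ha := hm.admissibleAt hx
  rw [real_inner_smul_left, potentialDensity, fluxAt, inner_flux_self hα ha]
  exact mul_le_mul_of_nonneg_left (potential_le_sq_mul_g hα ha (norm_nonneg _)) ha.zero_pos.le

theorem inner_le_two_mul_potentialDensity (hm : IsMedium U φ a) (hα : AdmissibleExp α) {t : ℝ}
    {x : E n} (hx : x ∈ U) :
    inner ℝ (a 0 x • fluxAt α p t x) (p.grad t x) ≤ 2 * potentialDensity α p t x := by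
  have ha := hm.admissibleAt hx
  rw [real_inner_smul_left, potentialDensity, fluxAt, inner_flux_self hα ha, mul_left_comm 2]
  exact mul_le_mul_of_nonneg_left (sq_mul_g_le_two_mul_potential hα ha (norm_nonneg _))
    ha.zero_pos.le

theorem inner_sub_le_potentialDensity_sub (hm : IsMedium U φ a) (hα : AdmissibleExp α) {s t : ℝ}
    {x : E n} (hx : x ∈ U) :
    inner ℝ (a 0 x • fluxAt α p t x) (p.grad s x - p.grad t x)
      ≤ potentialDensity α p s x - potentialDensity α p t x := by
  have ha := hm.admissibleAt hx
  rw [real_inner_smul_left, potentialDensity, potentialDensity, ← mul_sub]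
  exact mul_le_mul_of_nonneg_left (inner_flux_sub_le_potential_sub hα ha _ _) ha.zero_pos.le

theorem IsSolution.integrable_potentialDensity (hU : MeasurableSet U) (hm : IsMedium U φ a)
    (hα : AdmissibleExp α) (hp : IsSolution α p Ψ p₀) {t : ℝ} (ht : 0 < t) :
    Integrable (potentialDensity α p t) (wMeasure U fun x => (a 0 x)⁻¹) := by
  refine (integrable_inner_of_ae (hp.fluxL_ae hU hm hα ht) (p.gradL_ae ht)).mono' ?_ ?_
  · exact (((hm.coeff_meas 0).mul (aemeasurable_potential hm
      (hp.aestronglyMeasurable_flux ht).norm.aemeasurable)).mono_ac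
        wMeasure_absolutelyContinuous).aestronglyMeasurable
  · refine ae_wMeasure_of_forall_mem hU fun x hx => ?_
    rw [Real.norm_of_nonneg (potentialDensity_nonneg hm hα hx)]
    exact potentialDensity_le_inner hm hα hx

theorem IsSolution.potentialEnergy_le_inner_fluxL (hU : MeasurableSet U) (hm : IsMedium U φ a)
    (hα : AdmissibleExp α) (hp : IsSolution α p Ψ p₀) {t : ℝ} (ht : 0 < t) :
    potentialEnergy α p t ≤ inner ℝ (fluxL α p t) (p.gradL t) := by
  have hflux := hp.fluxL_ae hU hm hα ht
  rw [inner_eq_integral_of_ae hflux (p.gradL_ae ht)]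
  exact integral_mono_ae (hp.integrable_potentialDensity hU hm hα ht)
    (integrable_inner_of_ae hflux (p.gradL_ae ht))
    (ae_wMeasure_of_forall_mem hU fun x hx => potentialDensity_le_inner hm hα hx)

theorem IsSolution.inner_fluxL_le_two_mul_potentialEnergy (hU : MeasurableSet U)
    (hm : IsMedium U φ a) (hα : AdmissibleExp α) (hp : IsSolution α p Ψ p₀) {t : ℝ} (ht : 0 < t) :
    inner ℝ (fluxL α p t) (p.gradL t) ≤ 2 * potentialEnergy α p t := by
  have hflux := hp.fluxL_ae hU hm hα ht
  rw [inner_eq_integral_of_ae hflux (p.gradL_ae ht), potentialEnergy, ← integral_const_mul]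
  exact integral_mono_ae (integrable_inner_of_ae hflux (p.gradL_ae ht))
    ((hp.integrable_potentialDensity hU hm hα ht).const_mul 2)
    (ae_wMeasure_of_forall_mem hU fun x hx => inner_le_two_mul_potentialDensity hm hα hx)

theorem IsSolution.inner_fluxL_sub_le_potentialEnergy_sub (hU : MeasurableSet U)
    (hm : IsMedium U φ a) (hα : AdmissibleExp α) (hp : IsSolution α p Ψ p₀) {s t : ℝ}
    (hs : 0 < s) (ht : 0 < t) :
    inner ℝ (fluxL α p t) (p.gradL s - p.gradL t)
      ≤ potentialEnergy α p s - potentialEnergy α p t := by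
  have hflux := hp.fluxL_ae hU hm hα ht
  have hgrad := coeFn_sub_ae (p.gradL_ae hs) (p.gradL_ae ht)
  have hints := hp.integrable_potentialDensity hU hm hα hs
  have hintt := hp.integrable_potentialDensity hU hm hα ht
  rw [inner_eq_integral_of_ae hflux hgrad, potentialEnergy, potentialEnergy,
    ← integral_sub hints hintt]
  exact integral_mono_ae (integrable_inner_of_ae hflux hgrad) (hints.sub hintt)
    (ae_wMeasure_of_forall_mem hU fun x hx => inner_sub_le_potentialDensity_sub hm hα hx)

/-- The abstract flow in `L²_φ` and `L²_{1/a₀}` followed by a solution. -/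
def IsSolution.toFlow (hU : MeasurableSet U) (hm : IsMedium U φ a)
    (hα : AdmissibleExp α) (hp : IsSolution α p Ψ p₀) :
    Flow (Lp ℝ 2 (wMeasure U φ)) (Lp (E n) 2 (wMeasure U fun x => (a 0 x)⁻¹)) where
  u := p.valL
  u' := p.dtL
  u'' := p.dttL
  ψ := Ψ.valL
  ψ' := Ψ.dtL
  ψ'' := Ψ.dttL
  y := p.gradL
  y' := p.gradDtL
  η := Ψ.gradL
  η' := Ψ.gradDtL
  f := fluxL α p
  j := potentialEnergy α p
  hasDerivAt_u _ ht := p.hasDerivAt_valL ht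
  hasDerivAt_u' _ ht := p.hasDerivAt_dtL ht
  hasDerivAt_ψ _ ht := Ψ.hasDerivAt_valL ht
  hasDerivAt_ψ' _ ht := Ψ.hasDerivAt_dtL ht
  hasDerivAt_y _ ht := p.hasDerivAt_gradL ht
  hasDerivAt_η _ ht := Ψ.hasDerivAt_gradL ht
  continuousOn_ψ'' := Ψ.continuousOn_dttL
  continuousOn_η' := Ψ.continuousOn_gradDtL
  cocoercive _ hs _ ht := hp.norm_fluxL_sub_sq_le hU hm hα hp hs ht
  norm_f_sq_le _ ht := hp.norm_fluxL_sq_le hU hm hα ht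
  le_j_sub _ hs _ ht := hp.inner_fluxL_sub_le_potentialEnergy_sub hU hm hα hs ht
  j_le _ ht := hp.potentialEnergy_le_inner_fluxL hU hm hα ht
  le_two_j _ ht := hp.inner_fluxL_le_two_mul_potentialEnergy hU hm hα ht
  weak _ hs _ ht := hp.inner_dtL_eq hU hm hα hp hs ht

end SolutionFlow

section Gradients

variable {n N : ℕ} {U : Set (E n)} {φ : E n → ℝ} {α : Fin (N + 1) → ℝ}
  {a : Fin (N + 1) → E n → ℝ}

theorem IsMedium.W1_nonneg (hm : IsMedium U φ a) : ∀ x ∈ U, 0 ≤ W1 α a x := fun _ hx =>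
  Forchheimer.W1_nonneg (hm.admissibleAt hx)

theorem aemeasurable_maxCoeff (hm : IsMedium U φ a) :
    AEMeasurable (maxCoeff a) (volume.restrict U) := by
  have hsup : maxCoeff a = Finset.univ.sup' Finset.univ_nonempty a := by
    ext x
    rw [maxCoeff, Finset.sup'_apply]
  rw [hsup]
  exact Finset.sup'_induction (p := fun f => AEMeasurable f (volume.restrict U)) _ _
    (fun _ h₁ _ h₂ => AEMeasurable.sup h₁ h₂) fun j _ => hm.coeff_meas j

theorem aemeasurable_W1 (hm : IsMedium U φ a) : AEMeasurable (W1 α a) (volume.restrict U) :=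
  ((hm.coeff_meas _).pow_const _).div ((aemeasurable_maxCoeff hm).const_mul _)

theorem aemeasurable_g (hm : IsMedium U φ a) {s : E n → ℝ}
    (hs : AEMeasurable s (volume.restrict U)) :
    AEMeasurable (fun x => g α a x (s x)) (volume.restrict U) := by
  unfold g
  exact Finset.aemeasurable_fun_sum _ fun j _ => (hm.coeff_meas j).mul (hs.pow_const _)

theorem lintegral_W1_mul_rpow_le (hU : MeasurableSet U) (hm : IsMedium U φ a)
    (hα : AdmissibleExp α) {z : E n → E n} {s : E n → ℝ}
    (hz : AEStronglyMeasurable z (volume.restrict U)) (hs : AEMeasurable s (volume.restrict U))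
    (hs0 : ∀ x, 0 ≤ s x) :
    ∫⁻ x in U, ENNReal.ofReal (W1 α a x * ‖z x‖ ^ (2 - aExp α))
      ≤ (∫⁻ x in U, ENNReal.ofReal (‖z x‖ ^ 2 / g α a x (s x))) ^ ((2 - aExp α) / 2)
        * (∫⁻ x in U, ENNReal.ofReal (s x ^ 2 * g α a x (s x) + a (Fin.last N) x))
          ^ (aExp α / 2) := by
  have hb := hα.aExp_pos
  have hb1 := hα.aExp_lt_one
  have hg := aemeasurable_g (α := α) hm hs
  refine le_trans (setLIntegral_mono_ae' hU (ae_of_all _ fun x hx => ?_))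
    (ENNReal.lintegral_mul_norm_pow_le
      ((hz.norm.aemeasurable.pow_const 2).div hg).ennreal_ofReal
      (((hs.pow_const 2).mul hg).add (hm.coeff_meas _)).ennreal_ofReal
      (by linarith) (by linarith) (by ring))
  have ha := hm.admissibleAt hx
  have hgx := g_pos hα ha (hs0 x)
  have hlast := ha.last_pos
  simp only [Pi.div_apply, Pi.mul_apply, Pi.add_apply]
  rw [ENNReal.ofReal_rpow_of_nonneg (by positivity) (by linarith),
    ENNReal.ofReal_rpow_of_nonneg (by positivity) (by linarith),
    ← ENNReal.ofReal_mul (by positivity)]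
  exact ENNReal.ofReal_le_ofReal (W1_mul_rpow_le hα ha (hs0 x) (norm_nonneg _))

theorem wNorm_W1_sq_le (hU : MeasurableSet U) (hm : IsMedium U φ a) (hα : AdmissibleExp α)
    {z : E n → E n} {s : E n → ℝ} (hz : AEStronglyMeasurable z (volume.restrict U))
    (hs : AEMeasurable s (volume.restrict U)) (hs0 : ∀ x, 0 ≤ s x) :
    wNorm U (W1 α a) (2 - aExp α) z ^ 2
      ≤ (∫⁻ x in U, ENNReal.ofReal (‖z x‖ ^ 2 / g α a x (s x)))
        * (∫⁻ x in U, ENNReal.ofReal (s x ^ 2 * g α a x (s x) + a (Fin.last N) x))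
          ^ (aExp α / (2 - aExp α)) := by
  have hb2 : 0 < 2 - aExp α := by linarith [hα.aExp_lt_one]
  set I := ∫⁻ x in U, ENNReal.ofReal (‖z x‖ ^ 2 / g α a x (s x))
  set L := ∫⁻ x in U, ENNReal.ofReal (s x ^ 2 * g α a x (s x) + a (Fin.last N) x)
  calc wNorm U (W1 α a) (2 - aExp α) z ^ 2
      = (∫⁻ x in U, ENNReal.ofReal (W1 α a x * ‖z x‖ ^ (2 - aExp α))) ^ (2 / (2 - aExp α)) := by
        rw [wNorm, ← ENNReal.rpow_natCast, ← ENNReal.rpow_mul, Nat.cast_ofNat, one_div_mul_eq_div]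
    _ ≤ (I ^ ((2 - aExp α) / 2) * L ^ (aExp α / 2)) ^ (2 / (2 - aExp α)) :=
        ENNReal.rpow_le_rpow (lintegral_W1_mul_rpow_le hU hm hα hz hs hs0) (by positivity)
    _ = I * L ^ (aExp α / (2 - aExp α)) := by
        rw [ENNReal.mul_rpow_of_nonneg _ _ (by positivity), ← ENNReal.rpow_mul,
          ← ENNReal.rpow_mul, show (2 - aExp α) / 2 * (2 / (2 - aExp α)) = 1 by field_simp,
          show aExp α / 2 * (2 / (2 - aExp α)) = aExp α / (2 - aExp α) by field_simp,
          ENNReal.rpow_one]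

theorem wNorm_W1_sub_le (hU : MeasurableSet U) (hm : IsMedium U φ a) (hα : AdmissibleExp α)
    {z₁ z₂ : E n → E n} (hz₁ : AEStronglyMeasurable z₁ (volume.restrict U))
    (hz₂ : AEStronglyMeasurable z₂ (volume.restrict U)) :
    wNorm U (W1 α a) (2 - aExp α) (fun x => z₁ x - z₂ x)
      ≤ wNorm U (W1 α a) (2 - aExp α) z₁ + wNorm U (W1 α a) (2 - aExp α) z₂ := by
  have hb1 := hα.aExp_lt_one
  simp_rw [wNorm_eq_eLpNorm hU (aemeasurable_W1 hm) hm.W1_nonneg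
    (by linarith : 0 < 2 - aExp α)]
  refine eLpNorm_sub_le (hz₁.mono_ac wMeasure_absolutelyContinuous)
    (hz₂.mono_ac wMeasure_absolutelyContinuous) ?_
  rw [← ENNReal.ofReal_one]
  exact ENNReal.ofReal_le_ofReal (by linarith)

theorem RegFun.aestronglyMeasurable_grad {a₀ : E n → ℝ} (R : RegFun U φ a₀) {t : ℝ}
    (ht : 0 < t) : AEStronglyMeasurable (R.grad t) (volume.restrict U) :=
  (R.grad_spec t ht).locInt_grad.aestronglyMeasurable

namespace IsMedium

theorem integral_last_nonneg (hU : MeasurableSet U) (hm : IsMedium U φ a) :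
    0 ≤ ∫ x in U, a (Fin.last N) x :=
  setIntegral_nonneg hU fun x hx => (hm.coeff_last_pos x hx).le

theorem lintegral_last (hU : MeasurableSet U) (hm : IsMedium U φ a) :
    ∫⁻ x in U, ENNReal.ofReal (a (Fin.last N) x) = ENNReal.ofReal (∫ x in U, a (Fin.last N) x) :=
  (ofReal_integral_eq_lintegral_ofReal hm.coeff_last_int
    ((ae_restrict_mem hU).mono fun x hx => (hm.coeff_last_pos x hx).le)).symm

end IsMedium

theorem wNorm_W1_sq_le_of_ae (hU : MeasurableSet U) (hm : IsMedium U φ a) (hα : AdmissibleExp α)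
    {z : E n → E n} {c : Lp (E n) 2 (wMeasure U fun x => (a 0 x)⁻¹)}
    (hz : AEStronglyMeasurable z (volume.restrict U))
    (hc : c =ᵐ[wMeasure U fun x => (a 0 x)⁻¹] z) :
    wNorm U (W1 α a) (2 - aExp α) z ^ 2
      ≤ ENNReal.ofReal (‖c‖ ^ 2 * (∫ x in U, a (Fin.last N) x) ^ (aExp α / (2 - aExp α))) := by
  have hb := hα.aExp_pos
  have hb1 := hα.aExp_lt_one
  have hnorm : ∫⁻ x in U, ENNReal.ofReal (‖z x‖ ^ 2 / g α a x 0) = ENNReal.ofReal (‖c‖ ^ 2) := by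
    rw [ENNReal.ofReal_pow (norm_nonneg _), ← wNorm_two_eq_norm hU hm.inv_meas hm.inv_nonneg hc,
      wNorm, ← ENNReal.rpow_natCast, ← ENNReal.rpow_mul, Nat.cast_ofNat, one_div_mul_cancel
      two_ne_zero, ENNReal.rpow_one]
    refine lintegral_congr fun x => ?_
    rw [g_zero hα, div_eq_inv_mul, Real.rpow_two]
  refine (wNorm_W1_sq_le hU hm hα hz (s := fun _ => 0) aemeasurable_const fun _ => le_rfl).trans
    (le_of_eq ?_)
  rw [hnorm]
  simp only [zero_pow two_ne_zero, zero_mul, zero_add]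
  rw [hm.lintegral_last hU, ENNReal.ofReal_rpow_of_nonneg (hm.integral_last_nonneg hU)
    (div_nonneg hb.le (by linarith)), ← ENNReal.ofReal_mul (sq_nonneg _)]

theorem lintegral_inner_eq_ofReal_inner (hU : MeasurableSet U) (hm : IsMedium U φ a)
    {f y : E n → E n} {c d : Lp (E n) 2 (wMeasure U fun x => (a 0 x)⁻¹)}
    (hc : c =ᵐ[wMeasure U fun x => (a 0 x)⁻¹] fun x => a 0 x • f x)
    (hd : d =ᵐ[wMeasure U fun x => (a 0 x)⁻¹] y) (h : ∀ x ∈ U, 0 ≤ inner ℝ (f x) (y x)) :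
    ∫⁻ x in U, ENNReal.ofReal (inner ℝ (f x) (y x)) = ENNReal.ofReal (inner ℝ c d) := by
  have hnonneg : ∀ x ∈ U, 0 ≤ inner ℝ (a 0 x • f x) (y x) := fun x hx => by
    rw [real_inner_smul_left]
    exact mul_nonneg (hm.coeff_nonneg 0 x hx) (h x hx)
  rw [inner_eq_integral_of_ae hc hd, ofReal_integral_eq_lintegral_ofReal
    (integrable_inner_of_ae hc hd) (ae_wMeasure_of_forall_mem hU hnonneg),
    lintegral_wMeasure hm.inv_meas]
  refine setLIntegral_congr_fun hU fun x hx => ?_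
  rw [← ENNReal.ofReal_mul (hm.inv_nonneg x hx), real_inner_smul_left,
    inv_mul_cancel_left₀ (hm.coeff_zero_pos x hx).ne']

variable {p Ψ q Θ : RegFun U φ (a 0)} {p₀ q₀ : E n → ℝ}

/-- The dissipation `∫_U K(x,|∇p|)|∇p|² dx` at time `t`. -/
def dissipation (α : Fin (N + 1) → ℝ) (p : RegFun U φ (a 0)) (t : ℝ) : ℝ :=
  inner ℝ (fluxL α p t) (p.gradL t)

/-- The density of the dissipation, expressed through the speed `|K(x,|∇p|)∇p|`. -/
def dissipationDensity (α : Fin (N + 1) → ℝ) (p : RegFun U φ (a 0)) (t : ℝ) (x : E n) : ℝ :=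
  ‖fluxAt α p t x‖ ^ 2 * g α a x ‖fluxAt α p t x‖

theorem dissipationDensity_nonneg (hm : IsMedium U φ a) {t : ℝ} {x : E n} (hx : x ∈ U) :
    0 ≤ dissipationDensity α p t x :=
  mul_nonneg (sq_nonneg _) (g_nonneg (hm.admissibleAt hx) (norm_nonneg _))

theorem inner_fluxAt_grad (hm : IsMedium U φ a) (hα : AdmissibleExp α) {t : ℝ} {x : E n}
    (hx : x ∈ U) : inner ℝ (fluxAt α p t x) (p.grad t x) = dissipationDensity α p t x :=
  inner_flux_self hα (hm.admissibleAt hx) _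

theorem norm_grad_sq_div_g (hm : IsMedium U φ a) (hα : AdmissibleExp α) {t : ℝ} {x : E n}
    (hx : x ∈ U) :
    ‖p.grad t x‖ ^ 2 / g α a x ‖fluxAt α p t x‖ = dissipationDensity α p t x := by
  have hg := g_pos hα (hm.admissibleAt hx) (norm_nonneg (fluxAt α p t x))
  have hnorm : ‖p.grad t x‖ = ‖fluxAt α p t x‖ * g α a x ‖fluxAt α p t x‖ :=
    norm_eq_mul_g_norm_flux hα (hm.admissibleAt hx) _
  rw [hnorm, dissipationDensity]
  field_simp

namespace IsSolution

theorem dissipation_nonneg (hU : MeasurableSet U) (hm : IsMedium U φ a) (hα : AdmissibleExp α)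
    (hp : IsSolution α p Ψ p₀) {t : ℝ} (ht : 0 < t) : 0 ≤ dissipation α p t :=
  (sq_nonneg _).trans (hp.norm_fluxL_sq_le hU hm hα ht)

theorem aemeasurable_dissipationDensity (hm : IsMedium U φ a) (hp : IsSolution α p Ψ p₀) {t : ℝ}
    (ht : 0 < t) : AEMeasurable (dissipationDensity α p t) (volume.restrict U) :=
  have hspeed := (hp.aestronglyMeasurable_flux ht).norm.aemeasurable
  (hspeed.pow_const 2).mul (aemeasurable_g hm hspeed)

theorem lintegral_dissipationDensity (hU : MeasurableSet U) (hm : IsMedium U φ a)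
    (hα : AdmissibleExp α) (hp : IsSolution α p Ψ p₀) {t : ℝ} (ht : 0 < t) :
    ∫⁻ x in U, ENNReal.ofReal (dissipationDensity α p t x)
      = ENNReal.ofReal (dissipation α p t) := by
  rw [dissipation, ← lintegral_inner_eq_ofReal_inner hU hm (hp.fluxL_ae hU hm hα ht)
    (p.gradL_ae ht) fun x hx => (inner_fluxAt_grad hm hα hx).symm ▸ dissipationDensity_nonneg hm hx]
  exact setLIntegral_congr_fun hU fun x hx => by rw [inner_fluxAt_grad hm hα hx]

theorem wNorm_W1_grad_sq_le (hU : MeasurableSet U) (hm : IsMedium U φ a)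
    (hα : AdmissibleExp α) (hp : IsSolution α p Ψ p₀) {t : ℝ} (ht : 0 < t) :
    wNorm U (W1 α a) (2 - aExp α) (p.grad t) ^ 2
      ≤ ENNReal.ofReal (dissipation α p t
        * (dissipation α p t + ∫ x in U, a (Fin.last N) x) ^ (aExp α / (2 - aExp α))) := by
  have hb := hα.aExp_pos
  have hb1 := hα.aExp_lt_one
  have hdiss := hp.dissipation_nonneg hU hm hα ht
  have hlast := hm.integral_last_nonneg hU
  have hgrad : ∫⁻ x in U, ENNReal.ofReal (‖p.grad t x‖ ^ 2 / g α a x ‖fluxAt α p t x‖)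
      = ENNReal.ofReal (dissipation α p t) := by
    rw [← hp.lintegral_dissipationDensity hU hm hα ht]
    exact setLIntegral_congr_fun hU fun x hx => by rw [norm_grad_sq_div_g hm hα hx]
  have hweight : ∫⁻ x in U, ENNReal.ofReal (dissipationDensity α p t x + a (Fin.last N) x)
      = ENNReal.ofReal (dissipation α p t + ∫ x in U, a (Fin.last N) x) := by
    rw [ENNReal.ofReal_add hdiss hlast, ← hp.lintegral_dissipationDensity hU hm hα ht,
      ← hm.lintegral_last hU, ← lintegral_add_right' _ (hm.coeff_meas _).ennreal_ofReal]
    exact setLIntegral_congr_fun hU fun x hx =>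
      ENNReal.ofReal_add (dissipationDensity_nonneg hm hx) (hm.coeff_last_pos x hx).le
  refine (wNorm_W1_sq_le hU hm hα (p.aestronglyMeasurable_grad ht)
    (hp.aestronglyMeasurable_flux ht).norm.aemeasurable fun _ => norm_nonneg _).trans_eq ?_
  rw [hgrad, ENNReal.ofReal_mul hdiss, ← ENNReal.ofReal_rpow_of_nonneg (by positivity)
    (div_nonneg hb.le (by linarith)), ← hweight]
  rfl

theorem inner_fluxL_sub_nonneg (hU : MeasurableSet U) (hm : IsMedium U φ a)
    (hα : AdmissibleExp α) (hp : IsSolution α p Ψ p₀) (hq : IsSolution α q Θ q₀) {t : ℝ}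
    (ht : 0 < t) : 0 ≤ inner ℝ (fluxL α p t - fluxL α q t) (p.gradL t - q.gradL t) :=
  (sq_nonneg _).trans (hp.norm_fluxL_sub_sq_le hU hm hα hq ht ht)

theorem lintegral_norm_grad_sub_sq_div_g_le (hU : MeasurableSet U) (hm : IsMedium U φ a)
    (hα : AdmissibleExp α) (hp : IsSolution α p Ψ p₀) (hq : IsSolution α q Θ q₀) {t : ℝ}
    (ht : 0 < t) :
    ∫⁻ x in U, ENNReal.ofReal (‖p.grad t x - q.grad t x‖ ^ 2
        / g α a x (max ‖fluxAt α q t x‖ ‖fluxAt α p t x‖))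
      ≤ ENNReal.ofReal (2 * (2 + α (Fin.last N)) ^ 2
          * inner ℝ (fluxL α p t - fluxL α q t) (p.gradL t - q.gradL t)) := by
  have hconst : 0 ≤ 2 * (2 + α (Fin.last N)) ^ 2 := by positivity
  have hmono : ∀ x ∈ U,
      0 ≤ inner ℝ (fluxAt α p t x - fluxAt α q t x) (p.grad t x - q.grad t x) := fun x hx =>
    (mul_nonneg (hm.coeff_nonneg 0 x hx) (sq_nonneg _)).trans
      (flux_cocoercive hα (hm.admissibleAt hx) _ _)
  rw [ENNReal.ofReal_mul hconst, ← lintegral_inner_eq_ofReal_inner hU hm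
    (hp.fluxL_sub_ae hU hm hα hq ht ht) (coeFn_sub_ae (p.gradL_ae ht) (q.gradL_ae ht)) hmono,
    ← lintegral_const_mul' _ _ ENNReal.ofReal_ne_top]
  refine setLIntegral_mono_ae' hU (ae_of_all _ fun x hx => ?_)
  rw [← ENNReal.ofReal_mul hconst]
  exact ENNReal.ofReal_le_ofReal
    (norm_sub_sq_div_g_le_mul_inner_flux hα (hm.admissibleAt hx) _ _)

theorem lintegral_max_speed_sq_mul_g_add_le (hU : MeasurableSet U) (hm : IsMedium U φ a)
    (hα : AdmissibleExp α) (hp : IsSolution α p Ψ p₀) (hq : IsSolution α q Θ q₀) {t : ℝ}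
    (ht : 0 < t) :
    ∫⁻ x in U, ENNReal.ofReal (max ‖fluxAt α q t x‖ ‖fluxAt α p t x‖ ^ 2
        * g α a x (max ‖fluxAt α q t x‖ ‖fluxAt α p t x‖) + a (Fin.last N) x)
      ≤ ENNReal.ofReal ((∫ x in U, a (Fin.last N) x) + dissipation α p t
          + dissipation α q t) := by
  have hlast := hm.integral_last_nonneg hU
  have hp_diss := hp.dissipation_nonneg hU hm hα ht
  have hq_diss := hq.dissipation_nonneg hU hm hα ht
  rw [ENNReal.ofReal_add (by positivity) hq_diss, ENNReal.ofReal_add hlast hp_diss,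
    ← hm.lintegral_last hU, ← hp.lintegral_dissipationDensity hU hm hα ht,
    ← hq.lintegral_dissipationDensity hU hm hα ht,
    ← lintegral_add_left' (hm.coeff_meas _).ennreal_ofReal,
    ← lintegral_add_right' _ (hq.aemeasurable_dissipationDensity hm ht).ennreal_ofReal]
  refine setLIntegral_mono_ae' hU (ae_of_all _ fun x hx => ?_)
  have ha := hm.admissibleAt hx
  have hpx := dissipationDensity_nonneg (α := α) (p := p) (t := t) hm hx
  have hqx := dissipationDensity_nonneg (α := α) (p := q) (t := t) hm hx
  rw [← ENNReal.ofReal_add ha.last_pos.le hpx,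
    ← ENNReal.ofReal_add (add_nonneg ha.last_pos.le hpx) hqx]
  refine ENNReal.ofReal_le_ofReal ?_
  have hmax := max_sq_mul_g_le (α := α) ha (norm_nonneg (fluxAt α q t x))
    (norm_nonneg (fluxAt α p t x))
  simp only [dissipationDensity]
  linarith

theorem wNorm_W1_grad_sub_sq_le (hU : MeasurableSet U) (hm : IsMedium U φ a)
    (hα : AdmissibleExp α) (hp : IsSolution α p Ψ p₀) (hq : IsSolution α q Θ q₀) {t : ℝ}
    (ht : 0 < t) :
    wNorm U (W1 α a) (2 - aExp α) (fun x => p.grad t x - q.grad t x) ^ 2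
      ≤ ENNReal.ofReal (2 * (2 + α (Fin.last N)) ^ 2
          * inner ℝ (fluxL α p t - fluxL α q t) (p.gradL t - q.gradL t)
        * ((∫ x in U, a (Fin.last N) x) + dissipation α p t + dissipation α q t)
          ^ (aExp α / (2 - aExp α))) := by
  have hexp : 0 ≤ aExp α / (2 - aExp α) :=
    div_nonneg hα.aExp_pos.le (by linarith [hα.aExp_lt_one])
  have hlast := hm.integral_last_nonneg hU
  have hp_diss := hp.dissipation_nonneg hU hm hα ht
  have hq_diss := hq.dissipation_nonneg hU hm hα ht
  have hmono := hp.inner_fluxL_sub_nonneg hU hm hα hq ht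
  have hmaxspeed : AEMeasurable (fun x => max ‖fluxAt α q t x‖ ‖fluxAt α p t x‖)
      (volume.restrict U) := (hq.aestronglyMeasurable_flux ht).norm.aemeasurable.max
    (hp.aestronglyMeasurable_flux ht).norm.aemeasurable
  refine (wNorm_W1_sq_le hU hm hα
    ((p.aestronglyMeasurable_grad ht).sub (q.aestronglyMeasurable_grad ht)) hmaxspeed
    fun _ => le_max_of_le_left (norm_nonneg _)).trans ?_
  rw [ENNReal.ofReal_mul (by positivity), ← ENNReal.ofReal_rpow_of_nonneg (by positivity) hexp]
  exact mul_le_mul' (hp.lintegral_norm_grad_sub_sq_div_g_le hU hm hα hq ht)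
    (ENNReal.rpow_le_rpow (hp.lintegral_max_speed_sq_mul_g_add_le hU hm hα hq ht) hexp)

end IsSolution

end Gradients

section Control

variable {n N : ℕ} {U : Set (E n)} {φ : E n → ℝ} {α : Fin (N + 1) → ℝ}
  {a : Fin (N + 1) → E n → ℝ} {p Ψ p₁ p₂ Ψ₁ Ψ₂ : RegFun U φ (a 0)} {p₀ p₀₁ p₀₂ : E n → ℝ} {t : ℝ}

theorem G_eq_add_norm (hU : MeasurableSet U) (hm : IsMedium U φ a) (ht : 0 < t) :
    G α Ψ t = max (∫ x in U, a (Fin.last N) x) 1 + ‖Ψ.gradL t‖ ^ 2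
      + wInt U (W1 α a) (2 - aExp α) (Ψ.grad t)
      + ‖Ψ.dtL t‖ ^ ((2 - aExp α) / (1 - aExp α)) := by
  have hexp : (2 : ℕ) * ((2 - aExp α) / (2 * (1 - aExp α))) = (2 - aExp α) / (1 - aExp α) := by
    rw [Nat.cast_ofNat, mul_div_assoc', mul_div_mul_left _ _ two_ne_zero]
  rw [G, wInt_two_eq_norm_sq hU hm.inv_meas hm.inv_nonneg (Ψ.gradL_ae ht),
    wInt_two_eq_norm_sq hU hm.porosity_meas hm.porosity_nonneg (Ψ.dtL_ae ht),
    ← Real.rpow_natCast ‖Ψ.dtL t‖, ← Real.rpow_mul (norm_nonneg _), hexp]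

theorem max_integral_add_norm_gradL_sq_le_G (hU : MeasurableSet U) (hm : IsMedium U φ a)
    (ht : 0 < t) : max (∫ x in U, a (Fin.last N) x) 1 + ‖Ψ.gradL t‖ ^ 2 ≤ G α Ψ t := by
  rw [G_eq_add_norm hU hm ht, add_assoc]
  exact le_add_of_nonneg_right (add_nonneg (wInt_nonneg hU hm.W1_nonneg _) (by positivity))

theorem max_integral_le_G (hU : MeasurableSet U) (hm : IsMedium U φ a) (ht : 0 < t) :
    max (∫ x in U, a (Fin.last N) x) 1 ≤ G α Ψ t :=
  (le_add_of_nonneg_right (sq_nonneg _)).trans (max_integral_add_norm_gradL_sq_le_G hU hm ht)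

theorem one_le_G (hU : MeasurableSet U) (hm : IsMedium U φ a) (ht : 0 < t) : 1 ≤ G α Ψ t :=
  (le_max_right _ _).trans (max_integral_le_G hU hm ht)

theorem norm_gradL_sq_le_G (hU : MeasurableSet U) (hm : IsMedium U φ a) (ht : 0 < t) :
    ‖Ψ.gradL t‖ ^ 2 ≤ G α Ψ t :=
  (le_add_of_nonneg_left (zero_le_one.trans (le_max_right _ _))).trans
    (max_integral_add_norm_gradL_sq_le_G hU hm ht)

theorem norm_dtL_rpow_le_G (hU : MeasurableSet U) (hm : IsMedium U φ a) (ht : 0 < t) :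
    ‖Ψ.dtL t‖ ^ ((2 - aExp α) / (1 - aExp α)) ≤ G α Ψ t := by
  rw [G_eq_add_norm hU hm ht]
  have hmax : 0 ≤ max (∫ x in U, a (Fin.last N) x) 1 := zero_le_one.trans (le_max_right _ _)
  exact le_add_of_nonneg_left
    (add_nonneg (add_nonneg hmax (sq_nonneg _)) (wInt_nonneg hU hm.W1_nonneg _))

theorem wNorm_W1_gradBar_sub_le (hU : MeasurableSet U) (hm : IsMedium U φ a)
    (hα : AdmissibleExp α) (ht : 0 < t) :
    wNorm U (W1 α a) (2 - aExp α) (fun x => gradBar p₁ Ψ₁ t x - gradBar p₂ Ψ₂ t x)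
      ≤ wNorm U (W1 α a) (2 - aExp α) (fun x => p₁.grad t x - p₂.grad t x)
        + wNorm U (W1 α a) (2 - aExp α) (fun x => Ψ₁.grad t x - Ψ₂.grad t x) := by
  simp only [gradBar, sub_sub_sub_comm (p₁.grad t _)]
  exact wNorm_W1_sub_le hU hm hα
    ((p₁.aestronglyMeasurable_grad ht).sub (p₂.aestronglyMeasurable_grad ht))
    ((Ψ₁.aestronglyMeasurable_grad ht).sub (Ψ₂.aestronglyMeasurable_grad ht))

namespace IsSolution

theorem norm_valL_sub_rpow_le (hU : MeasurableSet U) (hm : IsMedium U φ a)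
    (hα : AdmissibleExp α) (hp : IsSolution α p Ψ p₀) (ht : 0 < t) {cP : ℝ} (hcP : 0 < cP)
    (hPS : PoincareSobolev U φ α a cP (bar p Ψ t) (gradBar p Ψ t)) :
    ‖p.valL t - Ψ.valL t‖ ^ (2 - aExp α)
      ≤ (2 * cP) ^ (2 - aExp α) * (dissipation α p t + G α Ψ t) := by
  have hb0 := hα.aExp_pos
  have hb1 := hα.aExp_lt_one
  have hb2 : 0 < 2 - aExp α := by linarith
  have hdiss := hp.dissipation_nonneg hU hm hα ht
  have hlast := hm.integral_last_nonneg hU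
  have hlast_le := (le_max_left _ _).trans (max_integral_le_G (α := α) (Ψ := Ψ) hU hm ht)
  have hgrad_le := norm_gradL_sq_le_G (α := α) (Ψ := Ψ) hU hm ht
  set T := dissipation α p t + G α Ψ t
  have hT : 0 ≤ T := add_nonneg hdiss (hlast.trans hlast_le)
  have hgrad : wNorm U (W1 α a) (2 - aExp α) (p.grad t) ≤ ENNReal.ofReal (T ^ (1 / (2 - aExp α))) :=
    le_ofReal_rpow_of_sq_le hb0.le (by linarith) hdiss (by positivity) (by linarith)
      (by linarith) (hp.wNorm_W1_grad_sq_le hU hm hα ht)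
  have hgradΨ : wNorm U (W1 α a) (2 - aExp α) (Ψ.grad t)
      ≤ ENNReal.ofReal (T ^ (1 / (2 - aExp α))) :=
    le_ofReal_rpow_of_sq_le hb0.le (by linarith) (sq_nonneg _) hlast (by linarith) (by linarith)
      (wNorm_W1_sq_le_of_ae hU hm hα (Ψ.aestronglyMeasurable_grad ht) (Ψ.gradL_ae ht))
  have hnorm : ‖p.valL t - Ψ.valL t‖ ≤ 2 * cP * T ^ (1 / (2 - aExp α)) := by
    refine (ENNReal.ofReal_le_ofReal_iff (by positivity)).1 ?_
    rw [← wNorm_two_eq_norm hU hm.porosity_meas hm.porosity_nonneg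
      (coeFn_sub_ae (p.valL_ae ht) (Ψ.valL_ae ht)), mul_right_comm, mul_comm _ cP,
      ENNReal.ofReal_mul hcP.le, two_mul, ENNReal.ofReal_add (by positivity) (by positivity)]
    exact hPS.trans (mul_le_mul_right ((wNorm_W1_sub_le hU hm hα (p.aestronglyMeasurable_grad ht)
      (Ψ.aestronglyMeasurable_grad ht)).trans (add_le_add hgrad hgradΨ)) _)
  calc ‖p.valL t - Ψ.valL t‖ ^ (2 - aExp α)
      ≤ (2 * cP * T ^ (1 / (2 - aExp α))) ^ (2 - aExp α) :=
        Real.rpow_le_rpow (norm_nonneg _) hnorm hb2.le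
    _ = (2 * cP) ^ (2 - aExp α) * T := by
        rw [Real.mul_rpow (by positivity) (by positivity), ← Real.rpow_mul hT,
          one_div_mul_cancel hb2.ne', Real.rpow_one]

theorem controlled (hU : MeasurableSet U) (hm : IsMedium U φ a)
    (hα : AdmissibleExp α) (hp : IsSolution α p Ψ p₀) {cP : ℝ} (hcP : 0 < cP)
    (hPS : ∀ t > 0, PoincareSobolev U φ α a cP (bar p Ψ t) (gradBar p Ψ t)) :
    (hp.toFlow hU hm hα).Controlled (aExp α) ((2 * cP) ^ (2 - aExp α)) (G α Ψ) where
  one_le _ ht := one_le_G hU hm ht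
  norm_η_sq_le _ ht := norm_gradL_sq_le_G hU hm ht
  norm_ψ'_rpow_le _ ht := norm_dtL_rpow_le_G hU hm ht
  poincare t ht := hp.norm_valL_sub_rpow_le hU hm hα ht hcP (hPS t ht)

theorem wNorm_W1_gradBar_sub_sq_le (hU : MeasurableSet U) (hm : IsMedium U φ a)
    (hα : AdmissibleExp α) (h₁ : IsSolution α p₁ Ψ₁ p₀₁) (h₂ : IsSolution α p₂ Ψ₂ p₀₂)
    (ht : 0 < t) :
    wNorm U (W1 α a) (2 - aExp α) (fun x => gradBar p₁ Ψ₁ t x - gradBar p₂ Ψ₂ t x) ^ 2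
      ≤ ENNReal.ofReal (4 * (2 + α (Fin.last N)) ^ 2
        * ((∫ x in U, a (Fin.last N) x) + dissipation α p₁ t + dissipation α p₂ t)
          ^ (aExp α / (2 - aExp α))
        * (inner ℝ (fluxL α p₁ t - fluxL α p₂ t) (p₁.gradL t - p₂.gradL t)
          + ‖Ψ₁.gradL t - Ψ₂.gradL t‖ ^ 2)) := by
  have hexp : 0 ≤ aExp α / (2 - aExp α) :=
    div_nonneg hα.aExp_pos.le (by linarith [hα.aExp_lt_one])
  have hmono := h₁.inner_fluxL_sub_nonneg hU hm hα h₂ ht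
  have hlast := hm.integral_last_nonneg hU
  have hdiss₁ := h₁.dissipation_nonneg hU hm hα ht
  have hdiss₂ := h₂.dissipation_nonneg hU hm hα ht
  have hp := h₁.wNorm_W1_grad_sub_sq_le hU hm hα h₂ ht
  have hΨ := wNorm_W1_sq_le_of_ae hU hm hα
    ((Ψ₁.aestronglyMeasurable_grad ht).sub (Ψ₂.aestronglyMeasurable_grad ht))
    (coeFn_sub_ae (Ψ₁.gradL_ae ht) (Ψ₂.gradL_ae ht))
  refine (pow_le_pow_left' (wNorm_W1_gradBar_sub_le hU hm hα ht) 2).trans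
    ((add_sq_le_two_mul_add _ _).trans ((mul_le_mul_right (add_le_add hp hΨ) 2).trans ?_))
  have htwo (r : ℝ) : 2 * ENNReal.ofReal r = ENNReal.ofReal (2 * r) := by
    rw [ENNReal.ofReal_mul two_pos.le, ENNReal.ofReal_ofNat]
  rw [← ENNReal.ofReal_add (by positivity) (by positivity), htwo]
  refine ENNReal.ofReal_le_ofReal ?_
  set S := inner ℝ (fluxL α p₁ t - fluxL α p₂ t) (p₁.gradL t - p₂.gradL t)
  set B := ∫ x in U, a (Fin.last N) x
  have hc : 1 ≤ 2 * (2 + α (Fin.last N)) ^ 2 := by nlinarith [hα.last_pos]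
  have hweight : B ^ (aExp α / (2 - aExp α))
      ≤ 2 * (2 + α (Fin.last N)) ^ 2
        * (B + dissipation α p₁ t + dissipation α p₂ t) ^ (aExp α / (2 - aExp α)) :=
    (Real.rpow_le_rpow hlast (by linarith) hexp).trans
      (le_mul_of_one_le_left (by positivity) hc)
  nlinarith [mul_le_mul_of_nonneg_left hweight (sq_nonneg ‖Ψ₁.gradL t - Ψ₂.gradL t‖)]

end IsSolution

theorem D_eq_norm (hU : MeasurableSet U) (hm : IsMedium U φ a) (ht : 0 < t) :
    D Ψ₁ Ψ₂ t = ‖Ψ₁.gradL t - Ψ₂.gradL t‖ ^ 2 + ‖Ψ₁.gradL t - Ψ₂.gradL t‖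
      + ‖Ψ₁.dtL t - Ψ₂.dtL t‖ := by
  rw [D, wInt_two_eq_norm_sq hU hm.inv_meas hm.inv_nonneg
    (coeFn_sub_ae (Ψ₁.gradL_ae ht) (Ψ₂.gradL_ae ht)),
    wInt_two_eq_norm_sq hU hm.porosity_meas hm.porosity_nonneg
    (coeFn_sub_ae (Ψ₁.dtL_ae ht) (Ψ₂.dtL_ae ht)), ← Real.sqrt_eq_rpow, ← Real.sqrt_eq_rpow,
    Real.sqrt_sq (norm_nonneg _), Real.sqrt_sq (norm_nonneg _)]

theorem G1_nonneg (hU : MeasurableSet U) (hm : IsMedium U φ a) (t : ℝ) : 0 ≤ G1 Ψ t :=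
  wInt_nonneg hU hm.inv_nonneg _

theorem G2_nonneg (hU : MeasurableSet U) (hm : IsMedium U φ a) (t : ℝ) : 0 ≤ G2 Ψ t :=
  wInt_nonneg hU hm.porosity_nonneg _

theorem G1_eq_norm_sq (hU : MeasurableSet U) (hm : IsMedium U φ a) (ht : 0 < t) :
    G1 Ψ t = ‖Ψ.gradDtL t‖ ^ 2 :=
  wInt_two_eq_norm_sq hU hm.inv_meas hm.inv_nonneg (Ψ.gradDtL_ae ht)

theorem G2_eq_norm_sq (hU : MeasurableSet U) (hm : IsMedium U φ a) (ht : 0 < t) :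
    G2 Ψ t = ‖Ψ.dttL t‖ ^ 2 :=
  wInt_two_eq_norm_sq hU hm.porosity_meas hm.porosity_nonneg (Ψ.dttL_ae ht)

theorem continuousOn_G1 (hU : MeasurableSet U) (hm : IsMedium U φ a) :
    ContinuousOn (G1 Ψ) (Ioi 0) :=
  (Ψ.continuousOn_gradDtL.norm.pow 2).congr fun _ ht => G1_eq_norm_sq hU hm ht

theorem continuousOn_G2 (hU : MeasurableSet U) (hm : IsMedium U φ a) :
    ContinuousOn (G2 Ψ) (Ioi 0) :=
  (Ψ.continuousOn_dttL.norm.pow 2).congr fun _ ht => G2_eq_norm_sq hU hm ht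

theorem intG12_comm (t : ℝ) : intG12 Ψ₁ Ψ₂ t = intG12 Ψ₂ Ψ₁ t := by
  unfold intG12
  exact intervalIntegral.integral_congr fun τ _ =>
    congrArg₂ (· + ·) (add_comm (G1 Ψ₁ τ) _) (add_comm (G2 Ψ₁ τ) _)

theorem intG12_nonneg (hU : MeasurableSet U) (hm : IsMedium U φ a) (t : ℝ) :
    0 ≤ intG12 Ψ₁ Ψ₂ t :=
  intervalIntegral.integral_nonneg (by linarith) fun _ _ =>
    add_nonneg (add_nonneg (G1_nonneg hU hm _) (G1_nonneg hU hm _))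
      (add_nonneg (G2_nonneg hU hm _) (G2_nonneg hU hm _))

theorem IsSolution.integral_source_le_intG12 (hU : MeasurableSet U) (hm : IsMedium U φ a)
    (hα : AdmissibleExp α) (hp : IsSolution α p Ψ₁ p₀) (ht : 1 < t) :
    ∫ τ in (t - 1)..t, (hp.toFlow hU hm hα).source τ ≤ intG12 Ψ₁ Ψ₂ t := by
  have hsub : uIcc (t - 1) t ⊆ Ioi 0 := by
    rw [uIcc_of_le (by linarith)]
    exact fun τ hτ => (by linarith : 0 < t - 1).trans_le hτ.1
  have hG : ContinuousOn (fun τ => (G1 Ψ₁ τ + G1 Ψ₂ τ) + (G2 Ψ₁ τ + G2 Ψ₂ τ)) (Ioi 0) :=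
    ((continuousOn_G1 hU hm).add (continuousOn_G1 hU hm)).add
      ((continuousOn_G2 hU hm).add (continuousOn_G2 hU hm))
  refine intervalIntegral.integral_mono_on (by linarith)
    ((hp.toFlow hU hm hα).continuousOn_source.mono hsub).intervalIntegrable
    (hG.mono hsub).intervalIntegrable fun τ hτ => ?_
  have hτ : 0 < τ := (by linarith : 0 < t - 1).trans_le hτ.1
  have hsource : (hp.toFlow hU hm hα).source τ = G1 Ψ₁ τ + G2 Ψ₁ τ := by
    rw [G1_eq_norm_sq hU hm hτ, G2_eq_norm_sq hU hm hτ]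
    rfl
  linarith [G1_nonneg (Ψ := Ψ₂) hU hm τ, G2_nonneg (Ψ := Ψ₂) hU hm τ]

section GrowthBound

variable {V : ℝ → ℝ}

theorem IsGeneralV.symm (hV : IsGeneralV α Ψ₁ Ψ₂ V) : IsGeneralV α Ψ₂ Ψ₁ V := by
  obtain ⟨M₁, M₂, hM₁, hM₂, hVeq⟩ := hV
  exact ⟨M₂, M₁, hM₂, hM₁, fun t ht => by rw [hVeq t ht, add_comm (M₁ t), intG12_comm]⟩

theorem IsFiniteBV.symm (hV : IsFiniteBV α Ψ₁ Ψ₂ V) : IsFiniteBV α Ψ₂ Ψ₁ V := by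
  obtain ⟨hG₁, hG₂, hB, hVeq⟩ := hV
  refine ⟨hG₂, hG₁, add_comm (limB α Ψ₁) _ ▸ hB, fun t ht => ?_⟩
  rw [hVeq t ht, add_comm (limB α Ψ₁), add_comm (G α Ψ₁ t), intG12_comm]

theorem one_le_G_add_G (hU : MeasurableSet U) (hm : IsMedium U φ a) (ht : 0 < t) :
    1 ≤ G α Ψ₁ t + G α Ψ₂ t :=
  (one_le_G hU hm ht).trans (le_add_of_nonneg_right (zero_le_one.trans (one_le_G hU hm ht)))

theorem G_add_G_le_V (hU : MeasurableSet U) (hm : IsMedium U φ a) (hα : AdmissibleExp α)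
    (hV : IsGeneralV α Ψ₁ Ψ₂ V ∨ IsFiniteBV α Ψ₁ Ψ₂ V) (ht : 1 ≤ t) :
    G α Ψ₁ t + G α Ψ₂ t ≤ V t := by
  have hb0 := hα.aExp_pos.le
  have hb2 : aExp α < 2 := by linarith [hα.aExp_lt_one]
  have ht0 : 0 < t := by linarith
  have hG := one_le_G_add_G (α := α) (Ψ₁ := Ψ₁) (Ψ₂ := Ψ₂) hU hm ht0
  have hint := intG12_nonneg (Ψ₁ := Ψ₁) (Ψ₂ := Ψ₂) hU hm t
  rcases hV with ⟨M₁, M₂, hM₁, hM₂, hVeq⟩ | ⟨-, -, -, hVeq⟩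
  · have hM := add_le_add (hM₁.ge t ht0.le) (hM₂.ge t ht0.le)
    rw [hVeq t ht]
    linarith [le_rpow_two_div_two_sub hb0 hb2 (hG.trans hM)]
  · have hB : 0 ≤ (limB α Ψ₁ + limB α Ψ₂).toReal ^ (1 / (1 - aExp α)) := by positivity
    rw [hVeq t ht]
    linarith [le_rpow_two_div_two_sub hb0 hb2 hG]

theorem one_le_V (hU : MeasurableSet U) (hm : IsMedium U φ a) (hα : AdmissibleExp α)
    (hV : IsGeneralV α Ψ₁ Ψ₂ V ∨ IsFiniteBV α Ψ₁ Ψ₂ V) (ht : 1 ≤ t) : 1 ≤ V t :=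
  (one_le_G_add_G hU hm (zero_lt_one.trans_le ht)).trans (G_add_G_le_V hU hm hα hV ht)

theorem integral_last_le_V (hU : MeasurableSet U) (hm : IsMedium U φ a) (hα : AdmissibleExp α)
    (hV : IsGeneralV α Ψ₁ Ψ₂ V ∨ IsFiniteBV α Ψ₁ Ψ₂ V) (ht : 1 ≤ t) :
    ∫ x in U, a (Fin.last N) x ≤ V t := by
  have ht0 : 0 < t := zero_lt_one.trans_le ht
  calc ∫ x in U, a (Fin.last N) x ≤ G α Ψ₁ t :=
        (le_max_left _ _).trans (max_integral_le_G hU hm ht0)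
    _ ≤ G α Ψ₁ t + G α Ψ₂ t :=
        le_add_of_nonneg_right (zero_le_one.trans (one_le_G hU hm ht0))
    _ ≤ V t := G_add_G_le_V hU hm hα hV ht

end GrowthBound

end Control

section SizeBounds

variable {N : ℕ} {α : Fin (N + 1) → ℝ} {cP : ℝ}

theorem exists_size_le_of_isGeneralV (hα : AdmissibleExp α) (hcP : 0 < cP) :
    ∃ C > 0, ∀ {n : ℕ} {U : Set (E n)} {φ : E n → ℝ} {a : Fin (N + 1) → E n → ℝ}
      {p Ψ₁ Ψ₂ : RegFun U φ (a 0)} {p₀ : E n → ℝ} {V : ℝ → ℝ} (hU : MeasurableSet U)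
      (hm : IsMedium U φ a) (hp : IsSolution α p Ψ₁ p₀),
      (∀ t > 0, PoincareSobolev U φ α a cP (bar p Ψ₁ t) (gradBar p Ψ₁ t)) →
      IsGeneralV α Ψ₁ Ψ₂ V → ∀ᶠ t in atTop, (hp.toFlow hU hm hα).size t ≤ C * V t := by
  obtain ⟨C, hC, hsize⟩ := exists_size_le_of_monotone hα.aExp_pos.le hα.aExp_lt_one
    (by positivity : 0 < (2 * cP) ^ (2 - aExp α))
  refine ⟨C, hC, fun {n U φ a p Ψ₁ Ψ₂ p₀ V} hU hm hp hPS hV => ?_⟩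
  obtain ⟨M₁, M₂, hM₁, hM₂, hVeq⟩ := hV
  filter_upwards [hsize (hp.toFlow hU hm hα) _ M₁ (hp.controlled hU hm hα hcP hPS)
    (fun t ht => hM₁.ge t (le_of_lt ht)) (hM₁.mono.mono Ioi_subset_Ici_self),
    eventually_gt_atTop 1] with t hsize_t ht
  have ht0 : 0 < t := by linarith
  have hM₁0 : 0 ≤ M₁ t := by linarith [hM₁.ge t ht0.le, one_le_G (α := α) (Ψ := Ψ₁) hU hm ht0]
  have hM₂0 : 0 ≤ M₂ t := by linarith [hM₂.ge t ht0.le, one_le_G (α := α) (Ψ := Ψ₂) hU hm ht0]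
  rw [hVeq t ht.le]
  refine hsize_t.trans ?_
  gcongr
  · exact div_nonneg two_pos.le (by linarith [hα.aExp_lt_one])
  · linarith
  · exact hp.integral_source_le_intG12 hU hm hα ht

theorem eventually_le_deriv_of_limB_ne_top {n : ℕ} {U : Set (E n)} {φ : E n → ℝ}
    {a : Fin (N + 1) → E n → ℝ} {Ψ : RegFun U φ (a 0)} (h : limB α Ψ ≠ ⊤) :
    ∀ᶠ t in atTop, -((limB α Ψ).toReal + 1) ≤ deriv (G α Ψ) t := by
  filter_upwards [eventually_le_toReal_limsup_add (R := fun t => -deriv (G α Ψ) t) one_pos h]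
    with t ht
  exact neg_le.1 ht

theorem exists_size_le_of_isFiniteBV (hα : AdmissibleExp α) (hcP : 0 < cP) :
    ∃ C > 0, ∀ {n : ℕ} {U : Set (E n)} {φ : E n → ℝ} {a : Fin (N + 1) → E n → ℝ}
      {p Ψ₁ Ψ₂ : RegFun U φ (a 0)} {p₀ : E n → ℝ} {V : ℝ → ℝ} (hU : MeasurableSet U)
      (hm : IsMedium U φ a) (hp : IsSolution α p Ψ₁ p₀),
      (∀ t > 0, PoincareSobolev U φ α a cP (bar p Ψ₁ t) (gradBar p Ψ₁ t)) →
      IsFiniteBV α Ψ₁ Ψ₂ V → ∀ᶠ t in atTop, (hp.toFlow hU hm hα).size t ≤ C * V t := by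
  obtain ⟨C, hC, hsize⟩ := exists_size_le_of_deriv_ge hα.aExp_pos.le hα.aExp_lt_one
    (by positivity : 0 < (2 * cP) ^ (2 - aExp α))
  have hb0 := hα.aExp_pos
  have hb1 := hα.aExp_lt_one
  set q := 1 / (1 - aExp α) with hq
  have hq1 : 1 ≤ q := by rw [hq, le_div_iff₀ (by linarith)]; linarith
  set k : ℝ := 2 ^ (q - 1)
  have hk : 0 < k := by positivity
  refine ⟨C * (1 + k), by positivity, fun {n U φ a p Ψ₁ Ψ₂ p₀ V} hU hm hp hPS hV => ?_⟩
  obtain ⟨hG₁, -, hB, hVeq⟩ := hV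
  set β := (limB α Ψ₁ + limB α Ψ₂).toReal
  have hβ : 0 ≤ β := ENNReal.toReal_nonneg
  have hderiv : ∀ t > 0, HasDerivAt (G α Ψ₁) (deriv (G α Ψ₁) t) t := fun t ht =>
    ((hG₁.differentiableOn one_ne_zero t ht).differentiableAt (Ioi_mem_nhds ht)).hasDerivAt
  have hderiv_ge : ∀ᶠ t in atTop, -(β + 1) ≤ deriv (G α Ψ₁) t := by
    have hle : (limB α Ψ₁).toReal ≤ β := ENNReal.toReal_mono hB.ne le_self_add
    filter_upwards [eventually_le_deriv_of_limB_ne_top (le_self_add.trans_lt hB).ne] with t ht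
    linarith
  have hβq : (β + 1) ^ q ≤ k * (β ^ q + 1) := by
    simpa only [Real.one_rpow] using add_rpow_le_two_rpow_mul_add hβ zero_le_one hq1
  filter_upwards [hsize (hp.toFlow hU hm hα) _ _ (β + 1) (hp.controlled hU hm hα hcP hPS)
    (by linarith) hderiv hderiv_ge, eventually_gt_atTop 1] with t hsize_t ht
  have ht0 : 0 < t := by linarith
  have hsource := hp.integral_source_le_intG12 (Ψ₂ := Ψ₂) hU hm hα ht
  have hint := intG12_nonneg (Ψ₁ := Ψ₁) (Ψ₂ := Ψ₂) hU hm t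
  have hGadd := one_le_G_add_G (α := α) (Ψ₁ := Ψ₁) (Ψ₂ := Ψ₂) hU hm ht0
  have hGrpow : G α Ψ₁ t ^ (2 / (2 - aExp α)) ≤ (G α Ψ₁ t + G α Ψ₂ t) ^ (2 / (2 - aExp α)) :=
    Real.rpow_le_rpow (zero_le_one.trans (one_le_G hU hm ht0))
      (le_add_of_nonneg_right (zero_le_one.trans (one_le_G hU hm ht0)))
      (div_nonneg two_pos.le (by linarith))
  have hone := hGadd.trans (le_rpow_two_div_two_sub hb0.le (by linarith) hGadd)
  rw [hVeq t ht.le, mul_assoc]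
  refine hsize_t.trans (mul_le_mul_of_nonneg_left ?_ hC.le)
  nlinarith [mul_nonneg hk.le hint, mul_nonneg hk.le (sub_nonneg.2 hone),
    Real.rpow_nonneg hβ q]

theorem exists_size_le (hα : AdmissibleExp α) (hcP : 0 < cP) :
    ∃ C > 0, ∀ {n : ℕ} {U : Set (E n)} {φ : E n → ℝ} {a : Fin (N + 1) → E n → ℝ}
      {p Ψ₁ Ψ₂ : RegFun U φ (a 0)} {p₀ : E n → ℝ} {V : ℝ → ℝ} (hU : MeasurableSet U)
      (hm : IsMedium U φ a) (hp : IsSolution α p Ψ₁ p₀),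
      (∀ t > 0, PoincareSobolev U φ α a cP (bar p Ψ₁ t) (gradBar p Ψ₁ t)) →
      (IsGeneralV α Ψ₁ Ψ₂ V ∨ IsFiniteBV α Ψ₁ Ψ₂ V) →
      ∀ᶠ t in atTop, (hp.toFlow hU hm hα).size t ≤ C * V t := by
  obtain ⟨A, hA, hgeneral⟩ := exists_size_le_of_isGeneralV hα hcP
  obtain ⟨B, -, hfinite⟩ := exists_size_le_of_isFiniteBV hα hcP
  refine ⟨max A B, lt_max_of_lt_left hA, fun {n U φ a p Ψ₁ Ψ₂ p₀ V} hU hm hp hPS hV => ?_⟩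
  have hV0 : ∀ᶠ t in atTop, 0 ≤ V t := by
    filter_upwards [eventually_ge_atTop 1] with t ht
    exact zero_le_one.trans (one_le_V hU hm hα hV ht)
  rcases hV with hV | hV
  · filter_upwards [hgeneral hU hm hp hPS hV, hV0] with t hsize ht
    exact hsize.trans (mul_le_mul_of_nonneg_right (le_max_left _ _) ht)
  · filter_upwards [hfinite hU hm hp hPS hV, hV0] with t hsize ht
    exact hsize.trans (mul_le_mul_of_nonneg_right (le_max_right _ _) ht)

end SizeBounds

section Coupling

variable {n N : ℕ} {U : Set (E n)} {φ : E n → ℝ} {α : Fin (N + 1) → ℝ}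
  {a : Fin (N + 1) → E n → ℝ} {p₁ p₂ Ψ₁ Ψ₂ : RegFun U φ (a 0)} {p₀₁ p₀₂ : E n → ℝ}

/-- The norm `‖∇P̄(t)‖` in `L^{2-a}_{W₁}` of the difference `P̄ = (p₁ - Ψ₁) - (p₂ - Ψ₂)`. -/
def gradBarDist (α : Fin (N + 1) → ℝ) (p₁ p₂ Ψ₁ Ψ₂ : RegFun U φ (a 0)) (t : ℝ) : ℝ≥0∞ :=
  wNorm U (W1 α a) (2 - aExp α) (fun x => gradBar p₁ Ψ₁ t x - gradBar p₂ Ψ₂ t x)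

namespace IsSolution

theorem gradBarDist_ne_top (hU : MeasurableSet U) (hm : IsMedium U φ a) (hα : AdmissibleExp α)
    (h₁ : IsSolution α p₁ Ψ₁ p₀₁) (h₂ : IsSolution α p₂ Ψ₂ p₀₂) {t : ℝ} (ht : 0 < t) :
    gradBarDist α p₁ p₂ Ψ₁ Ψ₂ t ≠ ⊤ := fun htop => by
  have hsq := h₁.wNorm_W1_gradBar_sub_sq_le hU hm hα h₂ ht
  rw [← gradBarDist, htop, ENNReal.top_pow two_ne_zero, top_le_iff] at hsq
  exact ENNReal.ofReal_ne_top hsq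

theorem coupled (hU : MeasurableSet U) (hm : IsMedium U φ a) (hα : AdmissibleExp α)
    (h₁ : IsSolution α p₁ Ψ₁ p₀₁) (h₂ : IsSolution α p₂ Ψ₂ p₀₂) {cP : ℝ} (hcP : 0 < cP)
    (hPS : ∀ t > 0, PoincareSobolev U φ α a cP
      (fun x => bar p₁ Ψ₁ t x - bar p₂ Ψ₂ t x)
      (fun x => gradBar p₁ Ψ₁ t x - gradBar p₂ Ψ₂ t x)) :
    (h₁.toFlow hU hm hα).Coupled (h₂.toFlow hU hm hα) (aExp α / (2 - aExp α))
      (cP ^ 2 + 4 * (2 + α (Fin.last N)) ^ 2) (fun _ => ∫ x in U, a (Fin.last N) x)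
      (fun t => (gradBarDist α p₁ p₂ Ψ₁ Ψ₂ t).toReal ^ 2) where
  weak₁₂ _ ht := h₁.inner_dtL_eq hU hm hα h₂ ht ht
  weak₂₁ _ ht := h₂.inner_dtL_eq hU hm hα h₁ ht ht
  nonneg _ _ := hm.integral_last_nonneg hU
  le_mul_monotonicity t ht := by
    have hdiss₁ := h₁.dissipation_nonneg hU hm hα ht
    have hdiss₂ := h₂.dissipation_nonneg hU hm hα ht
    have hmono := h₁.inner_fluxL_sub_nonneg hU hm hα h₂ ht
    have hlast := hm.integral_last_nonneg hU
    rw [← ENNReal.toReal_pow]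
    refine (ENNReal.toReal_le_of_le_ofReal (by positivity)
      (h₁.wNorm_W1_gradBar_sub_sq_le hU hm hα h₂ ht)).trans ?_
    change _ ≤ (cP ^ 2 + 4 * (2 + α (Fin.last N)) ^ 2) * ((∫ x in U, a (Fin.last N) x)
        + dissipation α p₁ t + dissipation α p₂ t) ^ (aExp α / (2 - aExp α))
      * (inner ℝ (fluxL α p₁ t - fluxL α p₂ t) (p₁.gradL t - p₂.gradL t)
        + ‖Ψ₁.gradL t - Ψ₂.gradL t‖ ^ 2)
    gcongr
    exact le_add_of_nonneg_left (sq_nonneg cP)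
  poincare t ht := by
    have hdist : ‖(p₁.valL t - Ψ₁.valL t) - (p₂.valL t - Ψ₂.valL t)‖
        ≤ cP * (gradBarDist α p₁ p₂ Ψ₁ Ψ₂ t).toReal := by
      refine (ENNReal.ofReal_le_ofReal_iff (by positivity)).1 ?_
      rw [← wNorm_two_eq_norm hU hm.porosity_meas hm.porosity_nonneg
        (coeFn_sub_ae (coeFn_sub_ae (p₁.valL_ae ht) (Ψ₁.valL_ae ht))
          (coeFn_sub_ae (p₂.valL_ae ht) (Ψ₂.valL_ae ht))), ENNReal.ofReal_mul hcP.le,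
        ENNReal.ofReal_toReal (h₁.gradBarDist_ne_top hU hm hα h₂ ht)]
      exact hPS t ht
    calc _ ≤ (cP * (gradBarDist α p₁ p₂ Ψ₁ Ψ₂ t).toReal) ^ 2 :=
          pow_le_pow_left₀ (norm_nonneg _) hdist 2
      _ ≤ _ := by
          rw [mul_pow]
          gcongr
          exact le_add_of_nonneg_right (by positivity)

theorem gradBarDist_sq_eventuallyEq (hU : MeasurableSet U) (hm : IsMedium U φ a)
    (hα : AdmissibleExp α) (h₁ : IsSolution α p₁ Ψ₁ p₀₁) (h₂ : IsSolution α p₂ Ψ₂ p₀₂) :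
    (fun t => gradBarDist α p₁ p₂ Ψ₁ Ψ₂ t ^ 2)
      =ᶠ[atTop] fun t => ENNReal.ofReal ((gradBarDist α p₁ p₂ Ψ₁ Ψ₂ t).toReal ^ 2) := by
  filter_upwards [eventually_gt_atTop 0] with t ht
  rw [ENNReal.ofReal_pow ENNReal.toReal_nonneg,
    ENNReal.ofReal_toReal (h₁.gradBarDist_ne_top hU hm hα h₂ ht)]

theorem D_eventuallyEq_dataDist (hU : MeasurableSet U) (hm : IsMedium U φ a)
    (hα : AdmissibleExp α) (h₁ : IsSolution α p₁ Ψ₁ p₀₁) (h₂ : IsSolution α p₂ Ψ₂ p₀₂) :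
    D Ψ₁ Ψ₂ =ᶠ[atTop] (h₁.toFlow hU hm hα).dataDist (h₂.toFlow hU hm hα) := by
  filter_upwards [eventually_gt_atTop 0] with t ht using D_eq_norm hU hm ht

end IsSolution

end Coupling

end Forchheimer

end

theorem mainTheorem9_general {N : ℕ} (hN : 1 ≤ N) (α : Fin (N + 1) → ℝ) (hα0 : α 0 = 0)
    (hα : StrictMono α) (cP : ℝ) (hcP : 0 < cP) :
    ∃ C : ℝ, 0 < C ∧
      ∀ {n : ℕ} {U : Set (E n)}, MeasurableSet U →
      ∀ (φ : E n → ℝ) (a : Fin (N + 1) → E n → ℝ), IsMedium U φ a →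
      ∀ (p₁ p₂ Ψ₁ Ψ₂ : RegFun U φ (a 0)) (p₀₁ p₀₂ : E n → ℝ),
        IsSolution α p₁ Ψ₁ p₀₁ → IsSolution α p₂ Ψ₂ p₀₂ →
        (∀ t > 0, PoincareSobolev U φ α a cP (bar p₁ Ψ₁ t) (gradBar p₁ Ψ₁ t)) →
        (∀ t > 0, PoincareSobolev U φ α a cP (bar p₂ Ψ₂ t) (gradBar p₂ Ψ₂ t)) →
        (∀ t > 0, PoincareSobolev U φ α a cP
          (fun x => bar p₁ Ψ₁ t x - bar p₂ Ψ₂ t x)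
          (fun x => gradBar p₁ Ψ₁ t x - gradBar p₂ Ψ₂ t x)) →
        ∀ V : ℝ → ℝ, (IsGeneralV α Ψ₁ Ψ₂ V ∨ IsFiniteBV α Ψ₁ Ψ₂ V) →
        ∫⁻ t in Ioi (1 : ℝ), ENNReal.ofReal (V t ^ (-(aExp α / (2 - aExp α)))) = ⊤ →
        (∀ᶠ t in atTop, DifferentiableAt ℝ (fun s => V s ^ (aExp α / (2 - aExp α))) t) →
        Tendsto (deriv fun s => V s ^ (aExp α / (2 - aExp α))) atTop (𝓝 0) →
        limsup (fun t => wNorm U (W1 α a) (2 - aExp α)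
            (fun x => gradBar p₁ Ψ₁ t x - gradBar p₂ Ψ₂ t x) ^ 2) atTop
          ≤ ENNReal.ofReal C *
              limsup (fun t => ENNReal.ofReal
                ((V t ^ (3 * kappa0 α) * D Ψ₁ Ψ₂ t) ^ (1 / 2 : ℝ))) atTop
            + ENNReal.ofReal C *
              limsup (fun t => ENNReal.ofReal (V t ^ kappa0 α * D Ψ₁ Ψ₂ t)) atTop := by
  have hexp : AdmissibleExp α := ⟨hN, hα0, hα⟩
  have hγ : 0 < aExp α / (2 - aExp α) :=
    div_pos hexp.aExp_pos (by linarith [hexp.aExp_lt_one])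
  obtain ⟨C₁, hC₁, hsize⟩ := exists_size_le hexp hcP
  obtain ⟨C, hC, hlimsup⟩ := Flow.exists_limsup_difference_le hγ
    (by positivity : 0 < cP ^ 2 + 4 * (2 + α (Fin.last N)) ^ 2) hC₁.le
  refine ⟨C, hC, fun hU φ a hm p₁ p₂ Ψ₁ Ψ₂ p₀₁ p₀₂ h₁ h₂ hPS₁ hPS₂ hPS V hV hint hdiff hder => ?_⟩
  have hV' := hV.imp IsGeneralV.symm IsFiniteBV.symm
  have hbound := hlimsup (h₁.toFlow hU hm hexp) (h₂.toFlow hU hm hexp) V _ _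
    (h₁.coupled hU hm hexp h₂ hcP hPS) (fun t => integral_last_le_V hU hm hexp hV)
    (fun t => one_le_V hU hm hexp hV) (hsize hU hm h₁ hPS₁ hV) (hsize hU hm h₂ hPS₂ hV')
    hdiff hder hint
  have hD := h₁.D_eventuallyEq_dataDist hU hm hexp h₂
  refine (limsup_congr (h₁.gradBarDist_sq_eventuallyEq hU hm hexp h₂)).trans_le
    (hbound.trans_eq (congrArg₂ _ (congrArg _ (limsup_congr ?_)) (congrArg _ (limsup_congr ?_))))
  all_goals
    filter_upwards [hD] with t ht
    rw [ht, kappa0]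

theorem mainTheorem9 {n N : ℕ} (hn : 2 ≤ n) (hN : 1 ≤ N)
    (U : Set (E n)) (hUo : IsOpen U) (hUc : IsConnected U) (hUb : Bornology.IsBounded U)
    (α : Fin (N + 1) → ℝ) (hα0 : α 0 = 0) (hα : StrictMono α)
    (cP : ℝ) (hcP : 0 < cP) :
    ∃ C : ℝ, 0 < C ∧
      ∀ (φ : E n → ℝ) (a : Fin (N + 1) → E n → ℝ), IsMedium U φ a →
      ∀ (p₁ p₂ Ψ₁ Ψ₂ : RegFun U φ (a 0)) (p₀₁ p₀₂ : E n → ℝ),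
        IsSolution α p₁ Ψ₁ p₀₁ → IsSolution α p₂ Ψ₂ p₀₂ →
        (∀ t > 0, PoincareSobolev U φ α a cP (bar p₁ Ψ₁ t) (gradBar p₁ Ψ₁ t)) →
        (∀ t > 0, PoincareSobolev U φ α a cP (bar p₂ Ψ₂ t) (gradBar p₂ Ψ₂ t)) →
        (∀ t > 0, PoincareSobolev U φ α a cP
          (fun x => bar p₁ Ψ₁ t x - bar p₂ Ψ₂ t x)
          (fun x => gradBar p₁ Ψ₁ t x - gradBar p₂ Ψ₂ t x)) →
        limA α Ψ₁ + limA α Ψ₂ = ⊤ →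
        ∀ V : ℝ → ℝ, (IsGeneralV α Ψ₁ Ψ₂ V ∨ IsFiniteBV α Ψ₁ Ψ₂ V) →
        ∫⁻ t in Ioi (1 : ℝ), ENNReal.ofReal (V t ^ (-(aExp α / (2 - aExp α)))) = ⊤ →
        (∀ᶠ t in atTop, DifferentiableAt ℝ (fun s => V s ^ (aExp α / (2 - aExp α))) t) →
        Tendsto (deriv fun s => V s ^ (aExp α / (2 - aExp α))) atTop (𝓝 0) →
        limsup (fun t => wNorm U (W1 α a) (2 - aExp α)
            (fun x => gradBar p₁ Ψ₁ t x - gradBar p₂ Ψ₂ t x) ^ 2) atTop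
          ≤ ENNReal.ofReal C *
              limsup (fun t => ENNReal.ofReal
                ((V t ^ (3 * kappa0 α) * D Ψ₁ Ψ₂ t) ^ (1 / 2 : ℝ))) atTop
            + ENNReal.ofReal C *
              limsup (fun t => ENNReal.ofReal (V t ^ kappa0 α * D Ψ₁ Ψ₂ t)) atTop := by
  obtain ⟨C, hC, hbound⟩ := mainTheorem9_general hN α hα0 hα cP hcP
  exact ⟨C, hC, fun φ a hm p₁ p₂ Ψ₁ Ψ₂ p₀₁ p₀₂ h₁ h₂ hPS₁ hPS₂ hPS _ =>
    hbound hUo.measurableSet φ a hm p₁ p₂ Ψ₁ Ψ₂ p₀₁ p₀₂ h₁ h₂ hPS₁ hPS₂ hPS⟩
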